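/- Let $\mathbb{O}\cong\mathbb{R}^8$ be the octonions with basis $e_0=1,e_1,\dots,e_7$ (where $e_4=e_1e_2$, $e_5=e_1e_3$, $e_6=e_2e_3$, $e_7=e_4e_3$), and let $\mathcal D=\partial_{x_0}+\sum_{i=1}^7 e_i\partial_{x_i}$; a real differentiable $F$ is left monogenic if $\mathcal DF=0$. Let $\Omega$ be one of the following domains, with outward unit normal $n$, scalar surface measure $|d\sigma|$ on $\partial\Omega$, and explicit kernel $S$: - the unit ball $B_8(0,1)$, with $S(x,y)=\dfrac{1-\overline{x}y}{|1-\overline{x}y|^8}$; - the half-space $H^+(\mathbb{O})=\{x_0>0\}$, with $S(x,y)=\dfrac{\overline{x}+y}{|\overline{x}+y|^8}$; - the strip $T=\{0<x_0<d\}$, $d>0$, with $S(x,y)=\displaystyle\sum_{n\in\mathbb{Z}}(-1)^n\frac{\overline{x}+y+2dn}{|\overline{x}+y+2dn|^8}$. For $f,g\in L^2(\partial\Omega,\mathbb{O})$ put $$(f,g)=\frac{3}{\pi^4}\int_{\partial\Omega}\overline{(n(x)g(x))}\,(n(x)f(x))\,|d\sigma(x)|,$$ and let $\langle f,g\rangle_i$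 be the $i$-th real component of $(f,g)$, so that $\langle f,g\rangle_0=\mathrm{Re}(f,g)$. Let $A(\Omega)$ be the set of functions that are continuous on $\overline\Omega$, left monogenic in $\Omega$, square-integrable on $\partial\Omega$, and whose $L^2$ norms on the parallel surfaces $\{x-s\,n(x):x\in\partial\Omega\}\subset\Omega$ are bounded uniformly in $s>0$. The Hardy space $H^2(\Omega,\mathbb{O})$ is the closure in $L^2(\partial\Omega,\mathbb{O})$ of the boundary functions of $A(\Omega)$. A left monogenic function $F$ in $\Omega$ belongs to $f\in H^2(\Omega,\mathbb O)$ if some sequence in $A(\Omega)$ converges to $F$ pointwise in $\Omega$ and to $f$ in $L^2(\partial\Omega)$. For component kernels $S_0,\dots,S_7$, the total Szegő projection is $[\mathcal Sf](y)=\sum_{i=0}^7\langle f,S_i(\cdot,y)\rangle_i\,e_i$ for $f\in L^2(\partial\Omega,\mathbb O)$, $y\in\Omega$. In each of the three cases the following hold. 1. $\overline{S(x,y)}=S(y,x)$ for all $x,y$. 2. For every $y\in\Omega$ we have $S(\cdot,y)\in A(\Omega)$; and $S_i=S$ is a component kernel for each $i=0,\dots,7$: if the monogenic function $F$ belongs to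 $f\in H^2(\Omega,\mathbb{O})$, then $\langle f,S(\cdot,y)\rangle_i=F_i(y)$. 3. With $S_i=S$ for all $i$, the total Szegő projection defines a bounded $\mathbb{R}$-linear operator $P$ on $L^2(\partial\Omega,\mathbb{O})$: for every $f$, the element $Pf$ is the $L^2(\partial\Omega)$-limit of $x\mapsto[\mathcal Sf](x-s\,n(x))$ as $s\to0^+$, and $\mathcal Sf$ is left monogenic in $\Omega$ and belongs to $Pf\in H^2(\Omega,\mathbb{O})$. 4. This operator is self-adjoint, $\langle Pf,g\rangle_0=\langle f,Pg\rangle_0$ for all $f,g\in L^2(\partial\Omega,\mathbb O)$, and hence it is the orthogonal projector onto $H^2(\Omega,\mathbb{O})$ with respect to $\langle\cdot,\cdot\rangle_0$: $P^2=P$, the range of $P$ is $H^2(\Omega,\mathbb{O})$, and $\langle f-Pf,h\rangle_0=0$ for all $f\in L^2(\partial\Omega,\mathbb O)$ and $h\in H^2(\Omega,\mathbb{O})$. -/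

import Mathlib

open MeasureTheory Filter Topology Set
open scoped ENNReal NNReal

noncomputable section

/-! ### Octonions -/

/-- The octonions as the Euclidean space `ℝ⁸` (with its Euclidean norm and Lebesgue measure);
`x 0` is the real part and `x 1, …, x 7` are the coordinates along `e₁, …, e₇`. -/
abbrev Oct : Type := EuclideanSpace ℝ (Fin 8)

/-- The basis elements `e₀ = 1, e₁, …, e₇`. -/
def octE (i : Fin 8) : Oct := EuclideanSpace.single i 1

/-- Octonionic multiplication, determined by `e₄ = e₁e₂`, `e₅ = e₁e₃`, `e₆ = e₂e₃`,
`e₇ = e₄e₃ = (e₁e₂)e₃`. -/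
def omul (x y : Oct) : Oct :=
  !₂[
    x 0 * y 0 - x 1 * y 1 - x 2 * y 2 - x 3 * y 3 - x 4 * y 4 - x 5 * y 5 - x 6 * y 6 - x 7 * y 7,
    x 0 * y 1 + x 1 * y 0 + x 2 * y 4 + x 3 * y 5 - x 4 * y 2 - x 5 * y 3 - x 6 * y 7 + x 7 * y 6,
    x 0 * y 2 - x 1 * y 4 + x 2 * y 0 + x 3 * y 6 + x 4 * y 1 + x 5 * y 7 - x 6 * y 3 - x 7 * y 5,
    x 0 * y 3 - x 1 * y 5 - x 2 * y 6 + x 3 * y 0 - x 4 * y 7 + x 5 * y 1 + x 6 * y 2 + x 7 * y 4,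
    x 0 * y 4 + x 1 * y 2 - x 2 * y 1 + x 3 * y 7 + x 4 * y 0 - x 5 * y 6 + x 6 * y 5 - x 7 * y 3,
    x 0 * y 5 + x 1 * y 3 - x 2 * y 7 - x 3 * y 1 + x 4 * y 6 + x 5 * y 0 - x 6 * y 4 + x 7 * y 2,
    x 0 * y 6 + x 1 * y 7 + x 2 * y 3 - x 3 * y 2 - x 4 * y 5 + x 5 * y 4 + x 6 * y 0 - x 7 * y 1,
    x 0 * y 7 - x 1 * y 6 + x 2 * y 5 - x 3 * y 4 + x 4 * y 3 - x 5 * y 2 + x 6 * y 1 + x 7 * y 0]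

infixl:70 " ⬝ₒ " => omul

/-- Octonionic conjugation `x₀ - x₁e₁ - ⋯ - x₇e₇`. -/
def oconj (x : Oct) : Oct :=
  !₂[x 0, -x 1, -x 2, -x 3, -x 4, -x 5, -x 6, -x 7]

/-! ### Monogenic functions -/

/-- The left Cauchy-Riemann operator `(𝒟F)(x) = ∂F/∂x₀ + ∑ᵢ eᵢ ∂F/∂xᵢ`. -/
def cauchyRiemann (F : Oct → Oct) (x : Oct) : Oct :=
  ∑ i : Fin 8, octE i ⬝ₒ fderiv ℝ F x (octE i)

/-- `F` is left octonionic monogenic on the open set `U`. -/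
def LeftMonogenicOn (F : Oct → Oct) (U : Set Oct) : Prop :=
  DifferentiableOn ℝ F U ∧ ∀ x ∈ U, cauchyRiemann F x = 0

/-! ### Domains with their surface measure and outward unit normal -/

/-- The data of a domain used for Hardy spaces: the open set, the scalar surface measure `|dσ|` of
its boundary (a measure on `Oct` carried by the boundary) and the outward unit normal field. -/
structure HardyDomain where
  carrier : Set Oct
  surface : Measure Oct
  normal : Oct → Oct

/-- The unit ball `B₈(0,1)`, with the surface measure of `S⁷` and `n(x) = x`. -/
def unitBall : HardyDomain where
  carrier := Metric.ball 0 1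
  surface := (volume : Measure Oct).toSphere.map Subtype.val
  normal := fun x => x

/-- Lebesgue measure `dx₁ ⋯ dx₇` on the hyperplane `x₀ = c`. -/
def hyperplaneMeasure (c : ℝ) : Measure Oct :=
  (volume : Measure (Fin 7 → ℝ)).map (fun ξ => (WithLp.toLp 2 (Fin.cons c ξ : Fin 8 → ℝ) : Oct))

/-- The right half-space `x₀ > 0`, with `n = -1`. -/
def halfSpace : HardyDomain where
  carrier := {x | 0 < x 0}
  surface := hyperplaneMeasure 0
  normal := fun _ => -octE 0

/-- The strip `0 < x₀ < d`, with `n = -1` on `x₀ = 0` and `n = 1` on `x₀ = d`. -/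
def strip (d : ℝ) : HardyDomain where
  carrier := {x | 0 < x 0 ∧ x 0 < d}
  surface := hyperplaneMeasure 0 + hyperplaneMeasure d
  normal := fun x => if x 0 = 0 then -octE 0 else octE 0

/-! ### The explicit Szegő kernels -/

/-- `S(x,y) = (1 - x̄y) / |1 - x̄y|⁸`. -/
def ballKernel (x y : Oct) : Oct :=
  (‖octE 0 - oconj x ⬝ₒ y‖ ^ 8)⁻¹ • (octE 0 - oconj x ⬝ₒ y)

/-- `S(x,y) = (x̄ + y) / |x̄ + y|⁸`. -/
def halfSpaceKernel (x y : Oct) : Oct :=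
  (‖oconj x + y‖ ^ 8)⁻¹ • (oconj x + y)

/-- `S(x,y) = ∑_{n ∈ ℤ} (-1)ⁿ (x̄ + y + 2dn) / |x̄ + y + 2dn|⁸`. -/
def stripKernel (d : ℝ) (x y : Oct) : Oct :=
  ∑' n : ℤ, ((-1 : ℝ) ^ n * (‖oconj x + y + (2 * d * n) • octE 0‖ ^ 8)⁻¹) •
    (oconj x + y + (2 * d * n) • octE 0)

/-! ### Inner products -/

/-- The octonion-valued inner product
`(f,g) = 3/π⁴ ∫ conj(n(x) g(x)) (n(x) f(x)) |dσ(x)|` over the boundary. -/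
def octInner (D : HardyDomain) (f g : Oct → Oct) : Oct :=
  (3 / Real.pi ^ 4) • ∫ x, oconj (D.normal x ⬝ₒ g x) ⬝ₒ (D.normal x ⬝ₒ f x) ∂D.surface

/-- The real-valued inner product `⟨f,g⟩ᵢ`, the `i`-th real component of `(f,g)`;
`⟨f,g⟩₀ = Re (f,g)`. -/
def compInner (D : HardyDomain) (i : Fin 8) (f g : Oct → Oct) : ℝ :=
  octInner D f g i

/-! ### Hardy spaces -/

/-- `L²(∂Ω)` with values in the octonions. -/
abbrev BoundaryL2 (D : HardyDomain) : Type := Lp Oct 2 D.surface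

/-- The functions generating the Hardy space: continuous on the closure, left monogenic inside,
square-integrable on the boundary, with `L²` norms uniformly bounded on the inner parallel surfaces
`{x - s n(x) : x ∈ ∂Ω}` that lie inside. The last requirement is automatic on a bounded
domain; on an unbounded one it is the usual Hardy condition. -/
structure IsHardyCore (D : HardyDomain) (F : Oct → Oct) : Prop where
  monogenic : LeftMonogenicOn F D.carrier
  continuousOn : ContinuousOn F (closure D.carrier)
  memLp : MemLp F 2 D.surface
  bounded : ∃ C : ℝ≥0, ∀ s : ℝ, 0 < s →
    (∀ x ∈ frontier D.carrier, x - s • D.normal x ∈ D.carrier) →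
      ∫⁻ x, ‖F (x - s • D.normal x)‖ₑ ^ 2 ∂D.surface ≤ C

/-- The Hardy space `H²(Ω, 𝕆)` as the closure in `L²(∂Ω)` of the boundary functions. -/
def hardySpace (D : HardyDomain) : Set (BoundaryL2 D) :=
  closure {f | ∃ F : Oct → Oct, IsHardyCore D F ∧ f =ᵐ[D.surface] F}

/-- `F` is the left monogenic function in `Ω` that belongs to the element `f` of the Hardy space:
it is the pointwise limit in `Ω` of generating functions whose boundary functions tend to `f`. -/
def IsHardyExtension (D : HardyDomain) (f : BoundaryL2 D) (F : Oct → Oct) : Prop :=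
  LeftMonogenicOn F D.carrier ∧
    ∃ u : ℕ → Oct → Oct, (∀ k, IsHardyCore D (u k)) ∧
      Tendsto (fun k => eLpNorm (fun x => u k x - f x) 2 D.surface) atTop (𝓝 0) ∧
      ∀ y ∈ D.carrier, Tendsto (fun k => u k y) atTop (𝓝 (F y))

/-! ### The total Szegő projection -/

/-- The total Szegő projection `[𝒮f](y) = ∑ᵢ ⟨f, Sᵢ(·,y)⟩ᵢ eᵢ` built from component kernels `Sᵢ`. -/
def totalSzego (D : HardyDomain) (S : Fin 8 → Oct → Oct → Oct) (f : Oct → Oct) (y : Oct) : Oct :=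
  ∑ i : Fin 8, compInner D i f (fun x => S i x y) • octE i

/-- `S` is a reproducing kernel for the `i`-th real component of the Hardy functions
with respect to `⟨·,·⟩ᵢ`. -/
def IsComponentKernel (D : HardyDomain) (i : Fin 8) (S : Oct → Oct → Oct) : Prop :=
  ∀ y ∈ D.carrier, IsHardyCore D (fun x => S x y) ∧
    ∀ (f : BoundaryL2 D) (F : Oct → Oct), f ∈ hardySpace D → IsHardyExtension D f F →
      compInner D i f (fun x => S x y) = F y i

/-- `f` is the `L²` boundary function of the function `F` in `Ω`, approached along the normals. -/
def HasBoundaryValue (D : HardyDomain) (F : Oct → Oct) (f : BoundaryL2 D) : Prop :=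
  Tendsto (fun s : ℝ => eLpNorm (fun x => F (x - s • D.normal x) - f x) 2 D.surface)
    (𝓝[>] 0) (𝓝 0)

end

/-! ### Octonion algebra -/

/-! Since all eight component kernels equal `S`, the total Szegő projection at `y` is the octonion
(f, S(·,y)). Tested against a vector v it becomes (3/π⁴) ∫ ⟨f, n̄((n S(·,y)) v)⟩, using only that
left multiplication by a has adjoint left multiplication by ā. In each of the three cases the
boundary field n̄((nS)v) is the trace of a function `K y v` in A(Ω), and Cauchy's formula gives ∫
⟨u, K y v⟩ = (π⁴/3) ⟨u(y), v⟩ for every u in A(Ω). So the `K y v` form a reproducing system for a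
real Hilbert space, and P is the orthogonal projection onto the closed real span N of this system.
Self-adjointness and idempotence are then automatic. `IsSzegoSystem` lists what has to be verified
per domain, and `IsSzegoSystem.main` draws the conclusions.

The analytic point is that N is all of H² and that the interior function has P f as its boundary
value. Point evaluation is locally uniformly bounded on L², so L² limits from the span give locally
uniform limits inside Ω, which are again monogenic. The span satisfies an L² bound along parallel
surfaces that does not depend on the element; a three-term estimate then gives L² boundary values
for all of N. If u lies in A(Ω) and p is the projection of its trace onto N, the Szegő transform of
p equals u inside Ω. It tends to p in L² and to u pointwise at the boundary, so Fatou's lemma yields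
u = p (`core_mem_closure`).

Non-associativity is avoided by working with real scalar fields ⟨eᵢ u, W⟩. Their divergence vanishes
when 𝒟u = 0 and the conjugate operator annihilates W, and the only product law needed is x̄(xv) =
|x|²v. The kernel xv/|x|⁸ is such a W off the origin. Regularised to xv/(ε² + |x|²)⁴, it produces an
approximate identity of mass π⁴/3, and the divergence theorem with cutoffs gives Cauchy's formula on
the ball (`ball_cauchy`) and on slabs (`slab_cauchy`).

For the ball and the half-space the parallel bound comes from a symmetric semigroup. Dilating or
shifting x in `K y v` does the same to y, so ⟨u_s, w_t⟩ = ⟨u_{s+t}, w⟩ on the span, with products of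
dilation factors in place of sums for the ball. Hence ‖w_s‖² ≤ (‖w‖² + ‖w_{2s}‖²)/2, and iterating
this with a uniform bound on ‖w_s‖ gives ‖w_s‖ ≤ ‖w‖.

For the strip, the kernel is an alternating sum over images. On the two faces its terms pair up into
dual kernels with common poles y + 2dm: m = 0 gives Cauchy's formula and every m ≠ 0 cancels by
Cauchy's theorem (`strip_reproducing`). In place of a semigroup there is the reflection x ↦ s + t −
x̄, which turns a monogenic w into a solution of the dual equation. Pairing w with its reflection
shows that ∫ |w|² over slices is midpoint convex, so each slice is controlled by the two faces
(`norm_sq_slice_le`). -/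

lemma oct_inner_eq_sum (x y : Oct) : inner ℝ x y = ∑ i, x i * y i := by
  simp [PiLp.inner_apply, mul_comm]

lemma oct_norm_sq (x : Oct) : ‖x‖ ^ 2 = ∑ i, x i ^ 2 := by
  simp [EuclideanSpace.norm_sq_eq]

lemma omul_add (x y z : Oct) : x ⬝ₒ (y + z) = x ⬝ₒ y + x ⬝ₒ z := by
  ext i; fin_cases i <;> simp [omul] <;> ring

lemma add_omul (x y z : Oct) : (x + y) ⬝ₒ z = x ⬝ₒ z + y ⬝ₒ z := by
  ext i; fin_cases i <;> simp [omul] <;> ring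

lemma omul_smul (c : ℝ) (x y : Oct) : x ⬝ₒ (c • y) = c • (x ⬝ₒ y) := by
  ext i; fin_cases i <;> simp [omul] <;> ring

lemma smul_omul (c : ℝ) (x y : Oct) : (c • x) ⬝ₒ y = c • (x ⬝ₒ y) := by
  ext i; fin_cases i <;> simp [omul] <;> ring

/-- Octonionic multiplication as a continuous bilinear map. -/
noncomputable def omulL : Oct →L[ℝ] Oct →L[ℝ] Oct :=
  (LinearMap.mk₂ ℝ omul add_omul smul_omul omul_add omul_smul).toContinuousBilinearMap

@[simp] lemma omulL_apply (x y : Oct) : omulL x y = x ⬝ₒ y := rfl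

/-- Octonionic conjugation as a continuous linear map. -/
noncomputable def oconjL : Oct →L[ℝ] Oct :=
  LinearMap.toContinuousLinearMap
    { toFun := oconj
      map_add' := fun x y => by ext i; fin_cases i <;> simp [oconj] <;> ring
      map_smul' := fun c x => by ext i; fin_cases i <;> simp [oconj] }

@[simp] lemma oconjL_apply (x : Oct) : oconjL x = oconj x := rfl

lemma oconj_add (x y : Oct) : oconj (x + y) = oconj x + oconj y := oconjL.map_add x y
lemma oconj_sub (x y : Oct) : oconj (x - y) = oconj x - oconj y := oconjL.map_sub x y
lemma oconj_neg (x : Oct) : oconj (-x) = -oconj x := oconjL.map_neg x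
lemma oconj_smul (c : ℝ) (x : Oct) : oconj (c • x) = c • oconj x := oconjL.map_smul c x

lemma omul_sub (x y z : Oct) : x ⬝ₒ (y - z) = x ⬝ₒ y - x ⬝ₒ z := (omulL x).map_sub y z
lemma omul_neg (x y : Oct) : x ⬝ₒ (-y) = -(x ⬝ₒ y) := (omulL x).map_neg y
lemma omul_zero (x : Oct) : x ⬝ₒ 0 = 0 := (omulL x).map_zero
lemma sub_omul (x y z : Oct) : (x - y) ⬝ₒ z = x ⬝ₒ z - y ⬝ₒ z := by
  rw [← omulL_apply, map_sub]; rfl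
lemma neg_omul (x y : Oct) : (-x) ⬝ₒ y = -(x ⬝ₒ y) := by
  rw [← omulL_apply, map_neg]; rfl
lemma zero_omul (y : Oct) : (0 : Oct) ⬝ₒ y = 0 := by
  rw [← omulL_apply, map_zero]; rfl

lemma octE_apply (i j : Fin 8) : octE i j = if j = i then 1 else 0 := by
  simp [octE]

@[simp] lemma one_omul (y : Oct) : octE 0 ⬝ₒ y = y := by
  ext i; fin_cases i <;> simp [omul, octE]

@[simp] lemma omul_one (y : Oct) : y ⬝ₒ octE 0 = y := by
  ext i; fin_cases i <;> simp [omul, octE]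

@[simp] lemma oconj_oconj (x : Oct) : oconj (oconj x) = x := by
  ext i; fin_cases i <;> simp [oconj]

@[simp] lemma oconj_one : oconj (octE 0) = octE 0 := by
  ext i; fin_cases i <;> simp [oconj, octE]

lemma oconj_omul (x y : Oct) : oconj (x ⬝ₒ y) = oconj y ⬝ₒ oconj x := by
  ext i; fin_cases i <;> simp [omul, oconj] <;> ring

@[simp] lemma norm_oconj (x : Oct) : ‖oconj x‖ = ‖x‖ := by
  rw [← sq_eq_sq₀ (norm_nonneg _) (norm_nonneg _), oct_norm_sq, oct_norm_sq]
  simp [Fin.sum_univ_eight, oconj]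

/-- Left alternativity in the form that replaces associativity: all later regrouping of products
rests on this law and on adjoints. -/
lemma oconj_omul_omul (x y : Oct) : oconj x ⬝ₒ (x ⬝ₒ y) = ‖x‖ ^ 2 • y := by
  rw [oct_norm_sq, Fin.sum_univ_eight]
  ext i; fin_cases i <;> simp [omul, oconj] <;> ring

lemma omul_oconj_omul (x y : Oct) : x ⬝ₒ (oconj x ⬝ₒ y) = ‖x‖ ^ 2 • y := by
  simpa using oconj_omul_omul (oconj x) y

/-- Moves an octonion factor across the real inner product without any regrouping of products; it is
what makes an integration by parts possible. -/
lemma inner_omul_left (a x y : Oct) : inner ℝ (a ⬝ₒ x) y = inner ℝ x (oconj a ⬝ₒ y) := by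
  simp only [oct_inner_eq_sum, Fin.sum_univ_eight]
  simp [omul, oconj]; ring

lemma inner_omul_omul (a x y : Oct) : inner ℝ (a ⬝ₒ x) (a ⬝ₒ y) = ‖a‖ ^ 2 * inner ℝ x y := by
  rw [inner_omul_left, oconj_omul_omul, inner_smul_right]

@[simp] lemma norm_omul (x y : Oct) : ‖x ⬝ₒ y‖ = ‖x‖ * ‖y‖ := by
  rw [← sq_eq_sq₀ (norm_nonneg _) (by positivity), ← real_inner_self_eq_norm_sq, inner_omul_omul,
    real_inner_self_eq_norm_sq]; ring

lemma octE_sum (x : Oct) : ∑ i, x i • octE i = x := by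
  ext j; fin_cases j <;> simp [Fin.sum_univ_eight, octE]

@[simp] lemma norm_octE (i : Fin 8) : ‖octE i‖ = 1 := by simp [octE]

lemma inner_octE_left (i : Fin 8) (x : Oct) : inner ℝ (octE i) x = x i := by
  simp [octE, EuclideanSpace.inner_single_left]

lemma inner_octE_right (i : Fin 8) (x : Oct) : inner ℝ x (octE i) = x i := by
  rw [real_inner_comm, inner_octE_left]

lemma omul_apply_zero_oconj (x y : Oct) : (oconj x ⬝ₒ y) 0 = inner ℝ x y := by
  simp only [oct_inner_eq_sum, Fin.sum_univ_eight]
  simp [omul, oconj]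

@[fun_prop] lemma continuous_oconj : Continuous oconj := oconjL.continuous

@[fun_prop] lemma Continuous.omul {α : Type*} [TopologicalSpace α] {f g : α → Oct}
    (hf : Continuous f) (hg : Continuous g) : Continuous fun a => f a ⬝ₒ g a :=
  (omulL.continuous.comp hf).clm_apply hg

@[fun_prop] lemma ContinuousOn.omul {α : Type*} [TopologicalSpace α] {f g : α → Oct} {s : Set α}
    (hf : ContinuousOn f s) (hg : ContinuousOn g s) : ContinuousOn (fun a => f a ⬝ₒ g a) s :=
  (omulL.continuous.comp_continuousOn hf).clm_apply hg

/-! ### Cauchy-Riemann operators -/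

/-- The symbol of `𝒟`, as a functional of the derivative. -/
noncomputable def crSymbol : (Oct →L[ℝ] Oct) →L[ℝ] Oct :=
  LinearMap.toContinuousLinearMap
    { toFun := fun A => ∑ i : Fin 8, octE i ⬝ₒ A (octE i)
      map_add' := fun A B => by simp [omul_add, Finset.sum_add_distrib]
      map_smul' := fun c A => by simp [omul_smul, Finset.smul_sum] }

lemma crSymbol_apply (A : Oct →L[ℝ] Oct) : crSymbol A = ∑ i : Fin 8, octE i ⬝ₒ A (octE i) := rfl

lemma cauchyRiemann_eq (F : Oct → Oct) (x : Oct) : cauchyRiemann F x = crSymbol (fderiv ℝ F x) := rfl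

/-- The symbol of the conjugate operator `∂₀ - ∑ eᵢ ∂ᵢ`. -/
noncomputable def crBarSymbol : (Oct →L[ℝ] Oct) →L[ℝ] Oct :=
  LinearMap.toContinuousLinearMap
    { toFun := fun A => ∑ i : Fin 8, oconj (octE i) ⬝ₒ A (octE i)
      map_add' := fun A B => by simp [omul_add, Finset.sum_add_distrib]
      map_smul' := fun c A => by simp [omul_smul, Finset.smul_sum] }

lemma crBarSymbol_apply (A : Oct →L[ℝ] Oct) :
    crBarSymbol A = ∑ i : Fin 8, oconj (octE i) ⬝ₒ A (octE i) := rfl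

/-- For a scalar function with gradient x times a constant c, the operator 𝒟 acts by left
multiplication with x. -/
lemma crSymbol_smulRight (x : Oct) (c : Oct) :
    crSymbol ((innerSL ℝ x).smulRight c) = x ⬝ₒ c := by
  rw [crSymbol_apply]
  conv_rhs => rw [← octE_sum x, ← omulL_apply, map_sum]
  simp [inner_octE_right, omul_smul]

lemma crBarSymbol_smulRight (x : Oct) (c : Oct) :
    crBarSymbol ((innerSL ℝ x).smulRight c) = oconj x ⬝ₒ c := by
  rw [crBarSymbol_apply]
  conv_rhs => rw [← octE_sum x, ← oconjL_apply, map_sum, ← omulL_apply, map_sum]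
  simp [inner_octE_right, omul_smul]

/-- Each of the eight terms is eᵢ(ēᵢ c) = c by alternativity. -/
lemma crSymbol_oconj_omul (c : Oct) : crSymbol ((omulL.flip c).comp oconjL) = (8 : ℝ) • c := by
  rw [crSymbol_apply]
  simp only [ContinuousLinearMap.comp_apply, ContinuousLinearMap.flip_apply, omulL_apply,
    oconjL_apply, omul_oconj_omul, norm_octE]
  simp [← Nat.cast_smul_eq_nsmul ℝ]

lemma crBarSymbol_omul (c : Oct) : crBarSymbol (omulL.flip c) = (8 : ℝ) • c := by
  rw [crBarSymbol_apply]
  simp only [ContinuousLinearMap.flip_apply, omulL_apply, oconj_omul_omul, norm_octE]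
  simp [← Nat.cast_smul_eq_nsmul ℝ]

lemma LeftMonogenicOn.crSymbol_eq_zero {F : Oct → Oct} {U : Set Oct} (h : LeftMonogenicOn F U)
    {x : Oct} (hx : x ∈ U) : crSymbol (fderiv ℝ F x) = 0 := h.2 x hx

lemma leftMonogenicOn_of_hasFDerivAt {F : Oct → Oct} {U : Set Oct}
    (h : ∀ x ∈ U, ∃ A : Oct →L[ℝ] Oct, HasFDerivAt F A x ∧ crSymbol A = 0) :
    LeftMonogenicOn F U := by
  refine ⟨fun x hx => ?_, fun x hx => ?_⟩
  · obtain ⟨A, hA, -⟩ := h x hx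
    exact hA.differentiableAt.differentiableWithinAt
  · obtain ⟨A, hA, hA0⟩ := h x hx
    rw [cauchyRiemann_eq, hA.fderiv, hA0]

lemma LeftMonogenicOn.hasFDerivAt {F : Oct → Oct} {U : Set Oct} (h : LeftMonogenicOn F U)
    (hU : IsOpen U) {x : Oct} (hx : x ∈ U) : HasFDerivAt F (fderiv ℝ F x) x :=
  ((h.1 x hx).differentiableAt (hU.mem_nhds hx)).hasFDerivAt

lemma LeftMonogenicOn.mono {F : Oct → Oct} {U V : Set Oct} (h : LeftMonogenicOn F U)
    (hVU : V ⊆ U) : LeftMonogenicOn F V :=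
  ⟨h.1.mono hVU, fun x hx => h.2 x (hVU hx)⟩

lemma LeftMonogenicOn.add {F G : Oct → Oct} {U : Set Oct} (hU : IsOpen U)
    (hF : LeftMonogenicOn F U) (hG : LeftMonogenicOn G U) :
    LeftMonogenicOn (fun x => F x + G x) U :=
  leftMonogenicOn_of_hasFDerivAt fun x hx => ⟨_, (hF.hasFDerivAt hU hx).add (hG.hasFDerivAt hU hx),
    by rw [map_add, hF.crSymbol_eq_zero hx, hG.crSymbol_eq_zero hx, add_zero]⟩

lemma LeftMonogenicOn.const_smul {F : Oct → Oct} {U : Set Oct} (hU : IsOpen U)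
    (hF : LeftMonogenicOn F U) (c : ℝ) : LeftMonogenicOn (fun x => c • F x) U :=
  leftMonogenicOn_of_hasFDerivAt fun x hx => ⟨_, (hF.hasFDerivAt hU hx).const_smul c,
    by rw [map_smul, hF.crSymbol_eq_zero hx, smul_zero]⟩

/-- Precomposition with `x ↦ a + r x` preserves monogenicity. -/
lemma LeftMonogenicOn.comp_affine {F : Oct → Oct} {U V : Set Oct} (hU : IsOpen U)
    (hF : LeftMonogenicOn F U) (a : Oct) (r : ℝ) (hV : ∀ x ∈ V, a + r • x ∈ U) :
    LeftMonogenicOn (fun x => F (a + r • x)) V :=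
  leftMonogenicOn_of_hasFDerivAt fun x hx => by
    have h1 : HasFDerivAt (fun x : Oct => a + r • x) (r • ContinuousLinearMap.id ℝ Oct) x :=
      ((hasFDerivAt_id x).const_smul r).const_add a
    refine ⟨_, (hF.hasFDerivAt hU (hV x hx)).comp x h1, ?_⟩
    rw [ContinuousLinearMap.comp_smul, ContinuousLinearMap.comp_id, map_smul,
      hF.crSymbol_eq_zero (hV x hx), smul_zero]

/-! ### The Cauchy kernel -/

/-- The regularised kernel `(ε² + |x|²)⁻⁴ x v`; for `ε = 0` it is `x v / |x|⁸`. -/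
noncomputable def dualKernel (ε : ℝ) (v x : Oct) : Oct := ((ε ^ 2 + ‖x‖ ^ 2) ^ 4)⁻¹ • (x ⬝ₒ v)

lemma dualKernel_zero (v x : Oct) : dualKernel 0 v x = (‖x‖ ^ 8)⁻¹ • (x ⬝ₒ v) := by
  simp only [dualKernel]
  congr 2
  ring

lemma hasFDerivAt_regularised_inv_pow {ε : ℝ} {x : Oct} (h : ε ^ 2 + ‖x‖ ^ 2 ≠ 0) :
    HasFDerivAt (fun x : Oct => ((ε ^ 2 + ‖x‖ ^ 2) ^ 4)⁻¹)
      ((-(8 * ((ε ^ 2 + ‖x‖ ^ 2) ^ 5)⁻¹)) • innerSL ℝ x) x := by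
  have h1 : HasFDerivAt (fun x : Oct => ‖x‖ ^ 2) ((2 : ℝ) • innerSL ℝ x) x := by
    rw [two_smul, ← two_nsmul]
    exact (hasStrictFDerivAt_norm_sq x).hasFDerivAt
  have h2 : HasDerivAt (fun t : ℝ => ((ε ^ 2 + t) ^ 4)⁻¹) (-(4 * ((ε ^ 2 + ‖x‖ ^ 2) ^ 5)⁻¹))
      (‖x‖ ^ 2) := by
    have h3 := (((hasDerivAt_id (‖x‖ ^ 2)).const_add (ε ^ 2)).pow 4).inv (by simpa using h)
    refine h3.congr_deriv ?_
    simp only [id, Pi.pow_apply]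
    field_simp
    simp [mul_comm]
  have h4 := h2.comp_hasFDerivAt x h1
  rw [smul_smul] at h4
  have h5 : -(4 * ((ε ^ 2 + ‖x‖ ^ 2) ^ 5)⁻¹) * 2 = -(8 * ((ε ^ 2 + ‖x‖ ^ 2) ^ 5)⁻¹) := by ring
  rw [h5] at h4
  exact h4

lemma hasFDerivAt_dualKernel {ε : ℝ} {x : Oct} (h : ε ^ 2 + ‖x‖ ^ 2 ≠ 0) (v : Oct) :
    HasFDerivAt (dualKernel ε v)
      (((ε ^ 2 + ‖x‖ ^ 2) ^ 4)⁻¹ • omulL.flip v +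
        ((-(8 * ((ε ^ 2 + ‖x‖ ^ 2) ^ 5)⁻¹)) • innerSL ℝ x).smulRight (x ⬝ₒ v)) x := by
  exact (hasFDerivAt_regularised_inv_pow h).smul (omulL.flip v).hasFDerivAt

lemma innerSL_smul_smulRight (c : ℝ) (x v : Oct) :
    (c • innerSL ℝ x).smulRight v = c • (innerSL ℝ x).smulRight v := by
  ext1 y; simp [mul_smul]

/-- The linear factor xv contributes 8(ε² + |x|²)⁻⁴ v and the radial factor −8|x|²(ε² + |x|²)⁻⁵ v.
Since the dimension 8 is twice the exponent 4, only the bump with numerator 8ε² survives; for ε = 0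
the kernel solves the dual equation off the origin. -/
lemma crBarSymbol_fderiv_dualKernel {ε : ℝ} {x : Oct} (h : ε ^ 2 + ‖x‖ ^ 2 ≠ 0) (v : Oct) :
    crBarSymbol (fderiv ℝ (dualKernel ε v) x) =
      (8 * ε ^ 2 * ((ε ^ 2 + ‖x‖ ^ 2) ^ 5)⁻¹) • v := by
  rw [(hasFDerivAt_dualKernel h v).fderiv, map_add, map_smul, innerSL_smul_smulRight, map_smul,
    crBarSymbol_omul, crBarSymbol_smulRight, oconj_omul_omul, smul_smul, smul_smul, ← add_smul]
  congr 1
  field_simp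
  ring

/-- `q(x) v = x̄ v / |x|⁸`, the Cauchy kernel times a constant. -/
noncomputable def cauchyKernel (v x : Oct) : Oct := (‖x‖ ^ 8)⁻¹ • (oconj x ⬝ₒ v)

lemma exists_hasFDerivAt_cauchyKernel {x : Oct} (h : x ≠ 0) (v : Oct) :
    ∃ A, HasFDerivAt (cauchyKernel v) A x ∧ crSymbol A = 0 := by
  have h' : (0 : ℝ) ^ 2 + ‖x‖ ^ 2 ≠ 0 := by simpa using h
  have h1 := (hasFDerivAt_regularised_inv_pow h').smul ((omulL.flip v).comp oconjL).hasFDerivAt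
  refine ⟨_, h1.congr_of_eventuallyEq (Eventually.of_forall fun z => ?_), ?_⟩
  · simp [cauchyKernel, ← pow_mul]
  · rw [map_add, map_smul, innerSL_smul_smulRight, map_smul, crSymbol_oconj_omul, crSymbol_smulRight]
    simp only [ContinuousLinearMap.comp_apply, ContinuousLinearMap.flip_apply, omulL_apply,
      oconjL_apply]
    rw [omul_oconj_omul, smul_smul, smul_smul, ← add_smul]
    convert zero_smul ℝ v
    have : ‖x‖ ≠ 0 := by simpa using h
    field_simp
    ring

lemma leftMonogenicOn_cauchyKernel (v : Oct) : LeftMonogenicOn (cauchyKernel v) {0}ᶜ :=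
  leftMonogenicOn_of_hasFDerivAt fun _ hx => exists_hasFDerivAt_cauchyKernel hx v

lemma norm_cauchyKernel (v x : Oct) : ‖cauchyKernel v x‖ = (‖x‖ ^ 7)⁻¹ * ‖v‖ := by
  rcases eq_or_ne x 0 with rfl | hx
  · simp [cauchyKernel]
  · have : ‖x‖ ≠ 0 := by simpa using hx
    simp [cauchyKernel, norm_smul]
    field_simp

lemma norm_dualKernel_le (ε : ℝ) (v x : Oct) : ‖dualKernel ε v x‖ ≤ (‖x‖ ^ 7)⁻¹ * ‖v‖ := by
  rcases eq_or_ne x 0 with rfl | hx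
  · simp [dualKernel, zero_omul]
  · have h0 : 0 < ‖x‖ := by simpa using hx
    rw [dualKernel, norm_smul, norm_omul, norm_inv, norm_pow, Real.norm_of_nonneg (by positivity),
      ← mul_assoc]
    gcongr
    rw [inv_mul_le_iff₀ (by positivity)]
    calc ‖x‖ = (‖x‖ ^ 2) ^ 4 * (‖x‖ ^ 7)⁻¹ := by field_simp
      _ ≤ _ := by
        gcongr
        nlinarith [sq_nonneg ε]

/-! ### The divergence theorem on slabs -/

/-- The point of the hyperplane `x₀ = c` with the remaining coordinates `ξ`. -/
noncomputable def slicePt (c : ℝ) (ξ : Fin 7 → ℝ) : Oct := WithLp.toLp 2 (Fin.cons c ξ : Fin 8 → ℝ)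

@[simp] lemma slicePt_zero (c : ℝ) (ξ : Fin 7 → ℝ) : slicePt c ξ 0 = c := rfl

@[simp] lemma slicePt_succ (c : ℝ) (ξ : Fin 7 → ℝ) (i : Fin 7) : slicePt c ξ i.succ = ξ i := rfl

/-- The closed slab `a ≤ x₀ ≤ b`. -/
def closedSlab (a b : ℝ) : Set Oct := {x | a ≤ x 0 ∧ x 0 ≤ b}

/-- The open slab `a < x₀ < b`. -/
def openSlab (a b : ℝ) : Set Oct := {x | a < x 0 ∧ x 0 < b}

lemma continuous_oct_apply (i : Fin 8) : Continuous fun x : Oct => x i := by fun_prop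

lemma isClosed_closedSlab (a b : ℝ) : IsClosed (closedSlab a b) :=
  (isClosed_le continuous_const (continuous_oct_apply 0)).inter
    (isClosed_le (continuous_oct_apply 0) continuous_const)

lemma isOpen_openSlab (a b : ℝ) : IsOpen (openSlab a b) :=
  (isOpen_lt continuous_const (continuous_oct_apply 0)).inter
    (isOpen_lt (continuous_oct_apply 0) continuous_const)

lemma openSlab_subset_closedSlab (a b : ℝ) : openSlab a b ⊆ closedSlab a b :=
  fun _ hx => ⟨hx.1.le, hx.2.le⟩

lemma continuous_slicePt : Continuous fun p : ℝ × (Fin 7 → ℝ) => slicePt p.1 p.2 := by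
  refine (PiLp.continuous_toLp 2 _).comp (continuous_pi fun i => ?_)
  refine Fin.cases ?_ (fun j => ?_) i
  · simpa using continuous_fst
  · exact (continuous_apply j).comp continuous_snd

@[fun_prop] lemma continuous_slicePt_right (c : ℝ) : Continuous (slicePt c) :=
  continuous_slicePt.comp (continuous_const.prodMk continuous_id)

/-- Divergence theorem on a slab for a continuous field with bounded horizontal support, which is
only assumed differentiable in the interior. -/
theorem integral_divergence_slab {a b R : ℝ} (hab : a ≤ b) (hR : 0 ≤ R)
    (V : Fin 8 → Oct → ℝ) (V' : Fin 8 → Oct → Oct →L[ℝ] ℝ) (G : Oct → ℝ)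
    (Hc : ∀ i, ContinuousOn (V i) (closedSlab a b))
    (Hd : ∀ x ∈ openSlab a b, ∀ i, HasFDerivAt (V i) (V' i x) x)
    (hG : ∀ x ∈ openSlab a b, G x = ∑ i, V' i x (octE i))
    (hGc : ContinuousOn G (closedSlab a b))
    (hV0 : ∀ i, ∀ x ∈ closedSlab a b, (∃ j : Fin 7, R ≤ |x j.succ|) → V i x = 0)
    (hG0 : ∀ x ∈ closedSlab a b, (∃ j : Fin 7, R ≤ |x j.succ|) → G x = 0) :
    ∫ x in closedSlab a b, G x =
      (∫ ξ : Fin 7 → ℝ, V 0 (slicePt b ξ)) - ∫ ξ : Fin 7 → ℝ, V 0 (slicePt a ξ) := by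
  set lo : Fin 8 → ℝ := Fin.cons a fun _ => -R with hlo
  set hi : Fin 8 → ℝ := Fin.cons b fun _ => R with hhi
  have hle : lo ≤ hi := fun i => by
    refine Fin.cases ?_ (fun j => ?_) i <;> simp [hlo, hhi, hab]
    linarith
  let T : (Fin 8 → ℝ) → Oct := fun x => WithLp.toLp 2 x
  have hTc : Continuous T := PiLp.continuous_toLp 2 _
  let TL : (Fin 8 → ℝ) →L[ℝ] Oct := ((PiLp.continuousLinearEquiv 2 ℝ fun _ : Fin 8 => ℝ).symm :
    (Fin 8 → ℝ) →L[ℝ] Oct)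
  have hTL : ∀ x, TL x = T x := fun x => rfl
  have hTd : ∀ x, HasFDerivAt T TL x := fun x => TL.hasFDerivAt
  have hmaps : MapsTo T (Icc lo hi) (closedSlab a b) := fun x hx => by
    have h1 := hx.1 0
    have h2 := hx.2 0
    simp only [hlo, hhi, Fin.cons_zero] at h1 h2
    exact ⟨h1, h2⟩
  have hint : ∀ x ∈ Set.pi univ fun i => Ioo (lo i) (hi i), T x ∈ openSlab a b := fun x hx => by
    have h1 := hx 0 (mem_univ _)
    simp only [hlo, hhi, Fin.cons_zero] at h1
    exact h1
  -- The derivatives are known only in the open box, while continuity, hence integrability, of `G`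
  -- is known on the closed one; the two boxes differ by a null set.
  have hae : (Set.pi univ fun i => Ioo (lo i) (hi i)) =ᵐ[volume] Icc lo hi := by
    rw [volume_pi]; exact Measure.univ_pi_Ioo_ae_eq_Icc
  have hsingle : ∀ i, TL (Pi.single i 1) = octE i := fun i => rfl
  have hGint : IntegrableOn (fun x => G (T x)) (Icc lo hi) :=
    (hGc.comp hTc.continuousOn hmaps).integrableOn_compact isCompact_Icc
  have hGeq : EqOn (fun x => ∑ i, ((V' i (T x)).comp TL) (Pi.single i 1)) (fun x => G (T x))
      (Set.pi univ fun i => Ioo (lo i) (hi i)) := fun x hx => by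
    simp only [ContinuousLinearMap.comp_apply, hsingle]
    exact (hG _ (hint x hx)).symm
  have hmeas : MeasurableSet (Set.pi univ fun i => Ioo (lo i) (hi i)) :=
    MeasurableSet.univ_pi fun i => measurableSet_Ioo
  have key := integral_divergence_of_hasFDerivAt_off_countable' lo hi hle
    (fun i x => V i (T x)) (fun i x => (V' i (T x)).comp TL) ∅ countable_empty
    (fun i => (Hc i).comp hTc.continuousOn hmaps)
    (fun x hx i => (Hd _ (hint x hx.1) i).comp x (hTd x)) (by
      rw [← integrableOn_congr_set_ae hae, integrableOn_congr_fun hGeq hmeas,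
        integrableOn_congr_set_ae hae]
      exact hGint)
  rw [← setIntegral_congr_set hae, setIntegral_congr_fun hmeas hGeq, setIntegral_congr_set hae]
    at key
  have hL : ∫ x in Icc lo hi, G (T x) = ∫ x in closedSlab a b, G x := by
    rw [← (PiLp.volume_preserving_toLp (Fin 8)).setIntegral_preimage_emb
      (MeasurableEquiv.toLp 2 (Fin 8 → ℝ)).measurableEmbedding]
    symm
    refine setIntegral_eq_of_subset_of_forall_sdiff_eq_zero ?_ hmaps ?_
    · exact (isClosed_closedSlab a b).measurableSet.preimage hTc.measurable
    · intro x hx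
      refine hG0 _ hx.1 ?_
      by_contra hcon
      push Not at hcon
      refine hx.2 ⟨fun i => ?_, fun i => ?_⟩
      · refine Fin.cases ?_ (fun j => ?_) i
        · exact hx.1.1
        · exact (abs_lt.1 (hcon j)).1.le
      · refine Fin.cases ?_ (fun j => ?_) i
        · exact hx.1.2
        · exact (abs_lt.1 (hcon j)).2.le
  rw [hL, Fin.sum_univ_succ] at key
  rw [key]
  have hface : ∀ c, a ≤ c → c ≤ b → ∫ x in Icc (lo ∘ Fin.succAbove 0) (hi ∘ Fin.succAbove 0),
      V 0 (T (Fin.insertNth 0 c x)) = ∫ ξ : Fin 7 → ℝ, V 0 (slicePt c ξ) := fun c hac hcb => by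
    have : ∀ x : Fin 7 → ℝ, T (Fin.insertNth 0 c x) = slicePt c x := fun x => by
      rw [Fin.insertNth_zero']; rfl
    simp only [this]
    refine setIntegral_eq_integral_of_forall_compl_eq_zero fun x hx => ?_
    refine hV0 0 _ ⟨hac, hcb⟩ ?_
    by_contra hcon
    push Not at hcon
    exact hx ⟨fun j => (abs_lt.1 (hcon j)).1.le, fun j => (abs_lt.1 (hcon j)).2.le⟩
  -- The lateral faces lie where some horizontal coordinate has absolute value R, and there the
  -- field vanishes.
  have hside : ∀ i : Fin 7, ∀ c : ℝ, |c| = R → ∫ x in Icc (lo ∘ Fin.succAbove i.succ)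
      (hi ∘ Fin.succAbove i.succ), V i.succ (T (Fin.insertNth i.succ c x)) = 0 := fun i c hc => by
    refine setIntegral_eq_zero_of_forall_eq_zero fun x hx => ?_
    refine hV0 _ _ ?_ ⟨i, ?_⟩
    · have h1 := hx.1 0
      have h2 := hx.2 0
      have h3 : (Fin.insertNth i.succ c x : Fin 8 → ℝ) 0 = x 0 := by
        have := Fin.insertNth_apply_succAbove (α := fun _ => ℝ) i.succ c x 0
        rwa [Fin.succAbove_ne_zero_zero (Fin.succ_ne_zero i)] at this
      simp only [Function.comp, Fin.succAbove_ne_zero_zero (Fin.succ_ne_zero i), hlo, hhi,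
        Fin.cons_zero] at h1 h2
      exact ⟨h1.trans_eq h3.symm, h3.trans_le h2⟩
    · change R ≤ |(Fin.insertNth i.succ c x : Fin 8 → ℝ) i.succ|
      rw [Fin.insertNth_apply_same, hc]
  have hb0 : hi 0 = b := rfl
  have ha0 : lo 0 = a := rfl
  rw [hb0, ha0, hface b hab le_rfl, hface a le_rfl hab, add_eq_left]
  refine Finset.sum_eq_zero fun i _ => ?_
  rw [hside i _ (by simp [hhi, abs_of_nonneg hR]), hside i _ (by simp [hlo, abs_of_nonneg hR]),
    sub_zero]

/-! ### Stokes identities for monogenic functions -/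

lemma hasFDerivAt_smul_inner_omul {θ : Oct → ℝ} {u W : Oct → Oct} {x g : Oct} {A B : Oct →L[ℝ] Oct}
    (hθ : HasFDerivAt θ (innerSL ℝ g) x) (hu : HasFDerivAt u A x) (hW : HasFDerivAt W B x)
    (i : Fin 8) :
    HasFDerivAt (fun z => θ z * inner ℝ (octE i ⬝ₒ u z) (W z))
      (θ x • ((innerSL ℝ (octE i ⬝ₒ u x)).comp B + (innerSL ℝ (W x)).comp ((omulL (octE i)).comp A))
        + (inner ℝ (octE i ⬝ₒ u x) (W x) : ℝ) • innerSL ℝ g) x := by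
  have h1 : HasFDerivAt (fun z => octE i ⬝ₒ u z) ((omulL (octE i)).comp A) x :=
    (omulL (octE i)).hasFDerivAt.comp x hu
  have h2 := h1.inner ℝ hW
  refine (hθ.mul h2).congr_fderiv ?_
  ext z
  simp [fderivInnerCLM_apply, real_inner_comm (W x), mul_add]

/-- Differentiating u produces ⟨∑ eᵢ ∂ᵢu, W⟩, which is the symbol of 𝒟. Differentiating W and moving
eᵢ to the other side produces ⟨u, ∑ ēᵢ ∂ᵢW⟩, which is the conjugate symbol. The cutoff leaves its
gradient multiplied into u. -/
lemma divergence_smul_inner_omul (θ : ℝ) (u W g : Oct) (A B : Oct →L[ℝ] Oct) :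
    ∑ i, (θ • ((innerSL ℝ (octE i ⬝ₒ u)).comp B + (innerSL ℝ W).comp ((omulL (octE i)).comp A))
        + (inner ℝ (octE i ⬝ₒ u) W : ℝ) • innerSL ℝ g) (octE i) =
      inner ℝ (g ⬝ₒ u) W + θ * (inner ℝ u (crBarSymbol B) + inner ℝ W (crSymbol A)) := by
  have h1 : inner ℝ (g ⬝ₒ u) W = ∑ i, g i * inner ℝ (octE i ⬝ₒ u) W := by
    conv_lhs => rw [← octE_sum g, ← omulL_apply, map_sum]
    simp [sum_inner, inner_smul_left]
  rw [h1, crBarSymbol_apply, crSymbol_apply, inner_sum, inner_sum, ← Finset.sum_add_distrib,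
    Finset.mul_sum, ← Finset.sum_add_distrib]
  refine Finset.sum_congr rfl fun i _ => ?_
  simp [inner_octE_right, inner_omul_left]
  ring

/-- Stokes' identity on a slab, with a horizontal cutoff `θ` whose gradient is `g`. -/
theorem slab_stokes {a b R : ℝ} (hab : a ≤ b) (hR : 0 ≤ R) {u W ω g : Oct → Oct} {θ : Oct → ℝ}
    (huc : ContinuousOn u (closedSlab a b)) (hu : LeftMonogenicOn u (openSlab a b))
    (hWc : ContinuousOn W (closedSlab a b))
    (hW : ∀ x ∈ openSlab a b, ∃ B, HasFDerivAt W B x ∧ crBarSymbol B = ω x)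
    (hωc : ContinuousOn ω (closedSlab a b))
    (hθ : ∀ x, HasFDerivAt θ (innerSL ℝ (g x)) x) (hg : Continuous g)
    (hθ0 : ∀ x, R ≤ ‖x‖ → θ x = 0) (hg0 : ∀ x, R ≤ ‖x‖ → g x = 0) :
    ∫ x in closedSlab a b, (inner ℝ (g x ⬝ₒ u x) (W x) + θ x * inner ℝ (u x) (ω x)) =
      (∫ ξ, θ (slicePt b ξ) * inner ℝ (u (slicePt b ξ)) (W (slicePt b ξ))) -
        ∫ ξ, θ (slicePt a ξ) * inner ℝ (u (slicePt a ξ)) (W (slicePt a ξ)) := by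
  have hθc : Continuous θ := continuous_iff_continuousAt.2 fun x => (hθ x).continuousAt
  choose! B hB hBω using hW
  have hn : ∀ x : Oct, (∃ j : Fin 7, R ≤ |x j.succ|) → R ≤ ‖x‖ := fun x ⟨j, hj⟩ =>
    hj.trans (by simpa using PiLp.norm_apply_le x j.succ)
  have := integral_divergence_slab hab hR
    (fun i x => θ x * inner ℝ (octE i ⬝ₒ u x) (W x))
    (fun i x => θ x • ((innerSL ℝ (octE i ⬝ₒ u x)).comp (B x) +
      (innerSL ℝ (W x)).comp ((omulL (octE i)).comp (fderiv ℝ u x)))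
        + (inner ℝ (octE i ⬝ₒ u x) (W x) : ℝ) • innerSL ℝ (g x))
    (fun x => inner ℝ (g x ⬝ₒ u x) (W x) + θ x * inner ℝ (u x) (ω x))
    (fun i => hθc.continuousOn.mul ((continuousOn_const.omul huc).inner hWc))
    (fun x hx i => hasFDerivAt_smul_inner_omul (hθ x)
      (hu.hasFDerivAt (isOpen_openSlab a b) hx) (hB x hx) i)
    (fun x hx => by
      rw [divergence_smul_inner_omul, hBω x hx, hu.crSymbol_eq_zero hx, inner_zero_right, add_zero])
    (((hg.continuousOn.omul huc).inner hWc).add (hθc.continuousOn.mul (huc.inner hωc)))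
    (fun i x _ hx => by simp [hθ0 x (hn x hx)])
    (fun x _ hx => by simp [hθ0 x (hn x hx), hg0 x (hn x hx), zero_omul])
  simpa using this

/-- Stokes' identity on an open set, with a compactly supported cutoff `χ` with gradient `g`. -/
theorem open_stokes {U K : Set Oct} (hU : IsOpen U) (hK : IsCompact K) (hKU : K ⊆ U)
    {u W ω g : Oct → Oct} {χ : Oct → ℝ} (hu : LeftMonogenicOn u U)
    (hW : ∀ x ∈ U, ∃ B, HasFDerivAt W B x ∧ crBarSymbol B = ω x)
    (hωc : ContinuousOn ω U)
    (hχ : ∀ x, HasFDerivAt χ (innerSL ℝ (g x)) x) (hg : Continuous g)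
    (hχ0 : ∀ x, x ∉ K → χ x = 0) (hg0 : ∀ x, x ∉ K → g x = 0) :
    ∫ x, (inner ℝ (g x ⬝ₒ u x) (W x) + χ x * inner ℝ (u x) (ω x)) = 0 := by
  classical
  have hχc : Continuous χ := continuous_iff_continuousAt.2 fun x => (hχ x).continuousAt
  choose! B hB hBω using hW
  have huc : ∀ x ∈ U, ContinuousAt u x := fun x hx => (hu.hasFDerivAt hU hx).continuousAt
  have hWc : ∀ x ∈ U, ContinuousAt W x := fun x hx => (hB x hx).continuousAt
  have hωc' : ∀ x ∈ U, ContinuousAt ω x := fun x hx => hωc.continuousAt (hU.mem_nhds hx)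
  obtain ⟨R, hR0, hR⟩ : ∃ R : ℝ, 0 ≤ R ∧ ∀ x ∈ K, ‖x‖ < R := by
    obtain ⟨r, hr⟩ := hK.isBounded.exists_norm_le
    exact ⟨|r| + 1, by positivity, fun x hx =>
      ((hr x hx).trans (le_abs_self r)).trans_lt (lt_add_one _)⟩
  have hKo : IsOpen Kᶜ := hK.isClosed.isOpen_compl
  let V : Fin 8 → Oct → ℝ := fun i x => χ x * inner ℝ (octE i ⬝ₒ u x) (W x)
  let G : Oct → ℝ := fun x => inner ℝ (g x ⬝ₒ u x) (W x) + χ x * inner ℝ (u x) (ω x)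
  have hG0 : ∀ x, x ∉ K → G x = 0 := fun x hx => by simp [G, hχ0 x hx, hg0 x hx, zero_omul]
  have hV0 : ∀ i x, x ∉ K → V i x = 0 := fun i x hx => by simp [V, hχ0 x hx]
  -- Off `U` the field vanishes near the point, because `K` is closed and contained in `U`; it is
  -- therefore differentiable everywhere, with derivative zero there.
  have hVd : ∀ x i, HasFDerivAt (V i) (if x ∈ U then χ x • ((innerSL ℝ (octE i ⬝ₒ u x)).comp (B x) +
      (innerSL ℝ (W x)).comp ((omulL (octE i)).comp (fderiv ℝ u x)))
        + (inner ℝ (octE i ⬝ₒ u x) (W x) : ℝ) • innerSL ℝ (g x) else 0) x := fun x i => by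
    split_ifs with h
    · exact hasFDerivAt_smul_inner_omul (hχ x) (hu.hasFDerivAt hU h) (hB x h) i
    · refine (hasFDerivAt_const (0 : ℝ) x).congr_of_eventuallyEq ?_
      filter_upwards [hKo.mem_nhds fun hk => h (hKU hk)] with z hz using hV0 i z hz
  have hGc : Continuous G := continuous_iff_continuousAt.2 fun x => by
    by_cases h : x ∈ U
    · have h1 : ContinuousAt (fun x => g x ⬝ₒ u x) x :=
        (omulL.continuous.continuousAt.comp hg.continuousAt).clm_apply (huc x h)
      exact (h1.inner (hWc x h)).add
        (hχc.continuousAt.mul ((huc x h).inner (hωc' x h)))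
    · refine (continuousAt_const (y := (0 : ℝ))).congr ?_
      filter_upwards [hKo.mem_nhds fun hk => h (hKU hk)] with z hz using (hG0 z hz).symm
  have hn : ∀ x : Oct, (∃ j, R ≤ |x j|) → x ∉ K := fun x ⟨j, hj⟩ hxK =>
    (hj.trans (by simpa using PiLp.norm_apply_le x j)).not_gt (hR x hxK)
  have key := integral_divergence_slab (a := -R) (b := R) (by linarith) hR0 V _ G
    (fun i => continuousOn_of_forall_continuousAt fun x _ => (hVd x i).continuousAt)
    (fun x _ i => hVd x i)
    (fun x _ => by
      by_cases h : x ∈ U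
      · simp only [h, if_true]
        rw [divergence_smul_inner_omul, hBω x h, hu.crSymbol_eq_zero h, inner_zero_right, add_zero]
      · simp [h, hG0 x fun hk => h (hKU hk)])
    hGc.continuousOn
    (fun i x _ ⟨j, hj⟩ => hV0 i x (hn x ⟨_, hj⟩)) (fun x _ ⟨j, hj⟩ => hG0 x (hn x ⟨_, hj⟩))
  -- `K` lies strictly inside the slab |x₀| < R, so both face integrals vanish.
  have hslice : ∀ c : ℝ, R ≤ |c| → ∀ ξ, V 0 (slicePt c ξ) = 0 := fun c hc ξ =>
    hV0 _ _ (hn _ ⟨0, by simpa using hc⟩)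
  simp only [hslice R (le_abs_self R), hslice (-R) (by simp [le_abs_self])] at key
  rw [setIntegral_eq_integral_of_forall_compl_eq_zero] at key
  · simpa using key
  · intro x hx
    refine hG0 x (hn x ⟨0, ?_⟩)
    by_contra hcon
    push Not at hcon
    exact hx ⟨(abs_lt.1 hcon).1.le, (abs_lt.1 hcon).2.le⟩

/-! ### The approximate identity `8 ε² (ε² + |x|²)⁻⁵` -/

/-- The radial density r⁷ · 8(1 + r²)⁻⁵ has an explicit primitive tending to 1 at infinity, which
gives both the integrability and the mass of the approximate identity. -/
lemma hasDerivAt_profile (r : ℝ) :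
    HasDerivAt (fun r : ℝ => r ^ 8 * ((1 + r ^ 2) ^ 4)⁻¹) (r ^ 7 * (8 * ((1 + r ^ 2) ^ 5)⁻¹)) r := by
  have h0 : (1 + r ^ 2) ≠ 0 := by positivity
  have h1 : HasDerivAt (fun r : ℝ => (1 + r ^ 2) ^ 4) (4 * (1 + r ^ 2) ^ 3 * (2 * r)) r := by
    have := (((hasDerivAt_id r).pow 2).const_add 1).pow 4
    refine this.congr_deriv ?_
    simp
  refine ((hasDerivAt_pow 8 r).mul (h1.inv (by positivity))).congr_deriv ?_
  simp only [Pi.inv_apply]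
  field_simp
  ring

lemma tendsto_profile :
    Tendsto (fun r : ℝ => r ^ 8 * ((1 + r ^ 2) ^ 4)⁻¹) atTop (𝓝 1) := by
  have h1 : Tendsto (fun r : ℝ => 1 + r ^ 2) atTop atTop :=
    tendsto_atTop_add_const_left _ _ (tendsto_pow_atTop two_ne_zero)
  have h2 : Tendsto (fun r : ℝ => (1 - (1 + r ^ 2)⁻¹) ^ 4) atTop (𝓝 ((1 - 0) ^ 4)) :=
    (tendsto_const_nhds.sub (tendsto_inv_atTop_zero.comp h1)).pow 4
  simp only [sub_zero, one_pow] at h2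
  refine h2.congr fun r => ?_
  have h0 : (1 + r ^ 2) ≠ 0 := by positivity
  field_simp
  ring

lemma integrable_approxIdentity :
    Integrable fun x : Oct => 8 * ((1 + ‖x‖ ^ 2) ^ 5)⁻¹ := by
  rw [integrable_fun_norm_addHaar (μ := (volume : Measure Oct))
    (f := fun r : ℝ => 8 * ((1 + r ^ 2) ^ 5)⁻¹)]
  simp only [finrank_euclideanSpace, Fintype.card_fin, smul_eq_mul]
  exact integrableOn_Ioi_deriv_of_nonneg' (fun r _ => hasDerivAt_profile r)
    (fun r hr => by have := mem_Ioi.1 hr; positivity) tendsto_profile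

lemma volume_real_ball_oct : (volume : Measure Oct).real (Metric.ball 0 1) = Real.pi ^ 4 / 24 := by
  have hG : Real.Gamma 5 = 24 := by
    rw [show (5 : ℝ) = (4 : ℕ) + 1 by norm_num, Real.Gamma_nat_eq_factorial 4]
    norm_num [Nat.factorial]
  rw [Measure.real, EuclideanSpace.volume_ball]
  have h1 : √Real.pi ^ 8 = Real.pi ^ 4 := by
    rw [show (8 : ℕ) = 2 * 4 from rfl, pow_mul, Real.sq_sqrt Real.pi_pos.le]
  have h2 : ((8 : ℕ) : ℝ) / 2 + 1 = 5 := by norm_num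
  simp only [Fintype.card_fin, h1, h2, hG]
  rw [ENNReal.toReal_mul, ENNReal.toReal_ofReal (by positivity)]
  simp

/-- In polar coordinates the mass is the dimension times the volume of the unit ball times the
radial integral 1, that is 8 · π⁴/24. -/
lemma integral_approxIdentity :
    ∫ x : Oct, 8 * ((1 + ‖x‖ ^ 2) ^ 5)⁻¹ = Real.pi ^ 4 / 3 := by
  have h := integrable_approxIdentity
  rw [integrable_fun_norm_addHaar (μ := (volume : Measure Oct))
    (f := fun r : ℝ => 8 * ((1 + r ^ 2) ^ 5)⁻¹)] at h
  rw [integral_fun_norm_addHaar (volume : Measure Oct) (fun r : ℝ => 8 * ((1 + r ^ 2) ^ 5)⁻¹)]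
  simp only [finrank_euclideanSpace, Fintype.card_fin, smul_eq_mul] at h ⊢
  rw [integral_Ioi_of_hasDerivAt_of_tendsto' (fun r _ => hasDerivAt_profile r) h tendsto_profile,
    volume_real_ball_oct]
  simp
  ring

/-- `8 ε² (ε² + |x|²)⁻⁵` is an approximate identity of mass `π⁴/3`. -/
lemma tendsto_integral_approxIdentity {f : Oct → ℝ} {y : Oct} {M : ℝ}
    (hf : AEStronglyMeasurable f volume) (hM : ∀ x, |f x| ≤ M) (hy : ContinuousAt f y) :
    Tendsto (fun ε : ℝ => ∫ x, (8 * ε ^ 2 * ((ε ^ 2 + ‖x - y‖ ^ 2) ^ 5)⁻¹) * f x) (𝓝[>] 0)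
      (𝓝 (Real.pi ^ 4 / 3 * f y)) := by
  have h1 : ∀ ε : ℝ, 0 < ε → ∫ x, (8 * ε ^ 2 * ((ε ^ 2 + ‖x - y‖ ^ 2) ^ 5)⁻¹) * f x =
      ∫ t, 8 * ((1 + ‖t‖ ^ 2) ^ 5)⁻¹ * f (y + ε • t) := fun ε hε => by
    rw [← integral_add_left_eq_self _ y]
    have := Measure.integral_comp_smul (volume : Measure Oct)
      (fun x : Oct => (8 * ε ^ 2 * ((ε ^ 2 + ‖x‖ ^ 2) ^ 5)⁻¹) * f (y + x)) ε
    simp only [finrank_euclideanSpace, Fintype.card_fin] at this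
    simp only [add_sub_cancel_left]
    rw [← inv_smul_eq_iff₀ (by positivity)] at this
    rw [← this, smul_eq_mul, ← integral_const_mul]
    refine integral_congr_ae (Eventually.of_forall fun t => ?_)
    simp only [norm_smul, mul_pow, Real.norm_eq_abs, sq_abs]
    rw [show ε ^ 2 + ε ^ 2 * ‖t‖ ^ 2 = ε ^ 2 * (1 + ‖t‖ ^ 2) by ring, mul_pow, mul_inv,
      abs_of_pos (by positivity)]
    field_simp
  rw [← integral_approxIdentity, ← integral_mul_const]
  refine Tendsto.congr' (f₁ := fun ε : ℝ => ∫ t, 8 * ((1 + ‖t‖ ^ 2) ^ 5)⁻¹ * f (y + ε • t)) ?_ ?_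
  · filter_upwards [self_mem_nhdsWithin] with ε hε using (h1 ε hε).symm
  · refine tendsto_integral_filter_of_dominated_convergence
      (fun t => 8 * ((1 + ‖t‖ ^ 2) ^ 5)⁻¹ * M) ?_ ?_ (integrable_approxIdentity.mul_const M) ?_
    · filter_upwards [self_mem_nhdsWithin] with ε hε
      refine integrable_approxIdentity.aestronglyMeasurable.mul ?_
      have hq : Measure.QuasiMeasurePreserving (fun t : Oct => y + ε • t) volume volume :=
        (quasiMeasurePreserving_add_left volume y).comp
          (Measure.quasiMeasurePreserving_smul (μ := (volume : Measure Oct)) (ne_of_gt hε))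
      exact hf.comp_quasiMeasurePreserving hq
    · refine Eventually.of_forall fun ε => Eventually.of_forall fun t => ?_
      rw [norm_mul, Real.norm_of_nonneg (by positivity)]
      gcongr
      exact hM _
    · refine Eventually.of_forall fun t => Tendsto.const_mul _ ?_
      have : Tendsto (fun ε : ℝ => y + ε • t) (𝓝[>] 0) (𝓝 y) := by
        have h : Continuous fun ε : ℝ => y + ε • t := by fun_prop
        simpa using (h.tendsto 0).mono_left nhdsWithin_le_nhds
      exact hy.tendsto.comp this

/-- The regularised kernels converge to the singular one away from the pole. -/
lemma tendsto_integral_dualKernel {μ : Measure Oct} {h : Oct → Oct} {y : Oct} {ρ : ℝ} (hρ : 0 < ρ)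
    (hh : Integrable h μ) (h0 : ∀ᵐ x ∂μ, ‖x - y‖ < ρ → h x = 0) (v : Oct) :
    Tendsto (fun ε : ℝ => ∫ x, inner ℝ (h x) (dualKernel ε v (x - y)) ∂μ) (𝓝[>] 0)
      (𝓝 (∫ x, inner ℝ (h x) (dualKernel 0 v (x - y)) ∂μ)) := by
  refine tendsto_integral_filter_of_dominated_convergence
    (fun x => ‖h x‖ * ((ρ ^ 7)⁻¹ * ‖v‖)) ?_ ?_ (hh.norm.mul_const _) ?_
  · filter_upwards [self_mem_nhdsWithin] with ε hε
    refine hh.aestronglyMeasurable.inner (Continuous.aestronglyMeasurable ?_)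
    have : ∀ x : Oct, (ε ^ 2 + ‖x - y‖ ^ 2) ^ 4 ≠ 0 := fun x => by
      have := mem_Ioi.1 hε; positivity
    unfold dualKernel
    exact (Continuous.inv₀ (by fun_prop) this).smul (by fun_prop)
  · refine Eventually.of_forall fun ε => ?_
    filter_upwards [h0] with x h0
    by_cases hx : ‖x - y‖ < ρ
    · simp [h0 hx]
    · refine (norm_inner_le_norm _ _).trans ?_
      gcongr
      refine (norm_dualKernel_le _ _ _).trans ?_
      gcongr
      exact not_lt.1 hx
  · filter_upwards [h0] with x h0
    by_cases hx : ‖x - y‖ < ρ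
    · simp [h0 hx]
    · have hx0 : 0 < ‖x - y‖ := hρ.trans_le (not_lt.1 hx)
      refine Tendsto.inner tendsto_const_nhds ?_
      have : ContinuousAt (fun ε : ℝ => dualKernel ε v (x - y)) 0 := by
        unfold dualKernel
        have hc : ContinuousAt (fun ε : ℝ => (ε ^ 2 + ‖x - y‖ ^ 2) ^ 4) 0 := by fun_prop
        exact (hc.inv₀ (by positivity)).smul continuousAt_const
      exact this.tendsto.mono_left nhdsWithin_le_nhds

lemma continuous_of_continuousOn_of_eq_zero {E : Type*} [TopologicalSpace E] [Zero E]
    {U K : Set Oct} (hU : IsOpen U) (hK : IsClosed K) (hKU : K ⊆ U) {F : Oct → E}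
    (hF : ContinuousOn F U) (h0 : ∀ x, x ∉ K → F x = 0) : Continuous F :=
  continuous_iff_continuousAt.2 fun x => by
    by_cases h : x ∈ U
    · exact hF.continuousAt (hU.mem_nhds h)
    · refine (continuousAt_const (y := (0 : E))).congr ?_
      filter_upwards [hK.isOpen_compl.mem_nhds fun hk => h (hKU hk)] with z hz using (h0 z hz).symm

/-- Cauchy's formula with a compactly supported cutoff which is constant near the pole. -/
theorem open_cauchy {U K : Set Oct} (hU : IsOpen U) (hK : IsCompact K) (hKU : K ⊆ U)
    {u g : Oct → Oct} {χ : Oct → ℝ} (hu : LeftMonogenicOn u U)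
    (hχ : ∀ x, HasFDerivAt χ (innerSL ℝ (g x)) x) (hg : Continuous g)
    (hχ0 : ∀ x, x ∉ K → χ x = 0) (hg0 : ∀ x, x ∉ K → g x = 0)
    {y : Oct} {ρ : ℝ} (hρ : 0 < ρ) (hgy : ∀ x, ‖x - y‖ < ρ → g x = 0) (v : Oct) :
    ∫ x, inner ℝ (g x ⬝ₒ u x) (dualKernel 0 v (x - y)) =
      -(Real.pi ^ 4 / 3 * (χ y * inner ℝ (u y) v)) := by
  have hχc : Continuous χ := continuous_iff_continuousAt.2 fun x => (hχ x).continuousAt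
  have huc : ContinuousOn u U := hu.1.continuousOn
  have hh : Continuous fun x => g x ⬝ₒ u x :=
    continuous_of_continuousOn_of_eq_zero hU hK.isClosed hKU (hg.continuousOn.omul huc)
      fun x hx => by simp [hg0 x hx, zero_omul]
  have hhi : Integrable fun x => g x ⬝ₒ u x :=
    hh.integrable_of_hasCompactSupport (HasCompactSupport.intro hK fun x hx => by
      simp [hg0 x hx, zero_omul])
  have hf : Continuous fun x => χ x * inner ℝ (u x) v :=
    continuous_of_continuousOn_of_eq_zero hU hK.isClosed hKU
      (hχc.continuousOn.mul (huc.inner continuousOn_const)) fun x hx => by simp [hχ0 x hx]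
  have hfs : HasCompactSupport fun x => χ x * inner ℝ (u x) v :=
    HasCompactSupport.intro hK fun x hx => by simp [hχ0 x hx]
  obtain ⟨M, hM⟩ := hf.bounded_above_of_compact_support hfs
  have h1 := tendsto_integral_dualKernel (y := y) hρ hhi
    (Eventually.of_forall fun x hx => by simp [hgy x hx, zero_omul]) v
  have h2 := tendsto_integral_approxIdentity (y := y) hf.aestronglyMeasurable hM hf.continuousAt
  -- Stokes' identity holds exactly for each ε > 0. Its left side has a limit because `g` vanishes
  -- near the pole, its right side because the bump concentrates at `y`.
  have h3 : ∀ᶠ ε : ℝ in 𝓝[>] 0, ∫ x, inner ℝ (g x ⬝ₒ u x) (dualKernel ε v (x - y)) =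
      -∫ x, (8 * ε ^ 2 * ((ε ^ 2 + ‖x - y‖ ^ 2) ^ 5)⁻¹) * (χ x * inner ℝ (u x) v) := by
    filter_upwards [self_mem_nhdsWithin] with ε hε
    have hε : 0 < ε := hε
    have hne : ∀ x : Oct, ε ^ 2 + ‖x - y‖ ^ 2 ≠ 0 := fun x => by positivity
    have hd : ∀ x, HasFDerivAt (fun x => dualKernel ε v (x - y))
        (fderiv ℝ (dualKernel ε v) (x - y)) x := fun x => by
      have := (hasFDerivAt_dualKernel (hne x) v).differentiableAt.hasFDerivAt
      exact (this.comp x ((hasFDerivAt_id x).sub_const y)).congr_fderiv (ContinuousLinearMap.comp_id _)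
    have hρc : Continuous fun x : Oct => 8 * ε ^ 2 * ((ε ^ 2 + ‖x - y‖ ^ 2) ^ 5)⁻¹ :=
      continuous_const.mul (Continuous.inv₀ (by fun_prop) fun x => pow_ne_zero _ (hne x))
    have key := open_stokes hU hK hKU hu
      (W := fun x => dualKernel ε v (x - y))
      (ω := fun x => (8 * ε ^ 2 * ((ε ^ 2 + ‖x - y‖ ^ 2) ^ 5)⁻¹) • v)
      (fun x _ => ⟨_, hd x, crBarSymbol_fderiv_dualKernel (hne x) v⟩)
      (hρc.smul continuous_const).continuousOn hχ hg hχ0 hg0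
    have hWc : Continuous fun x => dualKernel ε v (x - y) :=
      continuous_iff_continuousAt.2 fun x => (hd x).continuousAt
    rw [integral_add] at key
    · rw [eq_neg_iff_add_eq_zero, ← key]
      congr 2
      ext x
      rw [inner_smul_right]
      ring
    · exact (hh.inner hWc).integrable_of_hasCompactSupport (HasCompactSupport.intro hK fun x hx => by
        simp [hg0 x hx, zero_omul])
    · refine Continuous.integrable_of_hasCompactSupport ?_ (HasCompactSupport.intro hK fun x hx => by
        simp [hχ0 x hx])
      refine (hρc.mul hf).congr fun x => ?_
      rw [inner_smul_right, Pi.mul_apply]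
      ring
  exact tendsto_nhds_unique (h1.congr' h3) h2.neg

/-! ### Cauchy's formula on the unit ball -/

lemma integral_volumeIoiPow (f : ℝ → ℝ) :
    ∫ r : Ioi (0 : ℝ), f r ∂(Measure.volumeIoiPow 7) = ∫ r in Ioi (0 : ℝ), r ^ 7 * f r := by
  simp only [Measure.volumeIoiPow, ENNReal.ofReal]
  rw [integral_withDensity_eq_integral_smul
      (f := fun r : Ioi (0 : ℝ) => Real.toNNReal ((r : ℝ) ^ 7))
      (measurable_subtype_coe.pow_const _).real_toNNReal,
    integral_subtype_comap measurableSet_Ioi fun a ↦ Real.toNNReal (a ^ 7) • f a]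
  refine setIntegral_congr_fun measurableSet_Ioi fun x hx => ?_
  rw [NNReal.smul_def, Real.coe_toNNReal _ (pow_nonneg hx.out.le _), smul_eq_mul]

/-- Integration in polar coordinates. -/
lemma integral_polar (F : Oct → ℝ) :
    ∫ x, F x = ∫ p : Metric.sphere (0 : Oct) 1 × Ioi (0 : ℝ), F ((p.2 : ℝ) • (p.1 : Oct))
      ∂((volume : Measure Oct).toSphere.prod (Measure.volumeIoiPow 7)) := by
  have h := (volume : Measure Oct).measurePreserving_homeomorphUnitSphereProd
  simp only [finrank_euclideanSpace, Fintype.card_fin] at h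
  rw [← h.integral_comp (Homeomorph.measurableEmbedding _)]
  have h2 : ∀ x : ({0}ᶜ : Set Oct), ((homeomorphUnitSphereProd Oct x).2 : ℝ) •
      ((homeomorphUnitSphereProd Oct x).1 : Oct) = x := fun x => by
    have := (homeomorphUnitSphereProd Oct).symm_apply_apply x
    rw [Subtype.ext_iff, homeomorphUnitSphereProd_symm_apply_coe] at this
    exact this
  simp only [h2]
  rw [integral_subtype_comap (measurableSet_singleton _).compl F, restrict_compl_singleton]

lemma integrable_polar {F : Oct → ℝ} (hF : Integrable F) :
    Integrable (fun p : Metric.sphere (0 : Oct) 1 × Ioi (0 : ℝ) => F ((p.2 : ℝ) • (p.1 : Oct)))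
      ((volume : Measure Oct).toSphere.prod (Measure.volumeIoiPow 7)) := by
  have h := (volume : Measure Oct).measurePreserving_homeomorphUnitSphereProd
  simp only [finrank_euclideanSpace, Fintype.card_fin] at h
  rw [← h.integrable_comp_emb (Homeomorph.measurableEmbedding _)]
  have h2 : ∀ x : ({0}ᶜ : Set Oct), ((homeomorphUnitSphereProd Oct x).2 : ℝ) •
      ((homeomorphUnitSphereProd Oct x).1 : Oct) = x := fun x => by
    have := (homeomorphUnitSphereProd Oct).symm_apply_apply x
    rw [Subtype.ext_iff, homeomorphUnitSphereProd_symm_apply_coe] at this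
    exact this
  simp only [Function.comp_def, h2]
  exact (integrableOn_iff_comap_subtypeVal (measurableSet_singleton _).compl).1 hF.integrableOn

lemma hasFDerivAt_norm_oct {x : Oct} (hx : x ≠ 0) :
    HasFDerivAt (fun x : Oct => ‖x‖) (innerSL ℝ (‖x‖⁻¹ • x)) x := by
  have h0 : ‖x‖ ≠ 0 := by simpa using hx
  have h1 := (hasStrictFDerivAt_norm_sq x).hasFDerivAt.sqrt (by positivity)
  simp only [Real.sqrt_sq (norm_nonneg _)] at h1
  refine h1.congr_fderiv ?_
  ext z
  simp
  field_simp

/-- A radial cutoff, equal to `1` on `|x| ≤ 1 - τ`, supported in `|x| ≤ 1 - τ/4`. -/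
lemma exists_radial_cutoff {τ : ℝ} (hτ : 0 < τ) (hτ1 : τ < 1) :
    ∃ (ψ : ℝ → ℝ) (χ : Oct → ℝ), Continuous ψ ∧ (∀ r, 0 ≤ ψ r) ∧
      (∀ r, r ∉ Ioo (1 - τ) (1 - τ / 4) → ψ r = 0) ∧ (∫ r in Ioi (0 : ℝ), ψ r = 1) ∧
      (∀ x, ‖x‖ ≤ 1 - τ → χ x = 1) ∧ (∀ x, 1 - τ / 4 ≤ ‖x‖ → χ x = 0) ∧
      ∀ x, HasFDerivAt χ (innerSL ℝ (-(ψ ‖x‖ * ‖x‖⁻¹) • x)) x := by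
  let f : ContDiffBump (1 - τ / 2 : ℝ) := ⟨τ / 8, τ / 4, by linarith, by linarith⟩
  let ψ : ℝ → ℝ := f.normed volume
  have hψc : Continuous ψ := f.continuous_normed
  have hψ0 : ∀ r, r ∉ Ioo (1 - τ) (1 - τ / 4) → ψ r = 0 := fun r hr => by
    by_contra h
    have : r ∈ Function.support ψ := h
    rw [f.support_normed_eq] at this
    rw [Real.ball_eq_Ioo] at this
    exact hr ⟨by have := this.1; simp only [f] at this; linarith,
      by have := this.2; simp only [f] at this; linarith⟩
  have hψi : Integrable ψ := f.integrable_normed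
  have hint : ∀ r, 1 - τ / 4 ≤ r → ∫ t in (0 : ℝ)..r, ψ t = 1 := fun r hr => by
    rw [intervalIntegral.integral_of_le (by linarith),
      setIntegral_eq_integral_of_forall_compl_eq_zero, f.integral_normed]
    intro t ht
    refine hψ0 t fun h => ht ⟨by linarith [h.1], by linarith [h.2]⟩
  have hint0 : ∀ r, 0 ≤ r → r ≤ 1 - τ → ∫ t in (0 : ℝ)..r, ψ t = 0 := fun r h0 hr => by
    rw [intervalIntegral.integral_of_le h0]
    refine setIntegral_eq_zero_of_forall_eq_zero fun t ht => hψ0 t fun h => ?_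
    linarith [h.1, ht.2]
  refine ⟨ψ, fun x => 1 - ∫ t in (0 : ℝ)..‖x‖, ψ t, hψc, fun r => f.nonneg_normed r, hψ0, ?_,
    fun x hx => by simp [hint0 _ (norm_nonneg x) hx], fun x hx => by simp [hint _ hx], fun x => ?_⟩
  · rw [setIntegral_eq_integral_of_forall_compl_eq_zero, f.integral_normed]
    exact fun t ht => hψ0 t fun h => ht (mem_Ioi.2 (by linarith [h.1]))
  · rcases eq_or_ne x 0 with rfl | hx
    · refine ((hasFDerivAt_const (1 : ℝ) (0 : Oct)).congr_of_eventuallyEq ?_).congr_fderiv (by simp)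
      have : Metric.ball (0 : Oct) (1 - τ) ∈ 𝓝 0 := Metric.ball_mem_nhds _ (by linarith)
      filter_upwards [this] with z hz
      rw [hint0 _ (norm_nonneg z) (by simpa using (mem_ball_zero_iff.1 hz).le), sub_zero]
    · have h1 := (hψc.integral_hasStrictDerivAt 0 ‖x‖).hasDerivAt.comp_hasFDerivAt x
        (hasFDerivAt_norm_oct hx)
      refine (h1.const_sub 1).congr_fderiv ?_
      ext z
      simp
      ring

/-- Cauchy's integral formula on the unit ball. -/
theorem ball_cauchy {u : Oct → Oct} (huc : ContinuousOn u (Metric.closedBall 0 1))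
    (hu : LeftMonogenicOn u (Metric.ball 0 1)) {y : Oct} (hy : y ∈ Metric.ball (0 : Oct) 1)
    (v : Oct) :
    ∫ x : Metric.sphere (0 : Oct) 1,
      inner ℝ ((x : Oct) ⬝ₒ u x) (dualKernel 0 v ((x : Oct) - y)) ∂(volume : Measure Oct).toSphere =
      Real.pi ^ 4 / 3 * inner ℝ (u y) v := by
  have hy1 : ‖y‖ < 1 := by simpa using hy
  set G : Oct → ℝ := fun x => inner ℝ (x ⬝ₒ u x) (dualKernel 0 v (x - y)) with hGdef
  have hGc : ContinuousOn G (Metric.closedBall 0 1 \ {y}) := by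
    refine ContinuousOn.inner (continuousOn_id.omul (huc.mono sdiff_subset)) ?_
    intro x hx
    have hne : x - y ≠ 0 := sub_ne_zero.2 hx.2
    have h1 := (hasFDerivAt_dualKernel (ε := 0) (x := x - y) (by simpa using hne) v).continuousAt
    exact (h1.comp (f := fun x => x - y) (by fun_prop)).continuousWithinAt
  have hsph : ∀ x : Metric.sphere (0 : Oct) 1, (x : Oct) ∈ Metric.closedBall (0 : Oct) 1 \ {y} :=
    fun x => ⟨Metric.sphere_subset_closedBall x.2, fun h => by
      have h2 := mem_sphere_zero_iff_norm.1 x.2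
      rw [mem_singleton_iff.1 h] at h2
      linarith⟩
  have hGs : Continuous fun x : Metric.sphere (0 : Oct) 1 => G x :=
    hGc.comp_continuous continuous_subtype_val hsph
  set m := (volume : Measure Oct).toSphere with hm
  have hGsi : Integrable (fun x : Metric.sphere (0 : Oct) 1 => G x) m := by
    obtain ⟨M, hM⟩ := isCompact_univ.exists_bound_of_continuousOn hGs.continuousOn
    exact Integrable.of_bound hGs.aestronglyMeasurable M
      (Eventually.of_forall fun x => hM x (mem_univ _))
  -- the rescaled integrand is uniformly close to its boundary values
  set τ₀ := (1 - ‖y‖) / 2 with hτ₀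
  have hτ₀0 : 0 < τ₀ := by linarith
  have hτ₀1 : τ₀ < 1 := by linarith [norm_nonneg y]
  -- The exponent 6 is the polar weight r⁷ divided by the r coming from the gradient of the radial
  -- cutoff.
  have hunif : UniformContinuousOn (fun p : ℝ × Metric.sphere (0 : Oct) 1 =>
      p.1 ^ 6 * G (p.1 • (p.2 : Oct))) (Icc (1 - τ₀) 1 ×ˢ univ) := by
    refine (isCompact_Icc.prod isCompact_univ).uniformContinuousOn_of_continuous ?_
    refine ContinuousOn.mul (by fun_prop) (hGc.comp (by fun_prop) ?_)
    intro p hp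
    have hp1 := hp.1.1
    have hp2 := hp.1.2
    have hn : ‖p.1 • (p.2 : Oct)‖ = p.1 := by
      rw [norm_smul, mem_sphere_zero_iff_norm.1 p.2.2, mul_one, Real.norm_of_nonneg (by linarith)]
    refine ⟨by simp only [mem_closedBall_zero_iff]; rw [hn]; exact hp2, fun h => ?_⟩
    have h' : p.1 • (p.2 : Oct) = y := h
    rw [h'] at hn
    linarith
  refine eq_of_forall_dist_le fun δ' hδ' => ?_
  obtain ⟨δ, hδ, hδδ⟩ : ∃ δ : ℝ, 0 < δ ∧ δ * m.real univ ≤ δ' := by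
    refine ⟨δ' / (m.real univ + 1), by positivity, ?_⟩
    rw [div_mul_eq_mul_div, div_le_iff₀ (by positivity)]
    nlinarith [measureReal_nonneg (μ := m) (s := univ)]
  obtain ⟨τ₁, hτ₁, hclose⟩ := Metric.uniformContinuousOn_iff.1 hunif δ hδ
  set τ := min τ₀ τ₁ with hτ
  have hτ0 : 0 < τ := lt_min hτ₀0 hτ₁
  have hττ₀ : τ ≤ τ₀ := min_le_left _ _
  obtain ⟨ψ, χ, hψc, hψnn, hψ0, hψ1, hχ1, hχ0, hχd⟩ :=
    exists_radial_cutoff hτ0 (hττ₀.trans_lt hτ₀1)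
  have hclose' : ∀ r ∈ Ioo (1 - τ) (1 - τ / 4), ∀ x : Metric.sphere (0 : Oct) 1,
      |r ^ 6 * G (r • (x : Oct)) - G x| ≤ δ := fun r hr x => by
    have := hclose (r, x) ⟨⟨by linarith [hr.1], by linarith [hr.2]⟩, mem_univ _⟩ (1, x)
      ⟨⟨by linarith, le_rfl⟩, mem_univ _⟩ (by
        simp only [Prod.dist_eq, dist_self, Real.dist_eq]
        rw [max_eq_left (abs_nonneg _), abs_lt]
        have := min_le_right τ₀ τ₁
        constructor <;> linarith [hr.1, hr.2])
    simp only [one_pow, one_smul, one_mul, Real.dist_eq] at this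
    exact this.le
  have hgz : ∀ x : Oct, ‖x‖ ∉ Ioo (1 - τ) (1 - τ / 4) → -(ψ ‖x‖ * ‖x‖⁻¹) • x = 0 := fun x hx => by
    simp [hψ0 _ hx]
  have hgc : Continuous fun x : Oct => -(ψ ‖x‖ * ‖x‖⁻¹) • x := by
    refine continuous_iff_continuousAt.2 fun x => ?_
    rcases eq_or_ne x 0 with rfl | hx
    · refine (continuousAt_const (y := (0 : Oct))).congr ?_
      have : Metric.ball (0 : Oct) (1 - τ) ∈ 𝓝 0 := Metric.ball_mem_nhds _ (by linarith)
      filter_upwards [this] with z hz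
      exact (hgz z fun h => by linarith [h.1, mem_ball_zero_iff.1 hz]).symm
    · have : ContinuousAt (fun x : Oct => ‖x‖⁻¹) x :=
        continuous_norm.continuousAt.inv₀ (by simpa using hx)
      exact (((hψc.comp continuous_norm).continuousAt.mul this).neg).smul continuousAt_id
  have key := open_cauchy Metric.isOpen_ball (isCompact_closedBall (0 : Oct) (1 - τ / 4))
    (Metric.closedBall_subset_ball (by linarith)) hu hχd hgc
    (fun x hx => hχ0 x (by simpa using (not_le.1 (mt mem_closedBall_zero_iff.2 hx)).le))
    (fun x hx => hgz x fun h => hx (mem_closedBall_zero_iff.2 h.2.le))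
    (y := y) (ρ := τ₀) hτ₀0 (fun x hx => hgz x fun h => by
      have h3 := norm_sub_norm_le x y
      linarith [h.1]) v
  rw [hχ1 y (by linarith), one_mul, ← neg_eq_iff_eq_neg, ← integral_neg] at key
  have hB : ∀ x : Oct, -inner ℝ ((-(ψ ‖x‖ * ‖x‖⁻¹) • x) ⬝ₒ u x) (dualKernel 0 v (x - y)) =
      ψ ‖x‖ * ‖x‖⁻¹ * G x := fun x => by
    rw [smul_omul, real_inner_smul_left]; ring
  simp only [hB] at key
  have hBi : Integrable fun x : Oct => ψ ‖x‖ * ‖x‖⁻¹ * G x := by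
    refine Continuous.integrable_of_hasCompactSupport ?_ (HasCompactSupport.intro
      (isCompact_closedBall (0 : Oct) 1) fun x hx => ?_)
    · refine continuous_of_continuousOn_of_eq_zero
        (U := {x : Oct | 1 - 2 * τ₀ < ‖x‖ ∧ ‖x‖ < 1}) (K := {x : Oct | 1 - τ ≤ ‖x‖ ∧ ‖x‖ ≤ 1 - τ / 4})
        ((isOpen_lt continuous_const continuous_norm).inter
          (isOpen_lt continuous_norm continuous_const))
        ((isClosed_le continuous_const continuous_norm).inter
          (isClosed_le continuous_norm continuous_const))
        (fun x hx => ⟨by linarith [hx.1], by linarith [hx.2]⟩) ?_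
        (fun x hx => by rw [hψ0 _ fun h => hx ⟨h.1.le, h.2.le⟩, zero_mul, zero_mul])
      refine ContinuousOn.mul ((hψc.comp continuous_norm).continuousOn.mul
        (continuous_norm.continuousOn.inv₀ fun x hx => ?_)) (hGc.mono fun x hx => ⟨?_, fun h => ?_⟩)
      · linarith [hx.1, norm_nonneg y]
      · exact mem_closedBall_zero_iff.2 hx.2.le
      · have h1 := hx.1
        rw [mem_singleton_iff.1 h] at h1
        linarith
    · have : ψ ‖x‖ = 0 := hψ0 _ fun h => hx (mem_closedBall_zero_iff.2 (by linarith [h.2]))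
      simp [this]
  rw [← key, integral_polar]
  have hA : ∫ r : Ioi (0 : ℝ), ψ r * ((r : ℝ) ^ 7)⁻¹ ∂(Measure.volumeIoiPow 7) = 1 := by
    rw [integral_volumeIoiPow fun r => ψ r * (r ^ 7)⁻¹, ← hψ1]
    refine setIntegral_congr_fun measurableSet_Ioi fun r hr => ?_
    have : r ≠ 0 := ne_of_gt hr
    field_simp
  -- The integral of a non-integrable function is 0 by convention, so the value 1 already forces
  -- integrability.
  have hAi : Integrable (fun r : Ioi (0 : ℝ) => ψ r * ((r : ℝ) ^ 7)⁻¹) (Measure.volumeIoiPow 7) := by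
    by_contra h
    rw [integral_undef h] at hA
    exact zero_ne_one hA
  have hC : ∫ x : Metric.sphere (0 : Oct) 1, G x ∂m =
      ∫ p : Metric.sphere (0 : Oct) 1 × Ioi (0 : ℝ), G p.1 * (ψ p.2 * ((p.2 : ℝ) ^ 7)⁻¹)
        ∂(m.prod (Measure.volumeIoiPow 7)) := by
    rw [integral_prod_mul (fun x : Metric.sphere (0 : Oct) 1 => G x)
      (fun r : Ioi (0 : ℝ) => ψ r * ((r : ℝ) ^ 7)⁻¹), hA, mul_one]
  have hD : ∫ p : Metric.sphere (0 : Oct) 1 × Ioi (0 : ℝ), δ * (ψ p.2 * ((p.2 : ℝ) ^ 7)⁻¹)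
        ∂(m.prod (Measure.volumeIoiPow 7)) = δ * m.real univ := by
    rw [integral_prod_mul (fun _ : Metric.sphere (0 : Oct) 1 => δ)
      (fun r : Ioi (0 : ℝ) => ψ r * ((r : ℝ) ^ 7)⁻¹), hA, mul_one]
    simp [mul_comm]
  have hDi : Integrable (fun p : Metric.sphere (0 : Oct) 1 × Ioi (0 : ℝ) =>
      δ * (ψ p.2 * ((p.2 : ℝ) ^ 7)⁻¹)) (m.prod (Measure.volumeIoiPow 7)) :=
    Integrable.mul_prod (integrable_const δ) hAi
  have hCi : Integrable (fun p : Metric.sphere (0 : Oct) 1 × Ioi (0 : ℝ) =>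
      G p.1 * (ψ p.2 * ((p.2 : ℝ) ^ 7)⁻¹)) (m.prod (Measure.volumeIoiPow 7)) :=
    Integrable.mul_prod hGsi hAi
  change dist (∫ x : Metric.sphere (0 : Oct) 1, G x ∂m) _ ≤ δ'
  rw [hC, Real.dist_eq, ← Real.norm_eq_abs, ← integral_sub hCi (integrable_polar hBi)]
  refine (norm_integral_le_of_norm_le hDi (Eventually.of_forall fun p => ?_)).trans
    (hD.le.trans hδδ)
  have hr0 : (0 : ℝ) < p.2 := p.2.2
  have hn : ‖(p.2 : ℝ) • (p.1 : Oct)‖ = p.2 := by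
    rw [norm_smul, mem_sphere_zero_iff_norm.1 p.1.2, mul_one, Real.norm_of_nonneg hr0.le]
  rw [hn]
  by_cases h : (p.2 : ℝ) ∈ Ioo (1 - τ) (1 - τ / 4)
  · have : G p.1 * (ψ p.2 * ((p.2 : ℝ) ^ 7)⁻¹) - ψ p.2 * (p.2 : ℝ)⁻¹ * G ((p.2 : ℝ) • (p.1 : Oct)) =
        (ψ p.2 * ((p.2 : ℝ) ^ 7)⁻¹) *
          -((p.2 : ℝ) ^ 6 * G ((p.2 : ℝ) • (p.1 : Oct)) - G p.1) := by
      field_simp; ring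
    have h2 : 0 ≤ ψ p.2 * ((p.2 : ℝ) ^ 7)⁻¹ := mul_nonneg (hψnn _) (by positivity)
    rw [this, norm_mul, norm_neg, Real.norm_of_nonneg h2, mul_comm]
    exact mul_le_mul_of_nonneg_right (hclose' _ h p.1) h2
  · simp [hψ0 _ h]

/-! ### Locally uniform limits of monogenic functions -/

/-- Taking the adjoint turns the solution of the dual equation into the left monogenic Cauchy
kernel; this converts the scalar Cauchy formula into the vector-valued one. -/
lemma inner_dualKernel_zero (a v x : Oct) :
    inner ℝ a (dualKernel 0 v x) = inner ℝ (cauchyKernel a x) v := by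
  rw [dualKernel_zero, cauchyKernel, inner_smul_right, real_inner_smul_left, inner_omul_left,
    oconj_oconj]

/-- The derivative of the Cauchy kernel. -/
noncomputable def cauchyKernelDeriv (v x : Oct) : Oct →L[ℝ] Oct :=
  ((‖x‖ ^ 2) ^ 4)⁻¹ • ((omulL.flip v).comp oconjL) +
    (-(8 * ((‖x‖ ^ 2) ^ 5)⁻¹)) • (innerSL ℝ x).smulRight (oconj x ⬝ₒ v)

lemma hasFDerivAt_cauchyKernel {x : Oct} (h : x ≠ 0) (v : Oct) :
    HasFDerivAt (cauchyKernel v) (cauchyKernelDeriv v x) x := by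
  have h' : (0 : ℝ) ^ 2 + ‖x‖ ^ 2 ≠ 0 := by simpa using h
  have h1 := (hasFDerivAt_regularised_inv_pow h').smul ((omulL.flip v).comp oconjL).hasFDerivAt
  refine (h1.congr_of_eventuallyEq (Eventually.of_forall fun z => ?_)).congr_fderiv ?_
  · simp [cauchyKernel, ← pow_mul]
  · rw [innerSL_smul_smulRight]
    simp [cauchyKernelDeriv]

lemma crSymbol_cauchyKernelDeriv {x : Oct} (h : x ≠ 0) (v : Oct) :
    crSymbol (cauchyKernelDeriv v x) = 0 := by
  rw [cauchyKernelDeriv, map_add, map_smul, map_smul, crSymbol_oconj_omul, crSymbol_smulRight,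
    omul_oconj_omul, smul_smul, smul_smul, ← add_smul]
  convert zero_smul ℝ v
  have : ‖x‖ ≠ 0 := by simpa using h
  field_simp
  ring

/-- Serves as the dominating bound for differentiating a Cauchy integral under the integral sign
away from the pole. -/
lemma exists_norm_cauchyKernelDeriv_le {δ : ℝ} (hδ : 0 < δ) :
    ∃ C, 0 ≤ C ∧ ∀ v x : Oct, δ ≤ ‖x‖ → ‖cauchyKernelDeriv v x‖ ≤ C * ‖v‖ := by
  refine ⟨((δ ^ 2) ^ 4)⁻¹ * (‖omulL.flip‖ * ‖oconjL‖) + 8 * ((δ ^ 2) ^ 4)⁻¹, by positivity,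
    fun v x hx => ?_⟩
  have hx0 : 0 < ‖x‖ := hδ.trans_le hx
  refine (norm_add_le _ _).trans ?_
  rw [add_mul]
  refine add_le_add ?_ ?_
  · rw [norm_smul, norm_inv, norm_pow, norm_pow, norm_norm, mul_assoc]
    gcongr
    calc ‖(omulL.flip v).comp oconjL‖ ≤ ‖omulL.flip v‖ * ‖oconjL‖ :=
          ContinuousLinearMap.opNorm_comp_le _ _
      _ ≤ ‖omulL.flip‖ * ‖v‖ * ‖oconjL‖ := by gcongr; exact omulL.flip.le_opNorm v
      _ = _ := by ring
  · rw [norm_smul, ContinuousLinearMap.norm_smulRight_apply, innerSL_apply_norm, norm_omul,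
      norm_oconj, norm_neg, norm_mul, norm_inv, norm_pow, norm_pow, norm_norm]
    have : ‖(8 : ℝ)‖ * ((‖x‖ ^ 2) ^ 5)⁻¹ * (‖x‖ * (‖x‖ * ‖v‖)) = 8 * ((‖x‖ ^ 2) ^ 4)⁻¹ * ‖v‖ := by
      rw [Real.norm_of_nonneg (by norm_num)]
      field_simp
    rw [this]
    gcongr

lemma continuous_cauchyKernelDeriv_comp {α : Type*} [TopologicalSpace α] {f g : α → Oct}
    (hf : Continuous f) (hg : Continuous g) (h0 : ∀ a, g a ≠ 0) :
    Continuous fun a => cauchyKernelDeriv (f a) (g a) := by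
  have h1 : ∀ n : ℕ, Continuous fun a => ((‖g a‖ ^ 2) ^ n)⁻¹ := fun n =>
    Continuous.inv₀ (by fun_prop) fun a => by
      have := norm_pos_iff.2 (h0 a); positivity
  refine ((h1 4).smul ?_).add (((continuous_const.mul (h1 5)).neg).smul ?_)
  · exact ((omulL.flip.continuous.comp hf).clm_comp continuous_const)
  · have : Continuous fun a => ContinuousLinearMap.smulRightL ℝ Oct Oct (innerSL ℝ (g a))
        (oconj (g a) ⬝ₒ f a) :=
      (((ContinuousLinearMap.smulRightL ℝ Oct Oct).continuous.comp
        ((innerSL ℝ).continuous.comp hg))).clm_apply ((continuous_oconj.comp hg).omul hf)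
    exact this

lemma continuous_cauchyKernel_comp {α : Type*} [TopologicalSpace α] {f g : α → Oct}
    (hf : Continuous f) (hg : Continuous g) (h0 : ∀ a, g a ≠ 0) :
    Continuous fun a => cauchyKernel (f a) (g a) := by
  have h1 : Continuous fun a => (‖g a‖ ^ 8)⁻¹ :=
    Continuous.inv₀ (by fun_prop) fun a => by have := norm_pos_iff.2 (h0 a); positivity
  exact h1.smul ((continuous_oconj.comp hg).omul hf)

/-- Cauchy's formula on the unit ball, in vector form. -/
theorem ball_cauchy_vector {u : Oct → Oct} (huc : ContinuousOn u (Metric.closedBall 0 1))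
    (hu : LeftMonogenicOn u (Metric.ball 0 1)) {y : Oct} (hy : y ∈ Metric.ball (0 : Oct) 1) :
    u y = (3 / Real.pi ^ 4) • ∫ x : Metric.sphere (0 : Oct) 1,
      cauchyKernel ((x : Oct) ⬝ₒ u x) ((x : Oct) - y) ∂(volume : Measure Oct).toSphere := by
  have hy1 : ‖y‖ < 1 := by simpa using hy
  have hne : ∀ x : Metric.sphere (0 : Oct) 1, (x : Oct) - y ≠ 0 := fun x h => by
    have h2 := mem_sphere_zero_iff_norm.1 x.2
    rw [sub_eq_zero.1 h] at h2
    linarith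
  have hus : Continuous fun x : Metric.sphere (0 : Oct) 1 => u x :=
    huc.comp_continuous continuous_subtype_val fun x => Metric.sphere_subset_closedBall x.2
  have hc : Continuous fun x : Metric.sphere (0 : Oct) 1 =>
      cauchyKernel ((x : Oct) ⬝ₒ u x) ((x : Oct) - y) :=
    continuous_cauchyKernel_comp (continuous_subtype_val.omul hus) (by fun_prop) hne
  have hi : Integrable (fun x : Metric.sphere (0 : Oct) 1 =>
      cauchyKernel ((x : Oct) ⬝ₒ u x) ((x : Oct) - y)) (volume : Measure Oct).toSphere := by
    obtain ⟨M, hM⟩ := isCompact_univ.exists_bound_of_continuousOn hc.continuousOn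
    exact Integrable.of_bound hc.aestronglyMeasurable M
      (Eventually.of_forall fun x => hM x (mem_univ _))
  refine ext_inner_right ℝ fun v => ?_
  have h := ball_cauchy huc hu hy v
  simp only [inner_dualKernel_zero] at h
  have h2 := integral_inner (𝕜 := ℝ) hi v
  simp only [fun x : Oct => real_inner_comm x v] at h2
  rw [real_inner_smul_left, ← h2, h]
  have := Real.pi_pos
  field_simp

/-- The Cauchy transform of a continuous function on the sphere is monogenic at the centre. -/
lemma cauchyTransform_sphere_center {h : Metric.sphere (0 : Oct) 1 → Oct} (hh : Continuous h) :
    ∃ A : Oct →L[ℝ] Oct, crSymbol A = 0 ∧ HasFDerivAt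
      (fun y => ∫ x : Metric.sphere (0 : Oct) 1, cauchyKernel (h x) ((x : Oct) - y)
        ∂(volume : Measure Oct).toSphere) A 0 := by
  set m := (volume : Measure Oct).toSphere
  obtain ⟨M, hM⟩ := isCompact_univ.exists_bound_of_continuousOn hh.continuousOn
  obtain ⟨C, hC0, hC⟩ := exists_norm_cauchyKernelDeriv_le (δ := 1 / 2) (by norm_num)
  have hfar : ∀ x : Metric.sphere (0 : Oct) 1, ∀ y ∈ Metric.ball (0 : Oct) (1 / 2),
      1 / 2 ≤ ‖(x : Oct) - y‖ := fun x y hy => by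
    have h2 := mem_sphere_zero_iff_norm.1 x.2
    have h3 := norm_sub_norm_le (x : Oct) y
    have h4 := mem_ball_zero_iff.1 hy
    linarith
  have hne : ∀ x : Metric.sphere (0 : Oct) 1, ∀ y ∈ Metric.ball (0 : Oct) (1 / 2),
      (x : Oct) - y ≠ 0 := fun x y hy => by
    have := hfar x y hy
    exact norm_pos_iff.1 (by linarith)
  have h0 : (0 : Oct) ∈ Metric.ball (0 : Oct) (1 / 2) := Metric.mem_ball_self (by norm_num)
  have hc : ∀ y ∈ Metric.ball (0 : Oct) (1 / 2), Continuous fun x : Metric.sphere (0 : Oct) 1 =>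
      cauchyKernel (h x) ((x : Oct) - y) := fun y hy =>
    continuous_cauchyKernel_comp hh (by fun_prop) fun x => hne x y hy
  have hdc : Continuous fun x : Metric.sphere (0 : Oct) 1 =>
      -cauchyKernelDeriv (h x) ((x : Oct) - 0) :=
    (continuous_cauchyKernelDeriv_comp hh (by fun_prop) fun x => hne x 0 h0).neg
  have hmem : ∀ x, ‖h x‖ ≤ M := fun x => hM x (mem_univ _)
  have hint : ∀ {E : Type} [NormedAddCommGroup E] {f : Metric.sphere (0 : Oct) 1 → E},
      Continuous f → Integrable f m := fun {E} _ {f} hf => by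
    obtain ⟨M, hM⟩ := isCompact_univ.exists_bound_of_continuousOn hf.continuousOn
    exact Integrable.of_bound hf.aestronglyMeasurable M
      (Eventually.of_forall fun x => hM x (mem_univ _))
  refine ⟨_, ?_, hasFDerivAt_integral_of_dominated_of_fderiv_le
    (F' := fun y x => -cauchyKernelDeriv (h x) ((x : Oct) - y)) (bound := fun _ => C * M)
    (Metric.ball_mem_nhds (0 : Oct) (by norm_num : (0 : ℝ) < 1 / 2)) ?_ (hint (hc 0 h0))
    hdc.aestronglyMeasurable ?_ (integrable_const _) ?_⟩
  · rw [← ContinuousLinearMap.integral_comp_comm _ (hint hdc)]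
    refine integral_eq_zero_of_ae (Eventually.of_forall fun x => ?_)
    simp only [map_neg, crSymbol_cauchyKernelDeriv (hne x 0 h0), neg_zero, Pi.zero_apply]
  · filter_upwards [Metric.ball_mem_nhds (0 : Oct) (by norm_num : (0 : ℝ) < 1 / 2)] with y hy
      using (hc y hy).aestronglyMeasurable
  · refine Eventually.of_forall fun x y hy => ?_
    rw [norm_neg]
    exact (hC _ _ (hfar x y hy)).trans (by gcongr; exact hmem x)
  · refine Eventually.of_forall fun x y hy => ?_
    refine ((hasFDerivAt_cauchyKernel (hne x y hy) (h x)).comp y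
      ((hasFDerivAt_id y).const_sub (x : Oct))).congr_fderiv ?_
    ext z
    simp

/-- Locally uniform limits of left monogenic functions are left monogenic. -/
theorem LeftMonogenicOn.of_tendstoLocallyUniformlyOn {U : Set Oct} (hU : IsOpen U)
    {u : ℕ → Oct → Oct} {F : Oct → Oct} (hu : ∀ k, LeftMonogenicOn (u k) U)
    (hF : TendstoLocallyUniformlyOn u F atTop U) : LeftMonogenicOn F U := by
  refine leftMonogenicOn_of_hasFDerivAt fun a ha => ?_
  obtain ⟨r, hr, hrU⟩ := Metric.nhds_basis_closedBall.mem_iff.1 (hU.mem_nhds ha)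
  have hFc : ContinuousOn F U := hF.continuousOn (Frequently.of_forall fun k =>
    (hu k).1.continuousOn)
  have hunif : TendstoUniformlyOn u F atTop (Metric.closedBall a r) :=
    (tendstoLocallyUniformlyOn_iff_forall_isCompact hU).1 hF _ hrU (isCompact_closedBall a r)
  have hmaps : ∀ x ∈ Metric.closedBall (0 : Oct) 1, a + r • x ∈ Metric.closedBall a r := fun x hx => by
    rw [mem_closedBall_zero_iff] at hx
    simp [norm_smul, abs_of_pos hr]
    nlinarith
  have hsph : ∀ x : Metric.sphere (0 : Oct) 1, a + r • (x : Oct) ∈ Metric.closedBall a r := fun x =>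
    hmaps x (Metric.sphere_subset_closedBall x.2)
  have haff : Continuous fun x : Oct => a + r • x := by fun_prop
  have hFsph : Continuous fun x : Metric.sphere (0 : Oct) 1 => F (a + r • (x : Oct)) :=
    (hFc.mono hrU).comp_continuous (by fun_prop) hsph
  have husph : ∀ k, Continuous fun x : Metric.sphere (0 : Oct) 1 => u k (a + r • (x : Oct)) :=
    fun k => ((hu k).1.continuousOn.mono hrU).comp_continuous (by fun_prop) hsph
  obtain ⟨M, hM⟩ := isCompact_univ.exists_bound_of_continuousOn hFsph.continuousOn
  set m := (volume : Measure Oct).toSphere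
  -- Cauchy's formula on the sphere of radius r about `a` passes to the uniform limit. Restricting
  -- to the half-radius ball keeps the kernel bounded.
  have hrep : ∀ y ∈ Metric.ball (0 : Oct) (1 / 2), F (a + r • y) =
      (3 / Real.pi ^ 4) • ∫ x : Metric.sphere (0 : Oct) 1,
        cauchyKernel ((x : Oct) ⬝ₒ F (a + r • (x : Oct))) ((x : Oct) - y) ∂m := fun y hy => by
    have hy1 : y ∈ Metric.ball (0 : Oct) 1 := Metric.ball_subset_ball (by norm_num) hy
    have hfar : ∀ x : Metric.sphere (0 : Oct) 1, 1 / 2 ≤ ‖(x : Oct) - y‖ := fun x => by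
      have h2 := mem_sphere_zero_iff_norm.1 x.2
      have h3 := norm_sub_norm_le (x : Oct) y
      have h4 := mem_ball_zero_iff.1 hy
      linarith
    have h1 : Tendsto (fun k => u k (a + r • y)) atTop (𝓝 (F (a + r • y))) :=
      hunif.tendsto_at (hmaps y (Metric.ball_subset_closedBall hy1))
    have h2 : Tendsto (fun k => (3 / Real.pi ^ 4) • ∫ x : Metric.sphere (0 : Oct) 1,
        cauchyKernel ((x : Oct) ⬝ₒ u k (a + r • (x : Oct))) ((x : Oct) - y) ∂m) atTop
        (𝓝 ((3 / Real.pi ^ 4) • ∫ x : Metric.sphere (0 : Oct) 1,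
        cauchyKernel ((x : Oct) ⬝ₒ F (a + r • (x : Oct))) ((x : Oct) - y) ∂m)) := by
      refine Tendsto.const_smul ?_ _
      refine tendsto_integral_filter_of_dominated_convergence
        (fun _ => (((1 / 2 : ℝ)) ^ 7)⁻¹ * (1 * (M + 1))) ?_ ?_ (integrable_const _) ?_
      · refine Eventually.of_forall fun k => Continuous.aestronglyMeasurable ?_
        exact continuous_cauchyKernel_comp (continuous_subtype_val.omul (husph k)) (by fun_prop)
          fun x => norm_pos_iff.1 (by linarith [hfar x])
      · filter_upwards [Metric.tendstoUniformlyOn_iff.1 hunif 1 one_pos] with k hk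
        refine Eventually.of_forall fun x => ?_
        rw [norm_cauchyKernel, norm_omul, mem_sphere_zero_iff_norm.1 x.2]
        have h5 := hk _ (hsph x)
        have h6 := hM x (mem_univ _)
        rw [dist_comm, dist_eq_norm] at h5
        have h7 : ‖u k (a + r • (x : Oct))‖ ≤ M + 1 := by
          have := norm_sub_norm_le (u k (a + r • (x : Oct))) (F (a + r • (x : Oct)))
          linarith
        gcongr
        exact hfar x
      · refine Eventually.of_forall fun x => ?_
        have h5 : Tendsto (fun k => u k (a + r • (x : Oct))) atTop (𝓝 (F (a + r • (x : Oct)))) :=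
          hunif.tendsto_at (hsph x)
        have h6 : Continuous fun w : Oct => cauchyKernel ((x : Oct) ⬝ₒ w) ((x : Oct) - y) := by
          unfold cauchyKernel; fun_prop
        exact (h6.tendsto _).comp h5
    refine tendsto_nhds_unique h1 (h2.congr fun k => ?_)
    have hmono := (hu k).comp_affine hU a r (V := Metric.ball 0 1)
      fun x hx => hrU (hmaps x (Metric.ball_subset_closedBall hx))
    have hcont : ContinuousOn (fun x => u k (a + r • x)) (Metric.closedBall 0 1) :=
      (hu k).1.continuousOn.comp haff.continuousOn fun x hx => hrU (hmaps x hx)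
    exact (ball_cauchy_vector hcont hmono hy1).symm
  -- Differentiability at the centre suffices, because every point of `U` is the centre of such a
  -- ball.
  obtain ⟨A, hA0, hA⟩ := cauchyTransform_sphere_center
    (h := fun x => (x : Oct) ⬝ₒ F (a + r • (x : Oct))) (continuous_subtype_val.omul hFsph)
  have h3 : HasFDerivAt (fun y => F (a + r • y)) ((3 / Real.pi ^ 4) • A) 0 := by
    refine (hA.const_smul (3 / Real.pi ^ 4)).congr_of_eventuallyEq ?_
    filter_upwards [Metric.ball_mem_nhds (0 : Oct) (by norm_num : (0 : ℝ) < 1 / 2)] with y hy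
      using hrep y hy
  have h4 : HasFDerivAt (fun z : Oct => r⁻¹ • (z - a)) (r⁻¹ • ContinuousLinearMap.id ℝ Oct) a :=
    ((hasFDerivAt_id a).sub_const a).const_smul r⁻¹
  have h5 : r⁻¹ • (a - a) = 0 := by simp
  rw [← h5] at h3
  have h6 := h3.comp a h4
  refine ⟨_, h6.congr_of_eventuallyEq (Eventually.of_forall fun z => ?_), ?_⟩
  · simp [smul_smul, hr.ne']
  · rw [ContinuousLinearMap.comp_smul, ContinuousLinearMap.comp_id, map_smul, map_smul, hA0,
      smul_zero, smul_zero]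

/-! ### Linear structure of the generating functions -/

/-- Measurability along parallel surfaces of functions continuous in an open set. -/
lemma aestronglyMeasurable_comp_of_continuousOn {α : Type*} [MeasurableSpace α] {μ : Measure α}
    {U : Set Oct} (hU : IsOpen U) {F : Oct → Oct} (hF : ContinuousOn F U) {φ : α → Oct}
    (hφ : AEMeasurable φ μ) (hφU : ∀ᵐ x ∂μ, φ x ∈ U) :
    AEStronglyMeasurable (fun x => F (φ x)) μ := by
  classical
  have h1 : Measurable (U.piecewise F fun _ => 0) :=
    hF.measurable_piecewise continuousOn_const hU.measurableSet
  have h2 : AEMeasurable (fun x => U.piecewise F (fun _ => 0) (φ x)) μ := h1.comp_aemeasurable hφ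
  refine (h2.congr ?_).aestronglyMeasurable
  filter_upwards [hφU] with x hx using Set.piecewise_eq_of_mem _ _ _ hx

lemma enorm_add_sq_le (a b : Oct) : ‖a + b‖ₑ ^ 2 ≤ 2 * ‖a‖ₑ ^ 2 + 2 * ‖b‖ₑ ^ 2 := by
  have h : ‖a + b‖₊ ^ 2 ≤ 2 * ‖a‖₊ ^ 2 + 2 * ‖b‖₊ ^ 2 := by
    rw [← NNReal.coe_le_coe]
    push_cast
    nlinarith [norm_add_le a b, sq_nonneg (‖a‖ - ‖b‖), norm_nonneg (a + b)]
  simp only [enorm_eq_nnnorm]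
  exact_mod_cast h

lemma AEStronglyMeasurable.omul {α : Type*} [MeasurableSpace α] {μ : Measure α} {f g : α → Oct}
    (hf : AEStronglyMeasurable f μ) (hg : AEStronglyMeasurable g μ) :
    AEStronglyMeasurable (fun x => f x ⬝ₒ g x) μ :=
  omulL.aestronglyMeasurable_comp₂ hf hg

lemma AEStronglyMeasurable.oconj {α : Type*} [MeasurableSpace α] {μ : Measure α} {f : α → Oct}
    (hf : AEStronglyMeasurable f μ) : AEStronglyMeasurable (fun x => oconj (f x)) μ :=
  continuous_oconj.comp_aestronglyMeasurable hf

lemma integrable_oconj_omul {μ : Measure Oct} {n f g : Oct → Oct} (hm : AEMeasurable n μ)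
    (hn : ∀ᵐ x ∂μ, ‖n x‖ = 1) (hf : MemLp f 2 μ) (hg : MemLp g 2 μ) :
    Integrable (fun x => oconj (n x ⬝ₒ g x) ⬝ₒ (n x ⬝ₒ f x)) μ := by
  refine (MemLp.integrable_mul hg.norm hf.norm).mono' ?_ ?_
  · have h1 := hm.aestronglyMeasurable
    exact AEStronglyMeasurable.omul
      (AEStronglyMeasurable.oconj (AEStronglyMeasurable.omul h1 hg.1))
      (AEStronglyMeasurable.omul h1 hf.1)
  · filter_upwards [hn] with x hx
    simp [hx]

/-- The geometric properties of a domain which are used below. -/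
structure IsRegularDomain (D : HardyDomain) : Prop where
  isOpen : IsOpen D.carrier
  normal_aemeasurable : AEMeasurable D.normal D.surface
  normal_norm : ∀ᵐ x ∂D.surface, ‖D.normal x‖ = 1
  mem_frontier : ∀ᵐ x ∂D.surface, x ∈ frontier D.carrier
  parallel : ∀ᶠ s in 𝓝[>] (0 : ℝ), ∀ x ∈ frontier D.carrier, x - s • D.normal x ∈ D.carrier

lemma isHardyCore_zero (D : HardyDomain) : IsHardyCore D fun _ => 0 where
  monogenic := leftMonogenicOn_of_hasFDerivAt fun x _ => ⟨0, hasFDerivAt_const _ _, map_zero _⟩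
  continuousOn := continuousOn_const
  memLp := MemLp.zero
  bounded := ⟨0, fun s _ _ => by simp⟩

namespace IsRegularDomain

variable {D : HardyDomain} (hD : IsRegularDomain D)
include hD

lemma aestronglyMeasurable_parallel {F : Oct → Oct} (hF : ContinuousOn F D.carrier) {s : ℝ}
    (hs : ∀ x ∈ frontier D.carrier, x - s • D.normal x ∈ D.carrier) :
    AEStronglyMeasurable (fun x => F (x - s • D.normal x)) D.surface :=
  aestronglyMeasurable_comp_of_continuousOn hD.isOpen hF
    (aemeasurable_id.sub (hD.normal_aemeasurable.const_smul s))
    (hD.mem_frontier.mono hs)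

lemma core_add {F G : Oct → Oct} (hF : IsHardyCore D F) (hG : IsHardyCore D G) :
    IsHardyCore D fun x => F x + G x where
  monogenic := hF.monogenic.add hD.isOpen hG.monogenic
  continuousOn := hF.continuousOn.add hG.continuousOn
  memLp := hF.memLp.add hG.memLp
  bounded := by
    obtain ⟨A, hA⟩ := hF.bounded
    obtain ⟨B, hB⟩ := hG.bounded
    refine ⟨2 * A + 2 * B, fun s hs hpar => ?_⟩
    have hm := (hD.aestronglyMeasurable_parallel hF.monogenic.1.continuousOn hpar).enorm
    have hm2 := (hD.aestronglyMeasurable_parallel hG.monogenic.1.continuousOn hpar).enorm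
    calc ∫⁻ x, ‖F (x - s • D.normal x) + G (x - s • D.normal x)‖ₑ ^ 2 ∂D.surface
        ≤ ∫⁻ x, (2 * ‖F (x - s • D.normal x)‖ₑ ^ 2 + 2 * ‖G (x - s • D.normal x)‖ₑ ^ 2)
          ∂D.surface := lintegral_mono fun x => enorm_add_sq_le _ _
      _ = 2 * ∫⁻ x, ‖F (x - s • D.normal x)‖ₑ ^ 2 ∂D.surface +
          2 * ∫⁻ x, ‖G (x - s • D.normal x)‖ₑ ^ 2 ∂D.surface := by
        rw [lintegral_add_left' ((hm.pow_const 2).const_mul 2),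
          lintegral_const_mul'' _ (hm.pow_const 2), lintegral_const_mul'' _ (hm2.pow_const 2)]
      _ ≤ 2 * (A : ℝ≥0∞) + 2 * (B : ℝ≥0∞) := by
        gcongr
        exacts [hA s hs hpar, hB s hs hpar]
      _ = ((2 * A + 2 * B : ℝ≥0) : ℝ≥0∞) := by push_cast; rfl

lemma core_smul {F : Oct → Oct} (hF : IsHardyCore D F) (c : ℝ) :
    IsHardyCore D fun x => c • F x where
  monogenic := hF.monogenic.const_smul hD.isOpen c
  continuousOn := hF.continuousOn.const_smul c
  memLp := hF.memLp.const_smul c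
  bounded := by
    obtain ⟨A, hA⟩ := hF.bounded
    refine ⟨‖c‖₊ ^ 2 * A, fun s hs hpar => ?_⟩
    have hm := (hD.aestronglyMeasurable_parallel hF.monogenic.1.continuousOn hpar).enorm
    simp only [enorm_smul, mul_pow]
    rw [lintegral_const_mul'' _ (hm.pow_const 2), ENNReal.coe_mul, ENNReal.coe_pow]
    gcongr
    · exact le_rfl
    · exact hA s hs hpar

end IsRegularDomain

/-! ### Szegő projections from reproducing systems -/

/-- The functions `K y v` represent the functionals `F ↦ ⟨F(y), v⟩` on the generating functions,
are generating functions themselves, and their span behaves well along parallel surfaces. -/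
structure IsSzegoSystem (D : HardyDomain) (S : Oct → Oct → Oct) (K : Oct → Oct → Oct → Oct) : Prop
    extends IsRegularDomain D where
  conj_symm : ∀ x y, oconj (S x y) = S y x
  core : ∀ y ∈ D.carrier, ∀ v, IsHardyCore D (K y v)
  kernel_one : ∀ y ∈ D.carrier, K y (octE 0) = fun x => S x y
  boundary : ∀ y ∈ D.carrier, ∀ v, ∀ᵐ x ∂D.surface,
    oconj (D.normal x) ⬝ₒ ((D.normal x ⬝ₒ S x y) ⬝ₒ v) = K y v x
  reproducing : ∀ u, IsHardyCore D u → ∀ y ∈ D.carrier, ∀ v,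
    ∫ x, inner ℝ (u x) (K y v x) ∂D.surface = Real.pi ^ 4 / 3 * inner ℝ (u y) v
  loc_bound : ∀ y ∈ D.carrier, ∃ t ∈ 𝓝 y, ∃ B : ℝ≥0, ∀ z ∈ t ∩ D.carrier, ∀ v,
    eLpNorm (K z v) 2 D.surface ≤ B * ‖v‖ₑ
  contraction : ∃ M : ℝ≥0, ∀ᶠ s in 𝓝[>] (0 : ℝ),
    ∀ w ∈ Submodule.span ℝ {k | ∃ y ∈ D.carrier, ∃ v, k = K y v},
      eLpNorm (fun x => w (x - s • D.normal x)) 2 D.surface ≤ M * eLpNorm w 2 D.surface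
  approach : ∀ y ∈ D.carrier, ∀ v, Tendsto
    (fun s : ℝ => eLpNorm (fun x => K y v (x - s • D.normal x) - K y v x) 2 D.surface)
    (𝓝[>] 0) (𝓝 0)

/-- The span of the reproducing functions. -/
def kernelSpan (D : HardyDomain) (K : Oct → Oct → Oct → Oct) : Submodule ℝ (Oct → Oct) :=
  Submodule.span ℝ {k | ∃ y ∈ D.carrier, ∃ v, k = K y v}

/-- The classes in `L²(∂Ω)` of the span of the reproducing functions. -/
def kernelSpanL2 (D : HardyDomain) (K : Oct → Oct → Oct → Oct) : Submodule ℝ (BoundaryL2 D) where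
  carrier := {f | ∃ w ∈ kernelSpan D K, f =ᵐ[D.surface] w}
  add_mem' := by
    rintro f g ⟨w, hw, hf⟩ ⟨z, hz, hg⟩
    exact ⟨w + z, add_mem hw hz, (Lp.coeFn_add f g).trans (hf.add hg)⟩
  zero_mem' := ⟨0, zero_mem _, Lp.coeFn_zero _ _ _⟩
  smul_mem' := by
    rintro c f ⟨w, hw, hf⟩
    exact ⟨c • w, Submodule.smul_mem _ c hw, (Lp.coeFn_smul c f).trans (hf.const_smul c)⟩

lemma totalSzego_eq_octInner (D : HardyDomain) (S : Oct → Oct → Oct) (f : Oct → Oct) (y : Oct) :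
    totalSzego D (fun _ => S) f y = octInner D f fun x => S x y := octE_sum _

/-- The real part of āb is the Euclidean inner product, and left multiplication by the unit normal
is an isometry; so ⟨·,·⟩₀ is a multiple of the real L² inner product. -/
lemma compInner_zero (D : HardyDomain) (hn : ∀ᵐ x ∂D.surface, ‖D.normal x‖ = 1)
    (hm : AEMeasurable D.normal D.surface) {f g : Oct → Oct} (hf : MemLp f 2 D.surface)
    (hg : MemLp g 2 D.surface) :
    compInner D 0 f g = 3 / Real.pi ^ 4 * ∫ x, inner ℝ (g x) (f x) ∂D.surface := by
  have hi := integrable_oconj_omul hm hn hf hg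
  rw [compInner, octInner, PiLp.smul_apply, smul_eq_mul]
  congr 1
  rw [← inner_octE_left, ← integral_inner (𝕜 := ℝ) hi]
  refine integral_congr_ae ?_
  filter_upwards [hn] with x hx
  rw [inner_octE_left, omul_apply_zero_oconj, inner_omul_omul, hx]
  simp

namespace IsSzegoSystem

variable {D : HardyDomain} {S : Oct → Oct → Oct} {K : Oct → Oct → Oct → Oct}

lemma integrable_octInner (h : IsSzegoSystem D S K) {f : Oct → Oct} (hf : MemLp f 2 D.surface)
    {y : Oct} (hy : y ∈ D.carrier) :
    Integrable (fun x => oconj (D.normal x ⬝ₒ S x y) ⬝ₒ (D.normal x ⬝ₒ f x)) D.surface := by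
  have hS : MemLp (fun x => S x y) 2 D.surface := by
    rw [← h.kernel_one y hy]; exact (h.core y hy _).memLp
  exact integrable_oconj_omul h.normal_aemeasurable h.normal_norm hf hS

/-- The total Szegő projection against a vector is an inner product with `K y v`. -/
lemma inner_totalSzego (h : IsSzegoSystem D S K) {f : Oct → Oct} (hf : MemLp f 2 D.surface)
    {y : Oct} (hy : y ∈ D.carrier) (v : Oct) :
    inner ℝ (totalSzego D (fun _ => S) f y) v =
      3 / Real.pi ^ 4 * ∫ x, inner ℝ (f x) (K y v x) ∂D.surface := by
  rw [totalSzego_eq_octInner, octInner, real_inner_smul_left, real_inner_comm,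
    ← integral_inner (𝕜 := ℝ) (h.integrable_octInner hf hy)]
  congr 1
  refine integral_congr_ae ?_
  filter_upwards [h.boundary y hy v] with x hx
  rw [← hx, real_inner_comm, inner_omul_left, inner_omul_left, oconj_oconj]

/-- The class of `K y v` in `L²(∂Ω)`. -/
noncomputable def kernelL2 (h : IsSzegoSystem D S K) {y : Oct} (hy : y ∈ D.carrier) (v : Oct) :
    BoundaryL2 D := (h.core y hy v).memLp.toLp

lemma kernelL2_mem (h : IsSzegoSystem D S K) {y : Oct} (hy : y ∈ D.carrier) (v : Oct) :
    h.kernelL2 hy v ∈ kernelSpanL2 D K :=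
  ⟨K y v, Submodule.subset_span ⟨y, hy, v, rfl⟩, MemLp.coeFn_toLp _⟩

lemma inner_totalSzego_L2 (h : IsSzegoSystem D S K) (f : BoundaryL2 D) {y : Oct}
    (hy : y ∈ D.carrier) (v : Oct) :
    inner ℝ (totalSzego D (fun _ => S) f y) v =
      3 / Real.pi ^ 4 * inner ℝ f (h.kernelL2 hy v) := by
  rw [h.inner_totalSzego (Lp.memLp f) hy, L2.inner_def]
  congr 1
  refine integral_congr_ae ?_
  filter_upwards [(h.core y hy v).memLp.coeFn_toLp] with x hx
  rw [kernelL2, hx]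

lemma totalSzego_congr {f g : Oct → Oct} (hfg : f =ᵐ[D.surface] g) :
    totalSzego D (fun _ => S) f = totalSzego D (fun _ => S) g := by
  ext1 y
  rw [totalSzego_eq_octInner, totalSzego_eq_octInner, octInner, octInner]
  congr 1
  refine integral_congr_ae ?_
  filter_upwards [hfg] with x hx
  rw [hx]

/-- The normalising factor 3/π⁴ cancels the mass π⁴/3 in the reproducing identity. -/
lemma totalSzego_core (h : IsSzegoSystem D S K) {u : Oct → Oct} (hu : IsHardyCore D u) {y : Oct}
    (hy : y ∈ D.carrier) : totalSzego D (fun _ => S) u y = u y := by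
  refine ext_inner_right ℝ fun v => ?_
  rw [h.inner_totalSzego hu.memLp hy, h.reproducing u hu y hy]
  have := Real.pi_pos
  field_simp

lemma totalSzego_sub (h : IsSzegoSystem D S K) (f g : BoundaryL2 D) {y : Oct}
    (hy : y ∈ D.carrier) : totalSzego D (fun _ => S) (f - g : BoundaryL2 D) y =
      totalSzego D (fun _ => S) f y - totalSzego D (fun _ => S) g y := by
  refine ext_inner_right ℝ fun v => ?_
  rw [inner_sub_left, h.inner_totalSzego_L2 _ hy, h.inner_totalSzego_L2 _ hy,
    h.inner_totalSzego_L2 _ hy, inner_sub_left, mul_sub]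

/-- Testing the transform T against itself gives ‖T‖² as a multiple of ⟨f, K z T⟩; Cauchy–Schwarz
and the linear bound of `K z v` in v then allow one factor ‖T‖ to be cancelled. -/
lemma exists_norm_totalSzego_le (h : IsSzegoSystem D S K) {y : Oct} (hy : y ∈ D.carrier) :
    ∃ t ∈ 𝓝 y, ∃ B : ℝ, ∀ z ∈ t ∩ D.carrier, ∀ f : BoundaryL2 D,
      ‖totalSzego D (fun _ => S) f z‖ ≤ B * ‖f‖ := by
  obtain ⟨t, ht, B, hB⟩ := h.loc_bound y hy
  refine ⟨t, ht, 3 / Real.pi ^ 4 * B, fun z hz f => ?_⟩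
  set T := totalSzego D (fun _ => S) f z
  have hk : ‖h.kernelL2 hz.2 T‖ ≤ B * ‖T‖ := by
    have h1 := hB z hz T
    rw [← Lp.enorm_toLp (h.core z hz.2 T).memLp] at h1
    have h2 := ENNReal.toReal_mono (by finiteness) h1
    simpa [kernelL2] using h2
  have hpi := Real.pi_pos
  have h1 : ‖T‖ ^ 2 ≤ 3 / Real.pi ^ 4 * B * ‖f‖ * ‖T‖ := by
    rw [← real_inner_self_eq_norm_sq, h.inner_totalSzego_L2 f hz.2]
    calc 3 / Real.pi ^ 4 * inner ℝ f (h.kernelL2 hz.2 T)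
        ≤ 3 / Real.pi ^ 4 * (‖f‖ * (B * ‖T‖)) := by
          gcongr
          exact (real_inner_le_norm _ _).trans (by gcongr)
      _ = _ := by ring
  rcases (norm_nonneg T).eq_or_lt with h0 | h0
  · rw [← h0]; positivity
  · rw [sq] at h1
    exact le_of_mul_le_mul_right h1 h0

lemma core_of_mem_kernelSpan (h : IsSzegoSystem D S K) {w : Oct → Oct}
    (hw : w ∈ kernelSpan D K) : IsHardyCore D w := by
  refine Submodule.span_induction ?_ ?_ ?_ ?_ hw
  · rintro _ ⟨y, hy, v, rfl⟩; exact h.core y hy v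
  · exact isHardyCore_zero D
  · exact fun _ _ _ _ h1 h2 => h.toIsRegularDomain.core_add h1 h2
  · exact fun c _ _ h1 => h.toIsRegularDomain.core_smul h1 c

lemma aestronglyMeasurable_parallel_sub (h : IsSzegoSystem D S K) {w : Oct → Oct}
    (hw : w ∈ kernelSpan D K) : ∀ᶠ s in 𝓝[>] (0 : ℝ),
      AEStronglyMeasurable (fun x => w (x - s • D.normal x) - w x) D.surface := by
  have hc := h.core_of_mem_kernelSpan hw
  filter_upwards [h.parallel] with s hs
  exact (h.aestronglyMeasurable_parallel hc.monogenic.1.continuousOn hs).sub hc.memLp.1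

/-- Convergence along parallel surfaces to the boundary values. -/
def TendstoParallel (D : HardyDomain) (w : Oct → Oct) : Prop :=
  Tendsto (fun s : ℝ => eLpNorm (fun x => w (x - s • D.normal x) - w x) 2 D.surface)
    (𝓝[>] 0) (𝓝 0)

lemma tendstoParallel_add (h : IsSzegoSystem D S K) {f g : Oct → Oct} (hf : f ∈ kernelSpan D K)
    (hg : g ∈ kernelSpan D K) (h1 : TendstoParallel D f) (h2 : TendstoParallel D g) :
    TendstoParallel D (f + g) := by
  have h3 := Tendsto.add h1 h2
  rw [add_zero] at h3
  refine tendsto_of_tendsto_of_tendsto_of_le_of_le' tendsto_const_nhds h3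
    (Eventually.of_forall fun _ => zero_le) ?_
  filter_upwards [h.aestronglyMeasurable_parallel_sub hf,
    h.aestronglyMeasurable_parallel_sub hg] with s hs1 hs2
  refine le_trans (le_of_eq ?_) (eLpNorm_add_le hs1 hs2 (by norm_num))
  congr 1
  ext1 x
  simp only [Pi.add_apply]
  abel

lemma tendstoParallel_smul {f : Oct → Oct} (c : ℝ) (h1 : TendstoParallel D f) :
    TendstoParallel D (c • f) := by
  have h2 : ∀ s : ℝ, eLpNorm (fun x => (c • f) (x - s • D.normal x) - (c • f) x) 2 D.surface =
      ‖c‖ₑ * eLpNorm (fun x => f (x - s • D.normal x) - f x) 2 D.surface := fun s => by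
    rw [← eLpNorm_const_smul]
    congr 1
    ext1 x
    simp only [Pi.smul_apply, smul_sub]
  have h3 := ENNReal.Tendsto.const_mul (a := ‖c‖ₑ) h1 (Or.inr enorm_ne_top)
  rw [mul_zero] at h3
  exact h3.congr fun s => (h2 s).symm

lemma approach_of_mem_kernelSpan (h : IsSzegoSystem D S K) {w : Oct → Oct}
    (hw : w ∈ kernelSpan D K) : TendstoParallel D w := by
  refine Submodule.span_induction (p := fun w _ => TendstoParallel D w) ?_ ?_ ?_ ?_ hw
  · rintro _ ⟨y, hy, v, rfl⟩; exact h.approach y hy v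
  · simp [TendstoParallel]
  · exact fun f g hf hg h1 h2 => h.tendstoParallel_add hf hg h1 h2
  · exact fun c f _ h1 => tendstoParallel_smul c h1

/-- Elements of the closure are limits of sequences of functions in the span. -/
lemma exists_seq_kernelSpan {g : BoundaryL2 D}
    (hg : g ∈ (kernelSpanL2 D K).topologicalClosure) :
    ∃ w : ℕ → Oct → Oct, (∀ k, w k ∈ kernelSpan D K) ∧ ∃ G : ℕ → BoundaryL2 D,
      (∀ k, G k =ᵐ[D.surface] w k) ∧ Tendsto G atTop (𝓝 g) := by
  obtain ⟨G, hG, hlim⟩ := mem_closure_iff_seq_limit.1 hg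
  choose w hw hGw using hG
  exact ⟨w, hw, G, hGw, hlim⟩

lemma totalSzego_of_ae_eq_core (h : IsSzegoSystem D S K) {f : BoundaryL2 D} {u : Oct → Oct}
    (hu : IsHardyCore D u) (hfu : f =ᵐ[D.surface] u) {y : Oct} (hy : y ∈ D.carrier) :
    totalSzego D (fun _ => S) f y = u y := by
  rw [totalSzego_congr hfu, h.totalSzego_core hu hy]

lemma tendsto_totalSzego (h : IsSzegoSystem D S K) {G : ℕ → BoundaryL2 D} {g : BoundaryL2 D}
    (hG : Tendsto G atTop (𝓝 g)) {y : Oct} (hy : y ∈ D.carrier) :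
    Tendsto (fun k => totalSzego D (fun _ => S) (G k) y) atTop
      (𝓝 (totalSzego D (fun _ => S) g y)) := by
  obtain ⟨t, ht, B, hB⟩ := h.exists_norm_totalSzego_le hy
  rw [tendsto_iff_norm_sub_tendsto_zero] at hG ⊢
  refine squeeze_zero (fun _ => norm_nonneg _) (fun k => ?_) (by simpa using hG.const_mul B)
  rw [← h.totalSzego_sub _ _ hy]
  exact hB y ⟨mem_of_mem_nhds ht, hy⟩ _

/-- Locally uniform boundedness of evaluation turns L² convergence of traces from the span into
locally uniform convergence in the domain. -/
lemma leftMonogenicOn_totalSzego (h : IsSzegoSystem D S K) {g : BoundaryL2 D}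
    (hg : g ∈ (kernelSpanL2 D K).topologicalClosure) :
    LeftMonogenicOn (totalSzego D (fun _ => S) g) D.carrier := by
  obtain ⟨w, hw, G, hGw, hlim⟩ := exists_seq_kernelSpan hg
  refine LeftMonogenicOn.of_tendstoLocallyUniformlyOn h.isOpen
    (fun k => (h.core_of_mem_kernelSpan (hw k)).monogenic) ?_
  rw [Metric.tendstoLocallyUniformlyOn_iff]
  intro ε hε y hy
  obtain ⟨t, ht, B, hB⟩ := h.exists_norm_totalSzego_le hy
  refine ⟨t ∩ D.carrier, inter_mem (mem_nhdsWithin_of_mem_nhds ht) self_mem_nhdsWithin, ?_⟩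
  have h1 : Tendsto (fun k => B * ‖g - G k‖) atTop (𝓝 0) := by
    simpa using (tendsto_iff_norm_sub_tendsto_zero.1 hlim).const_mul B |>.congr
      fun k => by rw [norm_sub_rev]
  filter_upwards [h1.eventually (gt_mem_nhds hε)] with k hk z hz
  rw [dist_eq_norm, ← h.totalSzego_of_ae_eq_core (h.core_of_mem_kernelSpan (hw k)) (hGw k) hz.2,
    ← h.totalSzego_sub _ _ hz.2]
  exact (hB z hz _).trans_lt hk

lemma isHardyExtension_totalSzego (h : IsSzegoSystem D S K) {g : BoundaryL2 D}
    (hg : g ∈ (kernelSpanL2 D K).topologicalClosure) :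
    IsHardyExtension D g (totalSzego D (fun _ => S) g) := by
  obtain ⟨w, hw, G, hGw, hlim⟩ := exists_seq_kernelSpan hg
  refine ⟨h.leftMonogenicOn_totalSzego hg, w, fun k => h.core_of_mem_kernelSpan (hw k), ?_,
    fun y hy => ?_⟩
  · refine ((Lp.tendsto_Lp_iff_tendsto_eLpNorm' G g).1 hlim).congr fun k => eLpNorm_congr_ae ?_
    filter_upwards [hGw k] with x hx
    simp [hx]
  · refine (h.tendsto_totalSzego hlim hy).congr fun k =>
      h.totalSzego_of_ae_eq_core (h.core_of_mem_kernelSpan (hw k)) (hGw k) hy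

/-- The Cauchy transform is bounded along parallel surfaces. -/
lemma exists_eLpNorm_parallel_le (h : IsSzegoSystem D S K) :
    ∃ M : ℝ≥0, ∀ᶠ s in 𝓝[>] (0 : ℝ), ∀ g ∈ (kernelSpanL2 D K).topologicalClosure,
      eLpNorm (fun x => totalSzego D (fun _ => S) g (x - s • D.normal x)) 2 D.surface ≤
        M * ‖g‖ₑ := by
  obtain ⟨M, hM⟩ := h.contraction
  refine ⟨M, ?_⟩
  filter_upwards [hM, h.parallel] with s hs hpar g hg
  obtain ⟨w, hw, G, hGw, hlim⟩ := exists_seq_kernelSpan hg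
  have hwc := fun k => h.core_of_mem_kernelSpan (hw k)
  -- Fatou's lemma: on a parallel surface the approximants from the span converge pointwise, so
  -- their uniform bound is inherited by the limit.
  refine (Lp.eLpNorm_lim_le_liminf_eLpNorm (f := fun k x => w k (x - s • D.normal x))
    (fun k => h.aestronglyMeasurable_parallel (hwc k).monogenic.1.continuousOn hpar) _ ?_).trans ?_
  · filter_upwards [h.mem_frontier] with x hx
    refine (h.tendsto_totalSzego hlim (hpar x hx)).congr fun k =>
      h.totalSzego_of_ae_eq_core (hwc k) (hGw k) (hpar x hx)
  · have h1 : Tendsto (fun k => M * ‖G k‖ₑ) atTop (𝓝 (M * ‖g‖ₑ)) :=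
      ENNReal.Tendsto.const_mul hlim.enorm (Or.inr ENNReal.coe_ne_top)
    rw [← h1.liminf_eq]
    refine liminf_le_liminf (Eventually.of_forall fun k => ?_)
    rw [Lp.enorm_def, eLpNorm_congr_ae (hGw k)]
    exact hs (w k) (hw k)

/-- A three-term estimate with an approximant w from the span: the transform of g − w is bounded
uniformly along parallel surfaces, w converges to its own trace, and w − g is small on the boundary.
-/
lemma hasBoundaryValue_totalSzego (h : IsSzegoSystem D S K) {g : BoundaryL2 D}
    (hg : g ∈ (kernelSpanL2 D K).topologicalClosure) :
    HasBoundaryValue D (totalSzego D (fun _ => S) g) g := by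
  obtain ⟨M, hM⟩ := h.exists_eLpNorm_parallel_le
  obtain ⟨w, hw, G, hGw, hlim⟩ := exists_seq_kernelSpan hg
  have hwc := fun k => h.core_of_mem_kernelSpan (hw k)
  rw [HasBoundaryValue, ENNReal.tendsto_nhds_zero]
  intro ε hε
  have h1 : Tendsto (fun k => M * ‖g - G k‖ₑ + ‖g - G k‖ₑ) atTop (𝓝 0) := by
    have h2 : Tendsto (fun k => ‖g - G k‖ₑ) atTop (𝓝 0) := by
      simpa using (hlim.const_sub g).enorm
    simpa using (ENNReal.Tendsto.const_mul h2 (Or.inr ENNReal.coe_ne_top)).add h2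
  obtain ⟨k, hk⟩ := (ENNReal.tendsto_nhds_zero.1 h1 (ε / 2) (ENNReal.half_pos hε.ne')).exists
  have hGmem : G k ∈ (kernelSpanL2 D K).topologicalClosure :=
    Submodule.le_topologicalClosure _ ⟨w k, hw k, hGw k⟩
  filter_upwards [hM, h.parallel, ENNReal.tendsto_nhds_zero.1 (h.approach_of_mem_kernelSpan (hw k))
    (ε / 2) (ENNReal.half_pos hε.ne')] with s hs hpar happ
  have hcont := (h.leftMonogenicOn_totalSzego hg).1.continuousOn
  have hcontd := (h.leftMonogenicOn_totalSzego (Submodule.sub_mem _ hg hGmem)).1.continuousOn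
  have hm1 := h.aestronglyMeasurable_parallel hcontd hpar
  have hm2 := (h.aestronglyMeasurable_parallel (hwc k).monogenic.1.continuousOn hpar).sub
    (hwc k).memLp.1
  have hm3 := (Lp.aestronglyMeasurable (G k - g))
  have heq : (fun x => totalSzego D (fun _ => S) g (x - s • D.normal x) - g x) =ᵐ[D.surface]
      ((fun x => totalSzego D (fun _ => S) (g - G k : BoundaryL2 D) (x - s • D.normal x)) +
        fun x => w k (x - s • D.normal x) - w k x) + (G k - g : BoundaryL2 D) := by
    filter_upwards [h.mem_frontier, hGw k, Lp.coeFn_sub (G k) g] with x hx hGx hsub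
    simp only [Pi.add_apply, hsub, Pi.sub_apply, hGx]
    rw [h.totalSzego_sub _ _ (hpar x hx), h.totalSzego_of_ae_eq_core (hwc k) (hGw k) (hpar x hx)]
    abel
  rw [eLpNorm_congr_ae heq]
  calc _ ≤ eLpNorm (fun x => totalSzego D (fun _ => S) (g - G k : BoundaryL2 D)
          (x - s • D.normal x)) 2 D.surface +
        eLpNorm (fun x => w k (x - s • D.normal x) - w k x) 2 D.surface +
        eLpNorm (G k - g : BoundaryL2 D) 2 D.surface :=
        (eLpNorm_add_le (hm1.add hm2) hm3 (by norm_num)).trans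
          (add_le_add_left (eLpNorm_add_le hm1 hm2 (by norm_num)) _)
    _ ≤ M * ‖g - G k‖ₑ + ε / 2 + ‖g - G k‖ₑ := by
        gcongr
        · exact hs _ (Submodule.sub_mem _ hg hGmem)
        · rw [← Lp.enorm_def, ← enorm_neg, neg_sub]
    _ = (M * ‖g - G k‖ₑ + ‖g - G k‖ₑ) + ε / 2 := by ring
    _ ≤ ε / 2 + ε / 2 := by gcongr
    _ = ε := ENNReal.add_halves ε

/-- The transform sees f only through its pairings with the `K y v`, so it does not change when f is
projected onto their closed span. -/
lemma totalSzego_eq_of_inner_eq (h : IsSzegoSystem D S K) {f g : BoundaryL2 D}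
    (hfg : ∀ k ∈ (kernelSpanL2 D K).topologicalClosure, inner ℝ (f - g) k = 0) {y : Oct}
    (hy : y ∈ D.carrier) : totalSzego D (fun _ => S) f y = totalSzego D (fun _ => S) g y := by
  refine ext_inner_right ℝ fun v => ?_
  have := hfg _ (Submodule.le_topologicalClosure _ (h.kernelL2_mem hy v))
  rw [inner_sub_left, sub_eq_zero] at this
  rw [h.inner_totalSzego_L2 _ hy, h.inner_totalSzego_L2 _ hy, this]

/-- Generating functions lie in the closed span of the reproducing functions. -/
lemma core_mem_closure (h : IsSzegoSystem D S K) {u : Oct → Oct} (hu : IsHardyCore D u)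
    {f : BoundaryL2 D} (hfu : f =ᵐ[D.surface] u) :
    f ∈ (kernelSpanL2 D K).topologicalClosure := by
  set N := (kernelSpanL2 D K).topologicalClosure with hN
  set p := N.starProjection f with hp
  have hpN : p ∈ N := N.starProjection_apply_mem f
  have hTp : ∀ y ∈ D.carrier, totalSzego D (fun _ => S) p y = u y := fun y hy => by
    rw [← h.totalSzego_of_ae_eq_core hu hfu hy]
    exact (h.totalSzego_eq_of_inner_eq (fun k hk => N.starProjection_inner_eq_zero f k hk) hy).symm
  have hbv := h.hasBoundaryValue_totalSzego hpN
  -- Fatou's lemma is applied along a sequence of surfaces; the offset `k₀` ensures that all of them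
  -- lie in the domain.
  have hseq : Tendsto (fun k : ℕ => 1 / ((k : ℝ) + 1)) atTop (𝓝[>] 0) :=
    tendsto_nhdsWithin_iff.2 ⟨tendsto_one_div_add_atTop_nhds_zero_nat,
      Eventually.of_forall fun k => by simp only [mem_Ioi]; positivity⟩
  obtain ⟨k₀, hk₀⟩ := eventually_atTop.1 (hseq.eventually h.parallel)
  set s : ℕ → ℝ := fun k => 1 / (((k + k₀ : ℕ) : ℝ) + 1) with hs
  have hs0 : Tendsto s atTop (𝓝[>] 0) := hseq.comp (tendsto_add_atTop_nat k₀)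
  have hspar : ∀ k, ∀ x ∈ frontier D.carrier, x - s k • D.normal x ∈ D.carrier := fun k =>
    hk₀ (k + k₀) (Nat.le_add_left _ _)
  -- Along these surfaces u tends to its trace pointwise by continuity up to the boundary, while the
  -- same function is the transform of p and tends to p in L².
  have hzero : eLpNorm (fun x => u x - p x) 2 D.surface = 0 := by
    refine le_antisymm ?_ zero_le
    refine (Lp.eLpNorm_lim_le_liminf_eLpNorm
      (f := fun k x => u (x - s k • D.normal x) - p x)
      (fun k => (h.aestronglyMeasurable_parallel hu.monogenic.1.continuousOn (hspar k)).sub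
        (Lp.aestronglyMeasurable p)) _ ?_).trans ?_
    · filter_upwards [h.mem_frontier] with x hx
      refine Tendsto.sub_const ?_ _
      have hxc : x ∈ closure D.carrier := frontier_subset_closure hx
      refine (hu.continuousOn x hxc).tendsto.comp (tendsto_nhdsWithin_iff.2 ⟨?_, ?_⟩)
      · have hc : Continuous fun t : ℝ => x - t • D.normal x := by fun_prop
        have := (hc.tendsto 0).comp (hs0.mono_right nhdsWithin_le_nhds)
        simpa [Function.comp_def] using this
      · exact Eventually.of_forall fun k => subset_closure (hspar k x hx)
    · refine le_of_eq ((hbv.comp hs0).congr fun k => ?_).liminf_eq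
      refine eLpNorm_congr_ae ?_
      filter_upwards [h.mem_frontier] with x hx
      rw [hTp _ (hspar k x hx)]
  have hae : f = p := by
    have h1 := (eLpNorm_eq_zero_iff (hu.memLp.1.sub (Lp.aestronglyMeasurable p)) (by norm_num)).1
      hzero
    refine Lp.ext ?_
    filter_upwards [hfu, h1] with x hx1 hx2
    rw [hx1]
    exact sub_eq_zero.1 hx2
  rw [hae]
  exact hpN

/-- One inclusion is that traces of generating functions lie in the closed span, the other that the
span itself consists of generating functions. -/
lemma hardySpace_eq (h : IsSzegoSystem D S K) :
    hardySpace D = (kernelSpanL2 D K).topologicalClosure := by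
  refine Subset.antisymm ?_ ?_
  · refine closure_minimal ?_ (kernelSpanL2 D K).isClosed_topologicalClosure
    rintro f ⟨F, hF, hfF⟩
    exact h.core_mem_closure hF hfF
  · refine closure_mono ?_
    rintro f ⟨w, hw, hfw⟩
    exact ⟨w, h.core_of_mem_kernelSpan hw, hfw⟩

/-- With one kernel for all i, the pairing ⟨f, S(·,y)⟩ᵢ is the i-th coordinate of the total
transform. All components thus follow from the transform reproducing generating functions and being
continuous in L². -/
lemma isComponentKernel (h : IsSzegoSystem D S K) (i : Fin 8) : IsComponentKernel D i S := by
  refine fun y hy => ⟨by rw [← h.kernel_one y hy]; exact h.core y hy _, ?_⟩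
  rintro f F - ⟨-, u, hu, hlim, hpt⟩
  change octInner D f (fun x => S x y) i = F y i
  rw [← totalSzego_eq_octInner]
  refine congrArg (fun z : Oct => z i) ?_
  have h1 : Tendsto (fun k => (hu k).memLp.toLp) atTop (𝓝 f) := by
    rw [Lp.tendsto_Lp_iff_tendsto_eLpNorm']
    refine hlim.congr fun k => eLpNorm_congr_ae ?_
    filter_upwards [(hu k).memLp.coeFn_toLp] with x hx
    simp [hx]
  refine tendsto_nhds_unique (h.tendsto_totalSzego h1 hy) ((hpt y hy).congr fun k => ?_)
  exact (h.totalSzego_of_ae_eq_core (hu k) (hu k).memLp.coeFn_toLp hy).symm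

/-- The orthogonal projection onto the Hardy space is the total Szegő projection. -/
theorem main (h : IsSzegoSystem D S K) :
    (∀ x y : Oct, oconj (S x y) = S y x) ∧
    (∀ i : Fin 8, IsComponentKernel D i S) ∧
    ∃ P : BoundaryL2 D →L[ℝ] BoundaryL2 D,
      (∀ f : BoundaryL2 D,
        HasBoundaryValue D (totalSzego D (fun _ => S) f) (P f) ∧
        IsHardyExtension D (P f) (totalSzego D (fun _ => S) f)) ∧
      (∀ f g : BoundaryL2 D, compInner D 0 (P f) g = compInner D 0 f (P g)) ∧
      (∀ f : BoundaryL2 D, P (P f) = P f) ∧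
      Set.range P = hardySpace D ∧
      (∀ f h : BoundaryL2 D, h ∈ hardySpace D → compInner D 0 (fun x => f x - P f x) h = 0) := by
  set N := (kernelSpanL2 D K).topologicalClosure with hN
  have hin : ∀ f g : BoundaryL2 D, compInner D 0 f g = 3 / Real.pi ^ 4 * inner ℝ g f :=
    fun f g => by
      rw [compInner_zero D h.normal_norm h.normal_aemeasurable (Lp.memLp f) (Lp.memLp g),
        L2.inner_def]
  have hT : ∀ f : BoundaryL2 D, ∀ y ∈ D.carrier, totalSzego D (fun _ => S) f y =
      totalSzego D (fun _ => S) (N.starProjection f : BoundaryL2 D) y := fun f y hy =>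
    h.totalSzego_eq_of_inner_eq (fun k hk => N.starProjection_inner_eq_zero f k hk) hy
  refine ⟨h.conj_symm, h.isComponentKernel, N.starProjection, fun f => ⟨?_, ?_⟩, fun f g => ?_,
    fun f => ?_, ?_, fun f g hg => ?_⟩
  · refine (h.hasBoundaryValue_totalSzego (N.starProjection_apply_mem f)).congr' ?_
    filter_upwards [h.parallel] with s hs
    refine eLpNorm_congr_ae ?_
    filter_upwards [h.mem_frontier] with x hx
    rw [hT f _ (hs x hx)]
  · obtain ⟨hmono, u, hu, hlim, hpt⟩ :=
      h.isHardyExtension_totalSzego (N.starProjection_apply_mem f)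
    -- The transforms of f and of its projection are only known to agree inside the domain, so the
    -- derivative is carried over by equality near each interior point.
    refine ⟨leftMonogenicOn_of_hasFDerivAt fun y hy => ⟨_,
      (hmono.hasFDerivAt h.isOpen hy).congr_of_eventuallyEq ?_, hmono.crSymbol_eq_zero hy⟩,
      u, hu, hlim, fun y hy => by rw [hT f y hy]; exact hpt y hy⟩
    filter_upwards [h.isOpen.mem_nhds hy] with z hz using hT f z hz
  · rw [hin, hin, N.inner_starProjection_left_eq_right]
  · exact Submodule.starProjection_eq_self_iff.2 (N.starProjection_apply_mem f)
  · rw [h.hardySpace_eq]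
    refine Subset.antisymm ?_ fun f hf => ⟨f, Submodule.starProjection_eq_self_iff.2 hf⟩
    rintro _ ⟨f, rfl⟩
    exact N.starProjection_apply_mem f
  · rw [h.hardySpace_eq] at hg
    have h1 := hin (f - N.starProjection f) g
    rw [real_inner_comm, N.starProjection_inner_eq_zero f g hg, mul_zero] at h1
    have h2 : octInner D (fun x => f x - N.starProjection f x) g =
        octInner D (f - N.starProjection f : BoundaryL2 D) g := by
      rw [octInner, octInner]
      congr 1
      refine integral_congr_ae ?_
      filter_upwards [Lp.coeFn_sub f (N.starProjection f)] with x hx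
      rw [hx, Pi.sub_apply]
    rw [compInner, h2]
    exact h1

end IsSzegoSystem

/-! ### Square-integrable functions -/

lemma integrable_inner_of_memLp {α : Type*} [MeasurableSpace α] {μ : Measure α} {f g : α → Oct}
    (hf : MemLp f 2 μ) (hg : MemLp g 2 μ) : Integrable (fun x => inner ℝ (f x) (g x)) μ :=
  (MemLp.integrable_mul hf.norm hg.norm).mono' (hf.1.inner hg.1)
    (Eventually.of_forall fun _ => norm_inner_le_norm _ _)

lemma integrable_norm_sq_of_memLp {α : Type*} [MeasurableSpace α] {μ : Measure α} {f : α → Oct}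
    (hf : MemLp f 2 μ) : Integrable (fun x => ‖f x‖ ^ 2) μ := by
  simpa using integrable_inner_of_memLp hf hf

lemma integral_inner_le_average {α : Type*} [MeasurableSpace α] {μ : Measure α} {f g : α → Oct}
    (hf : MemLp f 2 μ) (hg : MemLp g 2 μ) :
    ∫ x, inner ℝ (f x) (g x) ∂μ ≤ (∫ x, ‖f x‖ ^ 2 ∂μ + ∫ x, ‖g x‖ ^ 2 ∂μ) / 2 := by
  rw [← integral_add (integrable_norm_sq_of_memLp hf) (integrable_norm_sq_of_memLp hg),
    ← integral_div]
  refine integral_mono (integrable_inner_of_memLp hf hg)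
    (((integrable_norm_sq_of_memLp hf).add (integrable_norm_sq_of_memLp hg)).div_const 2) fun x => ?_
  have h1 := real_inner_le_norm (f x) (g x)
  simp only
  nlinarith [sq_nonneg (‖f x‖ - ‖g x‖)]

lemma eLpNorm_two_le_of_integral_le {α β : Type*} [MeasurableSpace α] [MeasurableSpace β]
    {μ : Measure α} {ν : Measure β} {f : α → Oct} {g : β → Oct} {C : ℝ≥0}
    (hf : MemLp f 2 μ) (hg : MemLp g 2 ν)
    (h : ∫ x, ‖f x‖ ^ 2 ∂μ ≤ C ^ 2 * ∫ x, ‖g x‖ ^ 2 ∂ν) : eLpNorm f 2 μ ≤ C * eLpNorm g 2 ν := by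
  rw [hf.eLpNorm_eq_integral_rpow_norm two_ne_zero ENNReal.ofNat_ne_top,
    hg.eLpNorm_eq_integral_rpow_norm two_ne_zero ENNReal.ofNat_ne_top,
    ← ENNReal.ofReal_coe_nnreal, ← ENNReal.ofReal_mul C.coe_nonneg]
  refine ENNReal.ofReal_le_ofReal ?_
  simp only [ENNReal.toReal_ofNat, Real.rpow_ofNat]
  have h2 : ∀ t : ℝ, t ^ (2⁻¹ : ℝ) = √t := fun t => by rw [Real.sqrt_eq_rpow]; norm_num
  rw [h2, h2]
  calc √(∫ x, ‖f x‖ ^ 2 ∂μ) ≤ √(C ^ 2 * ∫ x, ‖g x‖ ^ 2 ∂ν) := Real.sqrt_le_sqrt h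
    _ = _ := by rw [Real.sqrt_mul (by positivity), Real.sqrt_sq C.coe_nonneg]

/-- A bounded sequence with `aₙ ≤ (b + aₙ₊₁)/2` starts below `b`. -/
lemma le_of_le_average {a : ℕ → ℝ} {b M : ℝ} (h : ∀ n, a n ≤ (b + a (n + 1)) / 2)
    (hM : ∀ n, a n ≤ M) : a 0 ≤ b := by
  have h1 : ∀ n, a 0 - b ≤ (a n - b) * (1 / 2) ^ n := fun n => by
    induction n with
    | zero => simp
    | succ n ih =>
      refine ih.trans ?_
      rw [pow_succ]
      have := h n
      have h2 : 0 ≤ (1 / 2 : ℝ) ^ n := by positivity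
      nlinarith
  have h2 : Tendsto (fun n : ℕ => (M - b) * (1 / 2 : ℝ) ^ n) atTop (𝓝 ((M - b) * 0)) :=
    (tendsto_pow_atTop_nhds_zero_of_lt_one (by norm_num) (by norm_num)).const_mul _
  have h3 : a 0 - b ≤ (M - b) * 0 := ge_of_tendsto' h2 fun n =>
    (h1 n).trans (by gcongr; exact hM n)
  linarith

/-! ### The unit ball -/

/-- The functions representing `F ↦ ⟨F(y), v⟩` on the unit ball. -/
noncomputable def ballSystem (y v x : Oct) : Oct :=
  (‖octE 0 - oconj x ⬝ₒ y‖ ^ 8)⁻¹ • (v - oconj x ⬝ₒ (y ⬝ₒ v))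

lemma one_sub_le_norm_ball {x y : Oct} (hx : ‖x‖ ≤ 1) :
    1 - ‖y‖ ≤ ‖octE 0 - oconj x ⬝ₒ y‖ := by
  have h1 := norm_sub_norm_le (octE 0) (oconj x ⬝ₒ y)
  rw [norm_octE, norm_omul, norm_oconj] at h1
  nlinarith [norm_nonneg y]

/-- For z = y/|y|² − x alternativity gives z̄(yw) = w − x̄(yw). The function is therefore a Cauchy
kernel with pole at the inversion of y in the sphere, outside the closed ball when |y| < 1. -/
lemma ballSystem_eq_cauchyKernel {y : Oct} (hy : y ≠ 0) (v x : Oct) :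
    ballSystem y v x =
      (‖y‖ ^ 8)⁻¹ • cauchyKernel (y ⬝ₒ v) ((‖y‖ ^ 2)⁻¹ • y + (-1 : ℝ) • x) := by
  have h0 : ‖y‖ ≠ 0 := by simpa using hy
  set z : Oct := (‖y‖ ^ 2)⁻¹ • y + (-1 : ℝ) • x with hz
  have h1 : ∀ w, oconj z ⬝ₒ (y ⬝ₒ w) = w - oconj x ⬝ₒ (y ⬝ₒ w) := fun w => by
    rw [hz, oconj_add, oconj_smul, oconj_smul, add_omul, smul_omul, smul_omul, oconj_omul_omul,
      smul_smul, inv_mul_cancel₀ (by positivity), one_smul, neg_one_smul, sub_eq_add_neg]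
  have h2 : octE 0 - oconj x ⬝ₒ y = oconj z ⬝ₒ y := by
    have := h1 (octE 0)
    rw [omul_one] at this
    exact this.symm
  rw [ballSystem, cauchyKernel, h1, smul_smul, h2, norm_omul, norm_oconj, mul_pow, mul_inv, mul_comm]

lemma leftMonogenicOn_ballSystem {y : Oct} (hy : ‖y‖ < 1) (v : Oct) :
    LeftMonogenicOn (ballSystem y v) (Metric.ball 0 1) := by
  rcases eq_or_ne y 0 with rfl | h0
  · have : ballSystem 0 v = fun _ => v := by
      ext1 x; simp [ballSystem, omul_zero, zero_omul]
    rw [this]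
    exact leftMonogenicOn_of_hasFDerivAt fun x _ => ⟨0, hasFDerivAt_const _ _, map_zero _⟩
  · have : ballSystem y v = fun x =>
        (‖y‖ ^ 8)⁻¹ • cauchyKernel (y ⬝ₒ v) ((‖y‖ ^ 2)⁻¹ • y + (-1 : ℝ) • x) := by
      ext1 x; exact ballSystem_eq_cauchyKernel h0 v x
    rw [this]
    refine LeftMonogenicOn.const_smul Metric.isOpen_ball
      ((leftMonogenicOn_cauchyKernel _).comp_affine isOpen_compl_singleton _ _ fun x hx h => ?_) _
    have hx1 : ‖x‖ < 1 := by simpa using hx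
    have h2 : x = (‖y‖ ^ 2)⁻¹ • y := by
      have h3 : (‖y‖ ^ 2)⁻¹ • y + (-1 : ℝ) • x = 0 := h
      rw [neg_one_smul, ← sub_eq_add_neg, sub_eq_zero] at h3
      exact h3.symm
    have hy0 : 0 < ‖y‖ := by simpa using h0
    have h4 : ‖x‖ = ‖y‖⁻¹ := by
      rw [h2, norm_smul, norm_inv, norm_pow, norm_norm]
      field_simp
    rw [h4] at hx1
    exact absurd (one_lt_inv_iff₀.2 ⟨hy0, hy⟩) hx1.not_gt

lemma continuousOn_ballSystem {y : Oct} (hy : ‖y‖ < 1) (v : Oct) :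
    ContinuousOn (ballSystem y v) (Metric.closedBall 0 1) := by
  unfold ballSystem
  have h1 : Continuous fun x : Oct => octE 0 - oconj x ⬝ₒ y :=
    continuous_const.sub (continuous_oconj.omul continuous_const)
  have h2 : Continuous fun x : Oct => v - oconj x ⬝ₒ (y ⬝ₒ v) :=
    continuous_const.sub (continuous_oconj.omul continuous_const)
  refine ((h1.norm.pow 8).continuousOn.inv₀ fun x hx => ?_).smul h2.continuousOn
  have := one_sub_le_norm_ball (y := y) (mem_closedBall_zero_iff.1 hx)
  have h2 : 0 < ‖octE 0 - oconj x ⬝ₒ y‖ := by linarith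
  exact (pow_pos h2 8).ne'

lemma norm_ballSystem_le {r : ℝ} (hr : r < 1) {x y : Oct} (hx : ‖x‖ ≤ 1) (hy : ‖y‖ ≤ r) (v : Oct) :
    ‖ballSystem y v x‖ ≤ ((1 - r) ^ 8)⁻¹ * 2 * ‖v‖ := by
  have h1 := one_sub_le_norm_ball (y := y) hx
  have h2 : ‖v - oconj x ⬝ₒ (y ⬝ₒ v)‖ ≤ 2 * ‖v‖ := by
    refine (norm_sub_le _ _).trans ?_
    rw [norm_omul, norm_omul, norm_oconj]
    have h3 : ‖x‖ * (‖y‖ * ‖v‖) ≤ 1 * (1 * ‖v‖) := by gcongr; linarith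
    linarith
  rw [ballSystem, norm_smul, norm_inv, norm_pow, norm_norm, mul_assoc]
  have : 0 < 1 - r := by linarith
  gcongr
  linarith

/-- x and y enter only through products of one with the other, so a real dilation can be moved from
one to the other; the dilation semigroup thus preserves the reproducing system. -/
lemma ballSystem_smul (r : ℝ) (y v x : Oct) : ballSystem y v (r • x) = ballSystem (r • y) v x := by
  simp only [ballSystem, oconj_smul, smul_omul, omul_smul]

lemma isFiniteMeasure_unitBall : IsFiniteMeasure unitBall.surface := by
  unfold unitBall; infer_instance

lemma ae_unitBall : ∀ᵐ x ∂unitBall.surface, ‖x‖ = 1 := by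
  simp only [unitBall]
  rw [(MeasurableEmbedding.subtype_coe Metric.isClosed_sphere.measurableSet).ae_map_iff]
  exact Eventually.of_forall fun x => mem_sphere_zero_iff_norm.1 x.2

lemma isRegularDomain_unitBall : IsRegularDomain unitBall where
  isOpen := Metric.isOpen_ball
  normal_aemeasurable := aemeasurable_id
  normal_norm := ae_unitBall
  mem_frontier := by
    filter_upwards [ae_unitBall] with x hx
    simp only [unitBall]
    rw [frontier_ball _ one_ne_zero]
    simpa using hx
  parallel := by
    filter_upwards [Ioo_mem_nhdsGT (zero_lt_one (α := ℝ))] with s hs x hx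
    simp only [unitBall] at hx ⊢
    rw [frontier_ball _ one_ne_zero, mem_sphere_zero_iff_norm] at hx
    have : x - s • x = (1 - s) • x := by rw [sub_smul, one_smul]
    rw [this, mem_ball_zero_iff, norm_smul, hx, Real.norm_of_nonneg (by linarith [hs.2])]
    linarith [hs.1]

lemma memLp_unitBall {F : Oct → Oct} (hF : ContinuousOn F (Metric.closedBall 0 1)) {r : ℝ}
    (h0 : 0 ≤ r) (h1 : r ≤ 1) : MemLp (fun x => F (r • x)) 2 unitBall.surface := by
  simp only [unitBall]
  have hemb : MeasurableEmbedding (Subtype.val : Metric.sphere (0 : Oct) 1 → Oct) :=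
    MeasurableEmbedding.subtype_coe Metric.isClosed_sphere.measurableSet
  rw [hemb.memLp_map_measure_iff]
  have hc : Continuous fun x : Metric.sphere (0 : Oct) 1 => F (r • (x : Oct)) :=
    hF.comp_continuous (by fun_prop) fun x => by
      rw [mem_closedBall_zero_iff, norm_smul, mem_sphere_zero_iff_norm.1 x.2,
        Real.norm_of_nonneg h0, mul_one]
      exact h1
  obtain ⟨M, hM⟩ := isCompact_univ.exists_bound_of_continuousOn hc.continuousOn
  exact MemLp.of_bound hc.aestronglyMeasurable M (Eventually.of_forall fun x => hM x (mem_univ _))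

lemma isHardyCore_unitBall {F : Oct → Oct} (hF : ContinuousOn F (Metric.closedBall 0 1))
    (hm : LeftMonogenicOn F (Metric.ball 0 1)) : IsHardyCore unitBall F where
  monogenic := hm
  continuousOn := by
    have : closure unitBall.carrier = Metric.closedBall (0 : Oct) 1 := closure_ball _ one_ne_zero
    rwa [this]
  memLp := by simpa using memLp_unitBall hF zero_le_one le_rfl
  bounded := by
    have := isFiniteMeasure_unitBall
    obtain ⟨M, hM⟩ := (isCompact_closedBall (0 : Oct) 1).exists_bound_of_continuousOn hF
    have h0 : 0 ≤ M := (norm_nonneg _).trans (hM 0 (by simp))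
    lift M to ℝ≥0 using h0
    refine ⟨M ^ 2 * (unitBall.surface univ).toNNReal, fun s _ hpar => ?_⟩
    calc ∫⁻ x, ‖F (x - s • unitBall.normal x)‖ₑ ^ 2 ∂unitBall.surface
        ≤ ∫⁻ _, (M : ℝ≥0∞) ^ 2 ∂unitBall.surface := by
          refine lintegral_mono_ae ?_
          filter_upwards [isRegularDomain_unitBall.mem_frontier] with x hx
          have h1 := hM _ (Metric.ball_subset_closedBall (hpar x hx))
          gcongr
          rw [enorm_eq_nnnorm]
          exact_mod_cast h1
      _ = _ := by
          rw [lintegral_const, ENNReal.coe_mul, ENNReal.coe_pow,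
            ENNReal.coe_toNNReal (measure_ne_top _ _)]

lemma IsHardyCore.continuousOn_closedBall {F : Oct → Oct} (hF : IsHardyCore unitBall F) :
    ContinuousOn F (Metric.closedBall 0 1) := by
  have : closure unitBall.carrier = Metric.closedBall (0 : Oct) 1 := closure_ball _ one_ne_zero
  rw [← this]; exact hF.continuousOn

/-- On the sphere x(1 − x̄y) = x − y, and x̄((x − y)v) = v − x̄(yv). This dictates the bracketing
x̄(yv) in `ballSystem`, which differs in general from (x̄y)v. -/
lemma ballKernel_boundary {x y : Oct} (hx : ‖x‖ = 1) (v : Oct) :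
    oconj x ⬝ₒ ((x ⬝ₒ ballKernel x y) ⬝ₒ v) = ballSystem y v x := by
  have h1 : x ⬝ₒ (octE 0 - oconj x ⬝ₒ y) = x - y := by
    rw [omul_sub, omul_one, omul_oconj_omul, hx]; simp
  have h2 : oconj x ⬝ₒ ((x - y) ⬝ₒ v) = v - oconj x ⬝ₒ (y ⬝ₒ v) := by
    rw [sub_omul, omul_sub, oconj_omul_omul, hx]; simp
  rw [ballKernel, omul_smul, h1, smul_omul, omul_smul, h2, ballSystem]

/-- On the unit sphere |x − y| = |1 − x̄y|, so moving the normal x across the inner product turns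
the integrand of Cauchy's formula into the pairing with the system. -/
lemma ball_reproducing {u : Oct → Oct} (hu : IsHardyCore unitBall u) {y : Oct} (hy : ‖y‖ < 1)
    (v : Oct) : ∫ x, inner ℝ (u x) (ballSystem y v x) ∂unitBall.surface =
      Real.pi ^ 4 / 3 * inner ℝ (u y) v := by
  have hemb : MeasurableEmbedding (Subtype.val : Metric.sphere (0 : Oct) 1 → Oct) :=
    MeasurableEmbedding.subtype_coe Metric.isClosed_sphere.measurableSet
  rw [← ball_cauchy hu.continuousOn_closedBall hu.monogenic (mem_ball_zero_iff.2 hy) v]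
  simp only [unitBall]
  rw [hemb.integral_map]
  refine integral_congr_ae (Eventually.of_forall fun x => ?_)
  have hx := mem_sphere_zero_iff_norm.1 x.2
  have h1 : (x : Oct) ⬝ₒ (octE 0 - oconj x ⬝ₒ y) = x - y := by
    rw [omul_sub, omul_one, omul_oconj_omul, hx]; simp
  have h2 : oconj (x : Oct) ⬝ₒ (((x : Oct) - y) ⬝ₒ v) = v - oconj x ⬝ₒ (y ⬝ₒ v) := by
    rw [sub_omul, omul_sub, oconj_omul_omul, hx]; simp
  have h3 : ‖(x : Oct) - y‖ = ‖octE 0 - oconj x ⬝ₒ y‖ := by rw [← h1, norm_omul, hx, one_mul]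
  simp only
  rw [dualKernel_zero, inner_smul_right, inner_omul_left, h2, h3, ballSystem, inner_smul_right]

/-- Dilation is symmetric on the span: on a generator both sides reproduce (π⁴/3) ⟨u(rr'y), v⟩, once
the dilation of the generator has been moved onto y. -/
lemma ball_inner_dilation {u : Oct → Oct} (hu : IsHardyCore unitBall u) {w : Oct → Oct}
    (hw : w ∈ kernelSpan unitBall ballSystem) {r r' : ℝ} (hr : 0 ≤ r) (hr1 : r ≤ 1) (hr' : 0 ≤ r')
    (hr'1 : r' ≤ 1) :
    ∫ x, inner ℝ (u (r • x)) (w (r' • x)) ∂unitBall.surface =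
      ∫ x, inner ℝ (u ((r * r') • x)) (w x) ∂unitBall.surface := by
  have hmaps : ∀ {t : ℝ}, 0 ≤ t → t ≤ 1 → ∀ {x : Oct} {R : ℝ}, ‖x‖ ≤ R → ‖t • x‖ ≤ R :=
    fun {t} h0 h1 {x R} hx => by
      rw [norm_smul, Real.norm_of_nonneg h0]
      nlinarith [norm_nonneg x]
  have hcore : ∀ {t : ℝ}, 0 ≤ t → t ≤ 1 → IsHardyCore unitBall fun x => u (t • x) :=
    fun {t} h0 h1 => by
      refine isHardyCore_unitBall (hu.continuousOn_closedBall.comp (by fun_prop) fun x hx => ?_) ?_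
      · exact mem_closedBall_zero_iff.2 (hmaps h0 h1 (mem_closedBall_zero_iff.1 hx))
      · have := hu.monogenic.comp_affine Metric.isOpen_ball 0 t (V := Metric.ball 0 1) fun x hx => by
          rw [zero_add, mem_ball_zero_iff, norm_smul, Real.norm_of_nonneg h0]
          have := mem_ball_zero_iff.1 hx
          nlinarith [norm_nonneg x]
        simpa using this
  have hcoreS : ∀ {w : Oct → Oct}, w ∈ kernelSpan unitBall ballSystem →
      ContinuousOn w (Metric.closedBall 0 1) := fun {w} hw => by
    refine Submodule.span_induction (p := fun w _ => ContinuousOn w (Metric.closedBall 0 1))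
      ?_ ?_ ?_ ?_ hw
    · rintro _ ⟨y, hy, v, rfl⟩; exact continuousOn_ballSystem (mem_ball_zero_iff.1 hy) v
    · exact continuousOn_const
    · exact fun f g _ _ hf hg => hf.add hg
    · exact fun c f _ hf => hf.const_smul c
  have hint : ∀ {w : Oct → Oct}, w ∈ kernelSpan unitBall ballSystem → ∀ {t t' : ℝ}, 0 ≤ t → t ≤ 1 →
      0 ≤ t' → t' ≤ 1 → Integrable (fun x => inner ℝ (u (t • x)) (w (t' • x))) unitBall.surface :=
    fun {w} hw {t t'} h0 h1 h0' h1' => integrable_inner_of_memLp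
      (memLp_unitBall hu.continuousOn_closedBall h0 h1) (memLp_unitBall (hcoreS hw) h0' h1')
  have hrr : 0 ≤ r * r' ∧ r * r' ≤ 1 := ⟨mul_nonneg hr hr', mul_le_one₀ hr1 hr' hr'1⟩
  refine Submodule.span_induction (p := fun w _ =>
    ∫ x, inner ℝ (u (r • x)) (w (r' • x)) ∂unitBall.surface =
      ∫ x, inner ℝ (u ((r * r') • x)) (w x) ∂unitBall.surface) ?_ ?_ ?_ ?_ hw
  · rintro _ ⟨y, hy, v, rfl⟩
    have hy1 : ‖y‖ < 1 := mem_ball_zero_iff.1 hy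
    simp only [ballSystem_smul]
    rw [ball_reproducing (hcore hr hr1) ((hmaps hr' hr'1 le_rfl).trans_lt hy1),
      ball_reproducing (hcore hrr.1 hrr.2) hy1, smul_smul]
  · simp
  · intro f g hf hg h1 h2
    have h3 := hint hf hrr.1 hrr.2 zero_le_one le_rfl
    have h4 := hint hg hrr.1 hrr.2 zero_le_one le_rfl
    simp only [one_smul] at h3 h4
    simp only [Pi.add_apply, inner_add_right]
    rw [integral_add (hint hf hr hr1 hr' hr'1) (hint hg hr hr1 hr' hr'1), h1, h2,
      integral_add h3 h4]
  · intro c f _ h1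
    simp only [Pi.smul_apply, inner_smul_right]
    rw [integral_const_mul, integral_const_mul, h1]

theorem isSzegoSystem_unitBall : IsSzegoSystem unitBall ballKernel ballSystem where
  toIsRegularDomain := isRegularDomain_unitBall
  conj_symm x y := by
    have h : oconj (octE 0 - oconj x ⬝ₒ y) = octE 0 - oconj y ⬝ₒ x := by
      rw [oconj_sub, oconj_one, oconj_omul, oconj_oconj]
    rw [ballKernel, oconj_smul, h, ← norm_oconj (octE 0 - oconj x ⬝ₒ y), h, ballKernel]
  core y hy v := isHardyCore_unitBall (continuousOn_ballSystem (mem_ball_zero_iff.1 hy) v)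
    (leftMonogenicOn_ballSystem (mem_ball_zero_iff.1 hy) v)
  kernel_one y _ := by
    ext1 x
    rw [ballSystem, omul_one, ballKernel]
  boundary y _ v := by
    filter_upwards [ae_unitBall] with x hx using ballKernel_boundary hx v
  reproducing u hu y hy v := ball_reproducing hu (mem_ball_zero_iff.1 hy) v
  loc_bound y hy := by
    have := isFiniteMeasure_unitBall
    have hy1 : ‖y‖ < 1 := mem_ball_zero_iff.1 hy
    obtain ⟨r, hyr, hr1⟩ := exists_between hy1
    have hr0 : 0 < 1 - r := by linarith
    refine ⟨Metric.ball 0 r, Metric.isOpen_ball.mem_nhds (mem_ball_zero_iff.2 hyr),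
      (unitBall.surface univ ^ (2 : ℝ)⁻¹).toNNReal * Real.toNNReal (((1 - r) ^ 8)⁻¹ * 2),
      fun z hz v => ?_⟩
    have h1 := eLpNorm_le_of_ae_bound (p := 2) (μ := unitBall.surface) (f := ballSystem z v)
      (C := ((1 - r) ^ 8)⁻¹ * 2 * ‖v‖) (by
        filter_upwards [ae_unitBall] with x hx
        exact norm_ballSystem_le hr1 hx.le (mem_ball_zero_iff.1 hz.1).le v)
    refine h1.trans (le_of_eq ?_)
    rw [ENNReal.coe_mul, ENNReal.coe_toNNReal (by finiteness), ENNReal.toReal_ofNat,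
      ENNReal.ofReal_mul (by positivity), mul_assoc, ofReal_norm]
    rfl
  contraction := by
    refine ⟨1, ?_⟩
    filter_upwards [Ioo_mem_nhdsGT (zero_lt_one (α := ℝ))] with s hs w hw
    have hwc : IsHardyCore unitBall w := by
      refine Submodule.span_induction (p := fun w _ => IsHardyCore unitBall w) ?_ ?_ ?_ ?_ hw
      · rintro _ ⟨y, hy, v, rfl⟩
        exact isHardyCore_unitBall (continuousOn_ballSystem (mem_ball_zero_iff.1 hy) v)
          (leftMonogenicOn_ballSystem (mem_ball_zero_iff.1 hy) v)
      · exact isHardyCore_zero _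
      · exact fun _ _ _ _ h1 h2 => isRegularDomain_unitBall.core_add h1 h2
      · exact fun c _ _ h1 => isRegularDomain_unitBall.core_smul h1 c
    have hc := hwc.continuousOn_closedBall
    set r := 1 - s with hr
    have hr0 : 0 ≤ r := by linarith [hs.2]
    have hr1 : r ≤ 1 := by linarith [hs.1]
    have hpow : ∀ n : ℕ, 0 ≤ r ^ n ∧ r ^ n ≤ 1 := fun n => ⟨by positivity, pow_le_one₀ hr0 hr1⟩
    have heq : (fun x => w (x - s • unitBall.normal x)) = fun x => w (r • x) := by
      ext1 x
      rw [hr, sub_smul, one_smul]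
      rfl
    rw [heq]
    have hw1 : MemLp w 2 unitBall.surface := hwc.memLp
    refine eLpNorm_two_le_of_integral_le (memLp_unitBall hc hr0 hr1) hw1 ?_
    simp only [NNReal.coe_one, one_pow, one_mul]
    obtain ⟨M, hM⟩ := (isCompact_closedBall (0 : Oct) 1).exists_bound_of_continuousOn hc
    have := isFiniteMeasure_unitBall
    -- The exponents 2ⁿ double because the squared norm at dilation ρ is the pairing of w at
    -- dilation ρ² with w itself, which is at most the average of the two squared norms.
    have key := le_of_le_average (a := fun n : ℕ => ∫ x, ‖w (r ^ 2 ^ n • x)‖ ^ 2 ∂unitBall.surface)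
      (b := ∫ x, ‖w x‖ ^ 2 ∂unitBall.surface) (M := M ^ 2 * unitBall.surface.real univ)
      (fun n => ?_) (fun n => ?_)
    · simpa using key
    · have h1 := ball_inner_dilation hwc hw (hpow (2 ^ n)).1 (hpow (2 ^ n)).2 (hpow (2 ^ n)).1
        (hpow (2 ^ n)).2
      simp only [real_inner_self_eq_norm_sq, ← pow_add] at h1
      rw [← two_mul, ← pow_succ'] at h1
      rw [h1]
      exact (integral_inner_le_average (memLp_unitBall hc (hpow _).1 (hpow _).2) hw1).trans
        (le_of_eq (by ring))
    · have h1 := integral_mono_ae (μ := unitBall.surface)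
        (integrable_norm_sq_of_memLp (memLp_unitBall hc (hpow (2 ^ n)).1 (hpow (2 ^ n)).2))
        (integrable_const (M ^ 2)) (by
          filter_upwards [ae_unitBall] with x hx
          have := hM (r ^ 2 ^ n • x) (by
            rw [mem_closedBall_zero_iff, norm_smul, hx, mul_one,
              Real.norm_of_nonneg (hpow _).1]
            exact (hpow _).2)
          gcongr)
      refine h1.trans (le_of_eq ?_)
      rw [integral_const, smul_eq_mul, mul_comm]
  approach y hy v := by
    have := isFiniteMeasure_unitBall
    have hu := (isCompact_closedBall (0 : Oct) 1).uniformContinuousOn_of_continuous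
      (continuousOn_ballSystem (mem_ball_zero_iff.1 hy) v)
    rw [ENNReal.tendsto_nhds_zero]
    intro ε hε
    obtain ⟨η, hη, hηε⟩ : ∃ η : ℝ, 0 < η ∧
        unitBall.surface univ ^ (2 : ℝ)⁻¹ * ENNReal.ofReal η ≤ ε := by
      have h1 : Tendsto (fun η : ℝ => unitBall.surface univ ^ (2 : ℝ)⁻¹ * ENNReal.ofReal η)
          (𝓝[>] 0) (𝓝 0) := by
        have h2 : Tendsto (fun η : ℝ => ENNReal.ofReal η) (𝓝[>] 0) (𝓝 (ENNReal.ofReal 0)) :=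
          (ENNReal.continuous_ofReal.tendsto 0).mono_left nhdsWithin_le_nhds
        have h3 := ENNReal.Tendsto.const_mul (a := unitBall.surface univ ^ (2 : ℝ)⁻¹) h2
          (Or.inr (by finiteness))
        simpa using h3
      obtain ⟨η, h2, h3⟩ := ((ENNReal.tendsto_nhds_zero.1 h1 ε hε).and self_mem_nhdsWithin).exists
      exact ⟨η, h3, h2⟩
    obtain ⟨δ, hδ, hclose⟩ := Metric.uniformContinuousOn_iff.1 hu η hη
    filter_upwards [Ioo_mem_nhdsGT (lt_min zero_lt_one hδ)] with s hs
    refine (eLpNorm_le_of_ae_bound (C := η) ?_).trans (by simpa using hηε)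
    filter_upwards [ae_unitBall] with x hx
    have hs1 : s < 1 := hs.2.trans_le (min_le_left _ _)
    have h1 : x - s • unitBall.normal x = (1 - s) • x := by rw [sub_smul, one_smul]; rfl
    rw [← dist_eq_norm]
    refine (hclose _ ?_ x (by simp [hx]) ?_).le
    · rw [h1, mem_closedBall_zero_iff, norm_smul, hx, Real.norm_of_nonneg (by linarith)]
      linarith [hs.1]
    · rw [dist_eq_norm, sub_sub_cancel_left, norm_neg, norm_smul]
      change ‖s‖ * ‖x‖ < δ
      rw [hx, Real.norm_of_nonneg hs.1.le, mul_one]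
      exact hs.2.trans_le (min_le_right _ _)

/-! ### Hyperplanes and slabs -/

lemma measurableEmbedding_slicePt (c : ℝ) : MeasurableEmbedding (slicePt c) :=
  (continuous_slicePt_right c).measurableEmbedding fun ξ η h => by
    ext i
    rw [← slicePt_succ c ξ i, h, slicePt_succ]

lemma integral_hyperplane (c : ℝ) (f : Oct → ℝ) :
    ∫ x, f x ∂hyperplaneMeasure c = ∫ ξ, f (slicePt c ξ) :=
  (measurableEmbedding_slicePt c).integral_map f

lemma lintegral_hyperplane (c : ℝ) (f : Oct → ℝ≥0∞) :
    ∫⁻ x, f x ∂hyperplaneMeasure c = ∫⁻ ξ, f (slicePt c ξ) :=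
  (measurableEmbedding_slicePt c).lintegral_map f

lemma ae_hyperplane (c : ℝ) : ∀ᵐ x ∂hyperplaneMeasure c, x 0 = c :=
  (measurableEmbedding_slicePt c).ae_map_iff.2 (Eventually.of_forall fun ξ => slicePt_zero c ξ)

lemma slicePt_add (c s : ℝ) (ξ : Fin 7 → ℝ) :
    slicePt c ξ + s • octE 0 = slicePt (c + s) ξ := by
  ext i
  refine Fin.cases ?_ (fun j => ?_) i
  · simp [octE]
  · simp [octE]

lemma measurePreserving_hyperplane_add (c s : ℝ) : MeasurePreserving (fun x => x + s • octE 0)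
    (hyperplaneMeasure c) (hyperplaneMeasure (c + s)) := by
  refine ⟨by fun_prop, ?_⟩
  have h : hyperplaneMeasure c = volume.map (slicePt c) := rfl
  rw [h, Measure.map_map (by fun_prop) (continuous_slicePt_right c).measurable]
  have : ((fun x => x + s • octE 0) ∘ slicePt c) = slicePt (c + s) := by
    ext1 ξ; exact slicePt_add c s ξ
  rw [this]
  rfl

lemma measurableEmbedding_add_octE (s : ℝ) : MeasurableEmbedding fun x : Oct => x + s • octE 0 :=
  (Homeomorph.addRight (s • octE 0)).measurableEmbedding

lemma measurePreserving_slicePt_prod :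
    MeasurePreserving (fun p : ℝ × (Fin 7 → ℝ) => slicePt p.1 p.2) volume volume := by
  have h1 := (volume_preserving_piFinSuccAbove (fun _ : Fin 8 => ℝ) 0).symm
  have h2 := (PiLp.volume_preserving_toLp (Fin 8)).comp h1
  have h3 : (fun p : ℝ × (Fin 7 → ℝ) => slicePt p.1 p.2) = WithLp.toLp 2 ∘
      (MeasurableEquiv.piFinSuccAbove (fun _ : Fin 8 => ℝ) 0).symm := by
    ext1 p
    rw [Function.comp_apply, slicePt]
    congr 1
    exact (Fin.insertNth_zero' p.1 p.2).symm
  rw [h3]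
  exact h2

lemma measurableEmbedding_slicePt_prod :
    MeasurableEmbedding (fun p : ℝ × (Fin 7 → ℝ) => slicePt p.1 p.2) :=
  continuous_slicePt.measurableEmbedding fun p q h => by
    ext i
    · exact congrArg (fun x : Oct => x 0) h
    · exact congrArg (fun x : Oct => x i.succ) h

/-- Only the inequality half of Tonelli's theorem is used, so no measurability of f is required. -/
lemma setLIntegral_closedSlab_le (a b : ℝ) (f : Oct → ℝ≥0∞) :
    ∫⁻ x in closedSlab a b, f x ≤ ∫⁻ s in Icc a b, ∫⁻ x, f x ∂hyperplaneMeasure s := by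
  rw [← measurePreserving_slicePt_prod.setLIntegral_comp_preimage_emb
    measurableEmbedding_slicePt_prod]
  have h : (fun p : ℝ × (Fin 7 → ℝ) => slicePt p.1 p.2) ⁻¹' closedSlab a b = Icc a b ×ˢ univ := by
    ext p; simp [closedSlab]
  rw [h, Measure.volume_eq_prod, ← Measure.prod_restrict, Measure.restrict_univ]
  simp only [lintegral_hyperplane]
  exact lintegral_prod_le _

lemma aestronglyMeasurable_of_continuousOn {μ : Measure Oct} {S : Set Oct} (hS : MeasurableSet S)
    {F : Oct → Oct} (hF : ContinuousOn F S) (h : ∀ᵐ x ∂μ, x ∈ S) : AEStronglyMeasurable F μ := by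
  rw [← Measure.restrict_eq_self_of_ae_mem h]
  exact hF.aestronglyMeasurable hS

lemma eLpNorm_two_sq {α : Type*} [MeasurableSpace α] {μ : Measure α} {E : Type*}
    [NormedAddCommGroup E] (f : α → E) : eLpNorm f 2 μ ^ 2 = ∫⁻ x, ‖f x‖ₑ ^ 2 ∂μ := by
  have := eLpNorm_nnreal_pow_eq_lintegral (f := f) (μ := μ) (p := 2) two_ne_zero
  simpa using this

/-! ### The comparison function `(1 + |x|)⁻⁴` -/

/-- A weight which is square integrable on hyperplanes. -/
noncomputable def decay (x : Oct) : ℝ := ((1 + ‖x‖) ^ 4)⁻¹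

lemma decay_pos (x : Oct) : 0 < decay x := by unfold decay; positivity

lemma continuous_decay : Continuous decay := by
  unfold decay
  exact Continuous.inv₀ (by fun_prop) fun x => by positivity

/-- The squared weight is (1 + |x|)⁻⁸, and 8 exceeds the dimension 7 of the hyperplanes; bounding
|x| below by the horizontal part makes the estimate uniform in c. -/
lemma exists_lintegral_decay_le :
    ∃ H : ℝ≥0, ∀ c, ∫⁻ x, ‖decay x‖ₑ ^ 2 ∂hyperplaneMeasure c ≤ H := by
  have h1 : ∫⁻ ξ : Fin 7 → ℝ, ENNReal.ofReal ((1 + ‖ξ‖) ^ (-8 : ℝ)) < ∞ :=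
    finite_integral_one_add_norm (by simp; norm_num)
  refine ⟨(∫⁻ ξ : Fin 7 → ℝ, ENNReal.ofReal ((1 + ‖ξ‖) ^ (-8 : ℝ))).toNNReal, fun c => ?_⟩
  rw [ENNReal.coe_toNNReal h1.ne, lintegral_hyperplane]
  refine lintegral_mono fun ξ => ?_
  have h2 : ‖ξ‖ ≤ ‖slicePt c ξ‖ := (pi_norm_le_iff_of_nonneg (norm_nonneg _)).2 fun i => by
    rw [← slicePt_succ c ξ i]
    exact PiLp.norm_apply_le _ _
  rw [← ofReal_norm, Real.norm_of_nonneg (decay_pos _).le, ← ENNReal.ofReal_pow (decay_pos _).le]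
  refine ENNReal.ofReal_le_ofReal ?_
  rw [Real.rpow_neg (by positivity), decay, inv_pow, ← pow_mul]
  norm_cast
  gcongr

lemma memLp_decay (c : ℝ) : MemLp decay 2 (hyperplaneMeasure c) := by
  obtain ⟨H, hH⟩ := exists_lintegral_decay_le
  refine ⟨continuous_decay.aestronglyMeasurable, ?_⟩
  have := (hH c).trans_lt ENNReal.coe_lt_top
  rw [← eLpNorm_two_sq] at this
  exact (ENNReal.pow_lt_top_iff.1 this).resolve_right two_ne_zero

lemma MemLp.of_le_decay {c A : ℝ} {f : Oct → Oct}
    (hf : AEStronglyMeasurable f (hyperplaneMeasure c))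
    (h : ∀ᵐ x ∂hyperplaneMeasure c, ‖f x‖ ≤ A * decay x) : MemLp f 2 (hyperplaneMeasure c) :=
  ((memLp_decay c).const_mul A).mono' hf h

/-- The product is at most the sum of the squares, whose integrals over the slices are uniformly
bounded, and the slab has finite width. -/
lemma integrableOn_closedSlab_mul_decay {a b : ℝ} {u : Oct → Oct}
    (huc : ContinuousOn u (closedSlab a b)) {C : ℝ≥0}
    (hC : ∀ s ∈ Icc a b, ∫⁻ x, ‖u x‖ₑ ^ 2 ∂hyperplaneMeasure s ≤ C) :
    IntegrableOn (fun x => ‖u x‖ * decay x) (closedSlab a b) := by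
  obtain ⟨H, hH⟩ := exists_lintegral_decay_le
  have hmeas := (isClosed_closedSlab a b).measurableSet
  refine ⟨((huc.norm).mul continuous_decay.continuousOn).aestronglyMeasurable hmeas, ?_⟩
  have h1 : ∀ x, ‖‖u x‖ * decay x‖ₑ ≤ ‖u x‖ₑ ^ 2 + ‖decay x‖ₑ ^ 2 := fun x => by
    have h2 : ‖‖u x‖ * decay x‖₊ ≤ ‖u x‖₊ ^ 2 + ‖decay x‖₊ ^ 2 := by
      rw [← NNReal.coe_le_coe]
      push_cast
      rw [norm_mul, norm_norm]
      nlinarith [sq_nonneg (‖u x‖ - ‖decay x‖), sq_nonneg ‖u x‖, sq_nonneg ‖decay x‖]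
    simp only [enorm_eq_nnnorm]
    exact_mod_cast h2
  calc ∫⁻ x in closedSlab a b, ‖‖u x‖ * decay x‖ₑ
      ≤ ∫⁻ x in closedSlab a b, (‖u x‖ₑ ^ 2 + ‖decay x‖ₑ ^ 2) := lintegral_mono h1
    _ ≤ ∫⁻ s in Icc a b, ∫⁻ x, (‖u x‖ₑ ^ 2 + ‖decay x‖ₑ ^ 2) ∂hyperplaneMeasure s :=
        setLIntegral_closedSlab_le _ _ _
    _ ≤ ∫⁻ s in Icc a b, ((C : ℝ≥0∞) + H) := by
        refine setLIntegral_mono measurable_const fun s hs => ?_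
        rw [lintegral_add_right _ (continuous_decay.measurable.enorm.pow_const 2)]
        exact add_le_add (hC s hs) (hH s)
    _ < ∞ := by
        rw [setLIntegral_const, Real.volume_Icc]
        finiteness

/-! ### Cutoff functions -/

/-- `θ` is a cutoff to `|x| ≤ R` with gradient `g`. -/
structure IsCutoff (M R : ℝ) (θ : Oct → ℝ) (g : Oct → Oct) : Prop where
  hasFDerivAt : ∀ x, HasFDerivAt θ (innerSL ℝ (g x)) x
  continuous_grad : Continuous g
  abs_le : ∀ x, |θ x| ≤ 1
  eq_one : ∀ x, ‖x‖ < R → θ x = 1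
  grad_eq_zero : ∀ x, ‖x‖ < R → g x = 0
  zero_far : ∀ x, 3 * R ≤ ‖x‖ → θ x = 0
  grad_far : ∀ x, 3 * R ≤ ‖x‖ → g x = 0
  norm_grad_le : ∀ x, ‖g x‖ ≤ M / R

/-- One fixed bump, equal to 1 on the unit ball and supported in radius 2, is dilated by R, so its
gradient scales like 1/R. The factor 3 in place of 2 puts the far region strictly outside the
support, where the gradient vanishes too. -/
lemma exists_isCutoff : ∃ M, ∀ R > 0, ∃ θ g, IsCutoff M R θ g := by
  let Θ : ContDiffBump (0 : Oct) := ⟨1, 2, one_pos, one_lt_two⟩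
  let G : Oct → Oct := fun x => (InnerProductSpace.toDual ℝ Oct).symm (fderiv ℝ Θ x)
  have hG : ∀ x, HasFDerivAt Θ (innerSL ℝ (G x)) x := fun x => by
    have h1 : innerSL ℝ (G x) = fderiv ℝ Θ x :=
      (InnerProductSpace.toDual ℝ Oct).apply_symm_apply _
    rw [h1]
    exact ((Θ.contDiff (n := 1)).differentiable one_ne_zero x).hasFDerivAt
  have hGc : Continuous G := (InnerProductSpace.toDual ℝ Oct).symm.continuous.comp
    ((Θ.contDiff (n := 1)).continuous_fderiv one_ne_zero)
  have hG1 : ∀ x, ‖x‖ < 1 → G x = 0 := fun x hx => by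
    have h1 : fderiv ℝ Θ x = 0 := by
      have h2 : (Θ : Oct → ℝ) =ᶠ[𝓝 x] fun _ => 1 := by
        filter_upwards [Metric.isOpen_ball.mem_nhds (mem_ball_zero_iff.2 hx)] with z hz
        exact Θ.one_of_mem_closedBall (Metric.ball_subset_closedBall hz)
      rw [h2.fderiv_eq]
      simp
    simp [G, h1]
  have hG2 : ∀ x, 2 < ‖x‖ → G x = 0 := fun x hx => by
    have h1 : fderiv ℝ Θ x = 0 := by
      have h2 : (Θ : Oct → ℝ) =ᶠ[𝓝 x] fun _ => 0 := by
        filter_upwards [(isOpen_lt continuous_const continuous_norm).mem_nhds hx] with z hz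
        refine Θ.zero_of_le_dist ?_
        rw [dist_zero_right]
        exact le_of_lt hz
      rw [h2.fderiv_eq]
      simp
    simp [G, h1]
  obtain ⟨M, hM⟩ := hGc.bounded_above_of_compact_support
    (HasCompactSupport.intro (isCompact_closedBall (0 : Oct) 2) fun x hx => hG2 x (by simpa using hx))
  refine ⟨M, fun R hR => ⟨fun x => Θ (R⁻¹ • x), fun x => R⁻¹ • G (R⁻¹ • x), ?_⟩⟩
  have hn : ∀ x : Oct, ‖R⁻¹ • x‖ = ‖x‖ / R := fun x => by
    rw [norm_smul, norm_inv, Real.norm_of_nonneg hR.le]; field_simp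
  have hfar : ∀ x : Oct, 3 * R ≤ ‖x‖ → 2 < ‖R⁻¹ • x‖ := fun x hx => by
    rw [hn, lt_div_iff₀ hR]; linarith
  refine ⟨fun x => ?_, by fun_prop, fun x => ?_, fun x hx => ?_, fun x hx => ?_, fun x hx => ?_,
    fun x hx => ?_, fun x => ?_⟩
  · refine ((hG (R⁻¹ • x)).comp x ((hasFDerivAt_id x).const_smul R⁻¹)).congr_fderiv ?_
    ext1 z
    simp
  · rw [abs_of_nonneg Θ.nonneg]
    exact Θ.le_one
  · refine Θ.one_of_mem_closedBall ?_
    change R⁻¹ • x ∈ Metric.closedBall (0 : Oct) 1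
    rw [mem_closedBall_zero_iff, hn, div_le_one hR]
    exact hx.le
  · rw [hG1 _ (by rw [hn, div_lt_one hR]; exact hx), smul_zero]
  · refine Θ.zero_of_le_dist ?_
    rw [dist_zero_right]
    exact (hfar x hx).le
  · rw [hG2 _ (hfar x hx), smul_zero]
  · rw [norm_smul, norm_inv, Real.norm_of_nonneg hR.le, div_eq_inv_mul]
    gcongr
    exact hM _

/-! ### Removing the cutoff -/

/-- The gradient term is at most (M/R) A ∫ |u| (1 + |x|)⁻⁴ over the slab and vanishes as R → ∞,
while the face terms converge by domination. The bound on W is needed only far out, so W may have a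
pole inside. -/
theorem slab_limit {a b M : ℝ} (hcut : ∀ R > 0, ∃ θ g, IsCutoff M R θ g) {u W : Oct → Oct}
    {c A R₀ : ℝ} (hA : 0 ≤ A) (huc : ContinuousOn u (closedSlab a b)) {C : ℝ≥0}
    (hC : ∀ s ∈ Icc a b, ∫⁻ x, ‖u x‖ₑ ^ 2 ∂hyperplaneMeasure s ≤ C)
    (hW : ∀ x ∈ closedSlab a b, R₀ ≤ ‖x‖ → ‖W x‖ ≤ A * decay x)
    (ha : Integrable (fun x => inner ℝ (u x) (W x)) (hyperplaneMeasure a))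
    (hb : Integrable (fun x => inner ℝ (u x) (W x)) (hyperplaneMeasure b))
    (key : ∀ R > R₀, ∀ θ g, IsCutoff M R θ g →
      (∫ x in closedSlab a b, inner ℝ (g x ⬝ₒ u x) (W x)) + c =
        (∫ x, θ x * inner ℝ (u x) (W x) ∂hyperplaneMeasure b) -
          ∫ x, θ x * inner ℝ (u x) (W x) ∂hyperplaneMeasure a) :
    c = (∫ x, inner ℝ (u x) (W x) ∂hyperplaneMeasure b) -
      ∫ x, inner ℝ (u x) (W x) ∂hyperplaneMeasure a := by
  set R : ℕ → ℝ := fun n => |R₀| + 1 + n with hR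
  have hR0 : ∀ n, 0 < R n := fun n => by positivity
  have hRR : ∀ n, R₀ < R n := fun n => by
    have := le_abs_self R₀
    have h2 : (0 : ℝ) ≤ n := by positivity
    simp only [hR]; linarith
  have hRt : Tendsto R atTop atTop :=
    tendsto_atTop_add_const_left _ _ tendsto_natCast_atTop_atTop
  choose θ g hθ using fun n => hcut (R n) (hR0 n)
  -- Nonnegativity is not part of `IsCutoff`; it is read off from the gradient bound at a single
  -- point.
  have hM : 0 ≤ M := by
    have h1 := (norm_nonneg _).trans ((hθ 0).norm_grad_le 0)
    by_contra h
    exact absurd h1 (div_neg_of_neg_of_pos (not_le.1 h) (hR0 0)).not_ge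
  have hface : ∀ {μ : Measure Oct}, Integrable (fun x => inner ℝ (u x) (W x)) μ →
      Tendsto (fun n => ∫ x, θ n x * inner ℝ (u x) (W x) ∂μ) atTop
        (𝓝 (∫ x, inner ℝ (u x) (W x) ∂μ)) := fun {μ} hi => by
    refine tendsto_integral_of_dominated_convergence (fun x => ‖inner ℝ (u x) (W x)‖) (fun n => ?_)
      hi.norm (fun n => Eventually.of_forall fun x => ?_) (Eventually.of_forall fun x => ?_)
    · have : Continuous (θ n) := continuous_iff_continuousAt.2 fun x =>
        ((hθ n).hasFDerivAt x).continuousAt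
      exact this.aestronglyMeasurable.mul hi.1
    · rw [norm_mul]
      exact mul_le_of_le_one_left (norm_nonneg _) ((hθ n).abs_le x)
    · refine tendsto_const_nhds.congr' ?_
      filter_upwards [hRt.eventually_gt_atTop ‖x‖] with n hn
      rw [(hθ n).eq_one x hn, one_mul]
  have hint := integrableOn_closedSlab_mul_decay huc hC
  have hbulk : Tendsto (fun n => ∫ x in closedSlab a b, inner ℝ (g n x ⬝ₒ u x) (W x)) atTop
      (𝓝 0) := by
    have h1 : ∀ n, ‖∫ x in closedSlab a b, inner ℝ (g n x ⬝ₒ u x) (W x)‖ ≤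
        M * A * (∫ x in closedSlab a b, ‖u x‖ * decay x) / R n := fun n => by
      have h2 : Integrable (fun x => M * A / R n * (‖u x‖ * decay x))
          (volume.restrict (closedSlab a b)) := hint.const_mul _
      refine (norm_integral_le_of_norm_le h2 ?_).trans (le_of_eq ?_)
      · filter_upwards [ae_restrict_mem (isClosed_closedSlab a b).measurableSet] with x hx
        by_cases hxR : ‖x‖ < R n
        · rw [(hθ n).grad_eq_zero x hxR, zero_omul, inner_zero_left, norm_zero]
          have := hR0 n
          have := (decay_pos x).le
          positivity
        · have h3 := hW x hx ((hRR n).le.trans (not_lt.1 hxR))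
          refine (norm_inner_le_norm _ _).trans ?_
          rw [norm_omul]
          calc ‖g n x‖ * ‖u x‖ * ‖W x‖ ≤ M / R n * ‖u x‖ * (A * decay x) := by
                gcongr
                exact (hθ n).norm_grad_le x
            _ = _ := by ring
      · rw [integral_const_mul]; ring
    refine squeeze_zero_norm h1 ?_
    exact tendsto_const_nhds.div_atTop hRt
  have h2 := (hface hb).sub (hface ha)
  have h3 := hbulk.add_const c
  rw [zero_add] at h3
  exact tendsto_nhds_unique (h3.congr fun n => key (R n) (hRR n) (θ n) (g n) (hθ n)) h2

/-! ### Cauchy's theorem and formula on slabs -/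

/-- The seventh power is split as 3 + 4: four powers are spent on the square-integrable weight and
three remain as δ⁻³. The latter give decay on distant hyperplanes and summability over the images in
the strip. -/
lemma inv_norm_pow_le_decay {δ κ : ℝ} (hδ : 0 < δ) {x z : Oct} (hz : δ ≤ ‖z‖)
    (hκ : 1 + ‖x‖ ≤ κ * ‖z‖) : (‖z‖ ^ 7)⁻¹ ≤ (δ ^ 3)⁻¹ * κ ^ 4 * decay x := by
  have hz0 : 0 < ‖z‖ := hδ.trans_le hz
  have h1 : (1 + ‖x‖) ^ 4 ≤ κ ^ 4 * ‖z‖ ^ 4 := by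
    rw [← mul_pow]
    gcongr
  have h2 : (‖z‖ ^ 4)⁻¹ ≤ κ ^ 4 * decay x := by
    rw [decay, ← div_eq_mul_inv, le_div_iff₀ (by positivity), inv_mul_le_iff₀ (by positivity)]
    linarith
  calc (‖z‖ ^ 7)⁻¹ = (‖z‖ ^ 3)⁻¹ * (‖z‖ ^ 4)⁻¹ := by rw [← mul_inv, ← pow_add]
    _ ≤ (δ ^ 3)⁻¹ * (κ ^ 4 * decay x) := by gcongr
    _ = _ := by ring

lemma one_add_norm_le {δ : ℝ} (hδ : 0 < δ) {x p : Oct} (h : δ ≤ ‖x - p‖) :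
    1 + ‖x‖ ≤ ((1 + ‖p‖) / δ + 1) * ‖x - p‖ := by
  have h1 : ‖x‖ ≤ ‖x - p‖ + ‖p‖ := by simpa using norm_add_le (x - p) p
  have h2 : 1 + ‖p‖ ≤ (1 + ‖p‖) / δ * ‖x - p‖ := by
    rw [div_mul_eq_mul_div, le_div_iff₀ hδ]
    gcongr
  linarith

lemma abs_apply_zero_sub_le (x y : Oct) : |x 0 - y 0| ≤ ‖x - y‖ := by
  simpa using PiLp.norm_apply_le (x - y) 0

lemma norm_dualKernel_le_decay {δ : ℝ} (hδ : 0 < δ) {x p : Oct} (h : δ ≤ ‖x - p‖) (ε : ℝ) (v : Oct) :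
    ‖dualKernel ε v (x - p)‖ ≤ (δ ^ 3)⁻¹ * ((1 + ‖p‖) / δ + 1) ^ 4 * ‖v‖ * decay x := by
  refine (norm_dualKernel_le _ _ _).trans ?_
  have := inv_norm_pow_le_decay hδ h (one_add_norm_le hδ h)
  calc (‖x - p‖ ^ 7)⁻¹ * ‖v‖ ≤ (δ ^ 3)⁻¹ * ((1 + ‖p‖) / δ + 1) ^ 4 * decay x * ‖v‖ := by gcongr
    _ = _ := by ring

lemma hasFDerivAt_dualKernel_sub {ε : ℝ} {x p : Oct} (h : ε ^ 2 + ‖x - p‖ ^ 2 ≠ 0) (v : Oct) :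
    HasFDerivAt (fun x => dualKernel ε v (x - p)) (fderiv ℝ (dualKernel ε v) (x - p)) x := by
  have := (hasFDerivAt_dualKernel h v).differentiableAt.hasFDerivAt
  exact (this.comp x ((hasFDerivAt_id x).sub_const p)).congr_fderiv (ContinuousLinearMap.comp_id _)

lemma ae_mem_closedSlab {a b c : ℝ} (hc : c ∈ Icc a b) :
    ∀ᵐ x ∂hyperplaneMeasure c, x ∈ closedSlab a b := by
  filter_upwards [ae_hyperplane c] with x hx
  exact ⟨hx ▸ hc.1, hx ▸ hc.2⟩

lemma memLp_hyperplane {a b c : ℝ} (hc : c ∈ Icc a b) {u : Oct → Oct}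
    (huc : ContinuousOn u (closedSlab a b)) {C : ℝ≥0}
    (hC : ∀ s ∈ Icc a b, ∫⁻ x, ‖u x‖ₑ ^ 2 ∂hyperplaneMeasure s ≤ C) :
    MemLp u 2 (hyperplaneMeasure c) := by
  refine ⟨aestronglyMeasurable_of_continuousOn (isClosed_closedSlab a b).measurableSet huc
    (ae_mem_closedSlab hc), ?_⟩
  have := (hC c hc).trans_lt ENNReal.coe_lt_top
  rw [← eLpNorm_two_sq] at this
  exact (ENNReal.pow_lt_top_iff.1 this).resolve_right two_ne_zero

lemma integrableOn_closedSlab_of_eq_zero {E : Type*} [NormedAddCommGroup E] {a b R : ℝ} {f : Oct → E}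
    (hf : ContinuousOn f (closedSlab a b)) (h0 : ∀ x, R ≤ ‖x‖ → f x = 0) :
    IntegrableOn f (closedSlab a b) := by
  have hK : IsCompact (closedSlab a b ∩ Metric.closedBall 0 R) :=
    (isCompact_closedBall 0 R).inter_left (isClosed_closedSlab a b)
  refine ((hf.mono inter_subset_left).integrableOn_compact hK).of_forall_sdiff_eq_zero
    (isClosed_closedSlab a b).measurableSet fun x hx => h0 x ?_
  by_contra hcon
  exact hx.2 ⟨hx.1, mem_closedBall_zero_iff.2 (not_le.1 hcon).le⟩

/-- Cauchy's theorem: the pairing of a left monogenic function with a solution of the dual equation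
is the same on both faces of a slab. -/
theorem slab_orthogonal {a b A : ℝ} (hab : a ≤ b) (hA : 0 ≤ A) {u W : Oct → Oct}
    (huc : ContinuousOn u (closedSlab a b)) (hu : LeftMonogenicOn u (openSlab a b)) {C : ℝ≥0}
    (hC : ∀ s ∈ Icc a b, ∫⁻ x, ‖u x‖ₑ ^ 2 ∂hyperplaneMeasure s ≤ C)
    (hWc : ContinuousOn W (closedSlab a b))
    (hW : ∀ x ∈ openSlab a b, ∃ B, HasFDerivAt W B x ∧ crBarSymbol B = 0)
    (hWd : ∀ x ∈ closedSlab a b, ‖W x‖ ≤ A * decay x) :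
    ∫ x, inner ℝ (u x) (W x) ∂hyperplaneMeasure b =
      ∫ x, inner ℝ (u x) (W x) ∂hyperplaneMeasure a := by
  obtain ⟨M, hM⟩ := exists_isCutoff
  have hface : ∀ c ∈ Icc a b, Integrable (fun x => inner ℝ (u x) (W x)) (hyperplaneMeasure c) :=
    fun c hc => integrable_inner_of_memLp (memLp_hyperplane hc huc hC)
      (MemLp.of_le_decay (aestronglyMeasurable_of_continuousOn
        (isClosed_closedSlab a b).measurableSet hWc (ae_mem_closedSlab hc))
        ((ae_mem_closedSlab hc).mono hWd))
  have := slab_limit hM (c := 0) (R₀ := 0) hA huc hC (fun x hx _ => hWd x hx)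
    (hface a ⟨le_rfl, hab⟩) (hface b ⟨hab, le_rfl⟩) fun R hR θ g hθ => by
      have h1 := slab_stokes hab (R := 3 * R) (by positivity) huc hu hWc hW continuousOn_const
        hθ.hasFDerivAt hθ.continuous_grad hθ.zero_far hθ.grad_far
      simp only [inner_zero_right, mul_zero, add_zero] at h1
      rw [add_zero, h1, integral_hyperplane, integral_hyperplane]
  linarith

/-- Cauchy's formula on a slab. -/
theorem slab_cauchy {a b : ℝ} {u : Oct → Oct} (huc : ContinuousOn u (closedSlab a b))
    (hu : LeftMonogenicOn u (openSlab a b)) {C : ℝ≥0}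
    (hC : ∀ s ∈ Icc a b, ∫⁻ x, ‖u x‖ₑ ^ 2 ∂hyperplaneMeasure s ≤ C) {y : Oct}
    (hy : y ∈ openSlab a b) (v : Oct) :
    (∫ x, inner ℝ (u x) (dualKernel 0 v (x - y)) ∂hyperplaneMeasure b) -
      ∫ x, inner ℝ (u x) (dualKernel 0 v (x - y)) ∂hyperplaneMeasure a =
        Real.pi ^ 4 / 3 * inner ℝ (u y) v := by
  obtain ⟨M, hM⟩ := exists_isCutoff
  have hab : a ≤ b := (hy.1.trans hy.2).le
  have haI : a ∈ Icc a b := ⟨le_rfl, hab⟩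
  have hbI : b ∈ Icc a b := ⟨hab, le_rfl⟩
  have hcl := (isClosed_closedSlab a b).measurableSet
  -- ρ keeps the faces away from the pole; ρ ≤ 1 places the ρ-ball about `y` where the cutoff equals
  -- 1, since R > ‖y‖ + 1.
  obtain ⟨ρ, hρ, hρ1, hρa, hρb⟩ : ∃ ρ : ℝ, 0 < ρ ∧ ρ ≤ 1 ∧ ρ ≤ y 0 - a ∧ ρ ≤ b - y 0 :=
    ⟨min 1 (min (y 0 - a) (b - y 0)), lt_min one_pos (lt_min (sub_pos.2 hy.1) (sub_pos.2 hy.2)),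
      min_le_left _ _, (min_le_right _ _).trans (min_le_left _ _),
      (min_le_right _ _).trans (min_le_right _ _)⟩
  have hρface : ∀ c, c = a ∨ c = b → ∀ᵐ x ∂hyperplaneMeasure c, ρ ≤ ‖x - y‖ := fun c hc => by
    filter_upwards [ae_hyperplane c] with x hx
    refine le_trans ?_ (abs_apply_zero_sub_le x y)
    rw [hx]
    rcases hc with rfl | rfl
    · rw [abs_sub_comm]; exact hρa.trans (le_abs_self _)
    · exact hρb.trans (le_abs_self _)
  have hsing : ∀ c, AEStronglyMeasurable (fun x => dualKernel 0 v (x - y)) (hyperplaneMeasure c) :=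
    fun c => by
      refine Measurable.aestronglyMeasurable ?_
      have hm : Measurable fun x : Oct => (((0 : ℝ) ^ 2 + ‖x - y‖ ^ 2) ^ 4)⁻¹ :=
        Measurable.inv (Continuous.measurable (by fun_prop))
      exact hm.smul
        (Continuous.measurable ((continuous_id.sub continuous_const).omul continuous_const))
  have hface : ∀ c, c = a ∨ c = b →
      Integrable (fun x => inner ℝ (u x) (dualKernel 0 v (x - y))) (hyperplaneMeasure c) :=
    fun c hc => integrable_inner_of_memLp
      (memLp_hyperplane (by rcases hc with rfl | rfl; exacts [haI, hbI]) huc hC)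
      (MemLp.of_le_decay (hsing c) ((hρface c hc).mono fun x hx =>
        norm_dualKernel_le_decay hρ hx 0 v))
  refine (slab_limit hM (R₀ := ‖y‖ + 1)
    (A := (ρ ^ 3)⁻¹ * ((1 + ‖y‖) / ρ + 1) ^ 4 * ‖v‖) (by positivity) huc hC
    (fun x _ hx => norm_dualKernel_le_decay hρ ?_ 0 v) (hface a (Or.inl rfl))
    (hface b (Or.inr rfl)) fun R hR θ g hθ => ?_).symm
  · have := norm_sub_norm_le x y
    linarith
  have hR0 : 0 < R := by have := norm_nonneg y; linarith
  have hnear : ∀ x, ‖x - y‖ < ρ → ‖x‖ < R := fun x hx => by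
    have : ‖x‖ ≤ ‖x - y‖ + ‖y‖ := by simpa using norm_add_le (x - y) y
    linarith
  have hθc : Continuous θ := continuous_iff_continuousAt.2 fun x =>
    (hθ.hasFDerivAt x).continuousAt
  have hgu : IntegrableOn (fun x => g x ⬝ₒ u x) (closedSlab a b) :=
    integrableOn_closedSlab_of_eq_zero (R := 3 * R) (hθ.continuous_grad.continuousOn.omul huc)
      fun x hx => by rw [hθ.grad_far x hx, zero_omul]
  -- On the ball of radius 3R, outside which θ vanishes, the weight is at least (1 + 3R)⁻⁴; hence θu
  -- is dominated by a multiple of |u| times the weight, a product of two L² functions.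
  have hθu : ∀ c ∈ Icc a b, Integrable (fun x => θ x • u x) (hyperplaneMeasure c) := fun c hc => by
    have h1 := MemLp.integrable_mul (memLp_hyperplane hc huc hC).norm (memLp_decay c)
    refine (h1.const_mul ((1 + 3 * R) ^ 4)).mono'
      (hθc.aestronglyMeasurable.smul (memLp_hyperplane hc huc hC).1)
      (Eventually.of_forall fun x => ?_)
    have hd := decay_pos x
    by_cases hx : 3 * R ≤ ‖x‖
    · rw [hθ.zero_far x hx, zero_smul, norm_zero]
      simp only [Pi.mul_apply]
      positivity
    · have h2 : 1 ≤ (1 + 3 * R) ^ 4 * decay x := by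
        rw [decay, ← div_eq_mul_inv, one_le_div (by positivity)]
        gcongr
        linarith
      rw [norm_smul, Pi.mul_apply]
      have h3 : ‖θ x‖ ≤ 1 := hθ.abs_le x
      have h4 := norm_nonneg (u x)
      calc ‖θ x‖ * ‖u x‖ ≤ 1 * ‖u x‖ := by gcongr
        _ ≤ (1 + 3 * R) ^ 4 * decay x * ‖u x‖ := by gcongr
        _ = _ := by ring
  have hfc : ContinuousOn (fun x => θ x * inner ℝ (u x) v) (closedSlab a b) :=
    hθc.continuousOn.mul (huc.inner continuousOn_const)
  obtain ⟨B, hB⟩ : ∃ B : ℝ, ∀ x, |(closedSlab a b).indicator (fun x => θ x * inner ℝ (u x) v) x| ≤ B := by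
    have hK : IsCompact (closedSlab a b ∩ Metric.closedBall 0 (3 * R)) :=
      (isCompact_closedBall 0 _).inter_left (isClosed_closedSlab a b)
    obtain ⟨B, hB⟩ := hK.exists_bound_of_continuousOn (hfc.mono inter_subset_left)
    refine ⟨max B 0, fun x => ?_⟩
    by_cases hx : x ∈ closedSlab a b
    · rw [indicator_of_mem hx]
      by_cases hx2 : ‖x‖ ≤ 3 * R
      · exact (hB x ⟨hx, mem_closedBall_zero_iff.2 hx2⟩).trans (le_max_left _ _)
      · rw [hθ.zero_far x (not_le.1 hx2).le]; simp
    · rw [indicator_of_notMem hx]; simp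
  have hlim1 := tendsto_integral_dualKernel (y := y) hρ hgu
    (Eventually.of_forall fun x hx => by rw [hθ.grad_eq_zero x (hnear x hx), zero_omul]) v
  -- The slab integral is written over the whole space with an indicator. This is continuous at `y`
  -- because `y` is an interior point of the slab.
  have hlim2 := tendsto_integral_approxIdentity (y := y)
    (f := (closedSlab a b).indicator fun x => θ x * inner ℝ (u x) v)
    ((aestronglyMeasurable_indicator_iff hcl).2 (hfc.aestronglyMeasurable hcl)) hB (by
      have h1 : closedSlab a b ∈ 𝓝 y := mem_of_superset
        ((isOpen_openSlab a b).mem_nhds hy) (openSlab_subset_closedSlab a b)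
      refine (hfc.continuousAt h1).congr ?_
      filter_upwards [h1] with x hx
      rw [indicator_of_mem hx])
  have hlim3 : ∀ c, c = a ∨ c = b → _ := fun c hc => tendsto_integral_dualKernel (y := y) hρ
    (hθu c (by rcases hc with rfl | rfl; exacts [haI, hbI]))
    ((hρface c hc).mono fun x hx h => absurd h hx.not_gt) v
  have key : ∀ ε : ℝ, 0 < ε → (∫ x in closedSlab a b, inner ℝ (g x ⬝ₒ u x) (dualKernel ε v (x - y))) +
      ∫ x, (8 * ε ^ 2 * ((ε ^ 2 + ‖x - y‖ ^ 2) ^ 5)⁻¹) *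
        (closedSlab a b).indicator (fun x => θ x * inner ℝ (u x) v) x =
      (∫ x, inner ℝ (θ x • u x) (dualKernel ε v (x - y)) ∂hyperplaneMeasure b) -
        ∫ x, inner ℝ (θ x • u x) (dualKernel ε v (x - y)) ∂hyperplaneMeasure a := fun ε hε => by
    have hne : ∀ x : Oct, ε ^ 2 + ‖x - y‖ ^ 2 ≠ 0 := fun x => by positivity
    have hd : ∀ x, HasFDerivAt (fun x => dualKernel ε v (x - y))
        (fderiv ℝ (dualKernel ε v) (x - y)) x := fun x => hasFDerivAt_dualKernel_sub (hne x) v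
    have hWc : Continuous fun x => dualKernel ε v (x - y) :=
      continuous_iff_continuousAt.2 fun x => (hd x).continuousAt
    have hρc : Continuous fun x : Oct => 8 * ε ^ 2 * ((ε ^ 2 + ‖x - y‖ ^ 2) ^ 5)⁻¹ :=
      continuous_const.mul (Continuous.inv₀ (by fun_prop) fun x => pow_ne_zero _ (hne x))
    have h1 := slab_stokes hab (R := 3 * R) (by positivity) huc hu hWc.continuousOn
      (ω := fun x => (8 * ε ^ 2 * ((ε ^ 2 + ‖x - y‖ ^ 2) ^ 5)⁻¹) • v)
      (fun x _ => ⟨_, hd x, crBarSymbol_fderiv_dualKernel (hne x) v⟩)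
      (hρc.smul continuous_const).continuousOn
      hθ.hasFDerivAt hθ.continuous_grad hθ.zero_far hθ.grad_far
    rw [integral_add] at h1
    · simp only [real_inner_smul_left, integral_hyperplane]
      rw [← h1]
      congr 1
      rw [← integral_indicator hcl]
      refine integral_congr_ae (Eventually.of_forall fun x => ?_)
      simp only [indicator]
      split_ifs
      · rw [inner_smul_right]; ring
      · simp
    · exact integrableOn_closedSlab_of_eq_zero (R := 3 * R)
        ((hθ.continuous_grad.continuousOn.omul huc).inner hWc.continuousOn)
        fun x hx => by rw [hθ.grad_far x hx, zero_omul, inner_zero_left]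
    · exact integrableOn_closedSlab_of_eq_zero (R := 3 * R)
        (hθc.continuousOn.mul (huc.inner (hρc.smul continuous_const).continuousOn))
        fun x hx => by rw [hθ.zero_far x hx, zero_mul]
  have hfin := tendsto_nhds_unique ((hlim1.add hlim2).congr' (by
    filter_upwards [self_mem_nhdsWithin] with ε hε using key ε hε))
    ((hlim3 b (Or.inr rfl)).sub (hlim3 a (Or.inl rfl)))
  rw [indicator_of_mem (openSlab_subset_closedSlab a b hy),
    hθ.eq_one y (hnear y (by simpa using hρ)), one_mul] at hfin
  simp only [real_inner_smul_left] at hfin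
  exact hfin

/-! ### Estimates with the comparison function -/

lemma eLpNorm_le_of_le_decay {c A : ℝ} {f : Oct → Oct}
    (h : ∀ᵐ x ∂hyperplaneMeasure c, ‖f x‖ ≤ A * decay x) :
    eLpNorm f 2 (hyperplaneMeasure c) ≤
      ENNReal.ofReal A * eLpNorm decay 2 (hyperplaneMeasure c) :=
  eLpNorm_le_mul_eLpNorm_of_ae_le_mul (h.mono fun x hx => by
    rwa [Real.norm_of_nonneg (decay_pos x).le]) 2

lemma exists_lintegral_le_of_le_decay (A : ℝ) : ∃ C : ℝ≥0, ∀ (c : ℝ) (f : Oct → Oct),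
    (∀ᵐ x ∂hyperplaneMeasure c, ‖f x‖ ≤ A * decay x) →
      ∫⁻ x, ‖f x‖ₑ ^ 2 ∂hyperplaneMeasure c ≤ C := by
  obtain ⟨H, hH⟩ := exists_lintegral_decay_le
  refine ⟨Real.toNNReal A ^ 2 * H, fun c f h => ?_⟩
  rw [← eLpNorm_two_sq]
  calc eLpNorm f 2 (hyperplaneMeasure c) ^ 2
      ≤ (ENNReal.ofReal A * eLpNorm decay 2 (hyperplaneMeasure c)) ^ 2 := by
        gcongr
        exact eLpNorm_le_of_le_decay h
    _ ≤ ENNReal.ofReal A ^ 2 * H := by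
        rw [mul_pow, eLpNorm_two_sq decay]
        gcongr
        exact hH c
    _ = _ := by push_cast; rfl

lemma tendsto_lintegral_of_le_decay {c A : ℝ} {f : ℝ → Oct → Oct}
    (hm : ∀ᶠ s in 𝓝[>] (0 : ℝ), AEStronglyMeasurable (f s) (hyperplaneMeasure c))
    (hb : ∀ᶠ s in 𝓝[>] (0 : ℝ), ∀ᵐ x ∂hyperplaneMeasure c, ‖f s x‖ ≤ A * decay x)
    (hl : ∀ᵐ x ∂hyperplaneMeasure c, Tendsto (fun s => f s x) (𝓝[>] 0) (𝓝 0)) :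
    Tendsto (fun s => ∫⁻ x, ‖f s x‖ₑ ^ 2 ∂hyperplaneMeasure c) (𝓝[>] 0) (𝓝 0) := by
  have h1 : Tendsto (fun s => ∫⁻ x, ‖f s x‖ₑ ^ 2 ∂hyperplaneMeasure c) (𝓝[>] 0)
      (𝓝 (∫⁻ _, 0 ∂hyperplaneMeasure c)) := by
    refine tendsto_lintegral_filter_of_dominated_convergence' (fun x => ‖A * decay x‖ₑ ^ 2)
      (hm.mono fun s hs => hs.enorm.pow_const 2) ?_ ?_ ?_
    · filter_upwards [hb] with s hs
      filter_upwards [hs] with x hx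
      have : ‖f s x‖ₑ ≤ ‖A * decay x‖ₑ := by
        rw [← ofReal_norm, ← ofReal_norm]
        exact ENNReal.ofReal_le_ofReal (hx.trans (le_abs_self _))
      gcongr
    · rw [← eLpNorm_two_sq]
      exact ENNReal.pow_ne_top ((memLp_decay c).const_mul A).2.ne
    · filter_upwards [hl] with x hx
      have h2 := ((ENNReal.continuous_pow 2).tendsto _).comp hx.enorm
      simpa [Function.comp_def] using h2
  simpa using h1

lemma tendsto_eLpNorm_of_tendsto_lintegral {α : Type*} [MeasurableSpace α] {μ : Measure α}
    {f : ℝ → α → Oct} (h : Tendsto (fun s => ∫⁻ x, ‖f s x‖ₑ ^ 2 ∂μ) (𝓝[>] 0) (𝓝 0)) :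
    Tendsto (fun s => eLpNorm (f s) 2 μ) (𝓝[>] 0) (𝓝 0) := by
  have h1 := (ENNReal.continuous_rpow_const (y := (2 : ℝ)⁻¹)).tendsto 0 |>.comp h
  rw [ENNReal.zero_rpow_of_pos (by norm_num)] at h1
  refine h1.congr fun s => ?_
  rw [Function.comp_apply, ← eLpNorm_two_sq, ← ENNReal.rpow_natCast, ← ENNReal.rpow_mul]
  norm_num

/-- The bound is linear in A with a constant independent of the hyperplane, so a pairing on a far
hyperplane vanishes in the limit as soon as its decay constant does. -/
lemma exists_enorm_integral_inner_le (C : ℝ≥0) : ∃ B : ℝ≥0, ∀ (c A : ℝ) (u W : Oct → Oct), 0 ≤ A →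
    AEStronglyMeasurable u (hyperplaneMeasure c) →
    ∫⁻ x, ‖u x‖ₑ ^ 2 ∂hyperplaneMeasure c ≤ C →
    (∀ᵐ x ∂hyperplaneMeasure c, ‖W x‖ ≤ A * decay x) →
    ‖∫ x, inner ℝ (u x) (W x) ∂hyperplaneMeasure c‖ ≤ A * B := by
  obtain ⟨H, hH⟩ := exists_lintegral_decay_le
  refine ⟨C + H, fun c A u W hA hu hC hW => ?_⟩
  lift A to ℝ≥0 using hA
  have h1 : ‖∫ x, inner ℝ (u x) (W x) ∂hyperplaneMeasure c‖ₑ ≤ (A * (C + H) : ℝ≥0) := by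
    refine (enorm_integral_le_lintegral_enorm _).trans ?_
    calc ∫⁻ x, ‖(inner ℝ (u x) (W x) : ℝ)‖ₑ ∂hyperplaneMeasure c
        ≤ ∫⁻ x, A * (‖u x‖ₑ ^ 2 + ‖decay x‖ₑ ^ 2) ∂hyperplaneMeasure c := by
          refine lintegral_mono_ae ?_
          filter_upwards [hW] with x hx
          have h2 : ‖(inner ℝ (u x) (W x) : ℝ)‖₊ ≤ A * (‖u x‖₊ ^ 2 + ‖decay x‖₊ ^ 2) := by
            rw [← NNReal.coe_le_coe]
            push_cast
            have hd := decay_pos x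
            rw [Real.norm_of_nonneg hd.le]
            calc ‖(inner ℝ (u x) (W x) : ℝ)‖ ≤ ‖u x‖ * ‖W x‖ := norm_inner_le_norm _ _
              _ ≤ ‖u x‖ * (A * decay x) := by gcongr
              _ = A * (‖u x‖ * decay x) := by ring
              _ ≤ _ := by
                gcongr
                nlinarith [sq_nonneg (‖u x‖ - decay x), sq_nonneg ‖u x‖, sq_nonneg (decay x)]
          simp only [enorm_eq_nnnorm]
          exact_mod_cast h2
      _ ≤ A * (C + H) := by
          rw [lintegral_const_mul' _ _ ENNReal.coe_ne_top, lintegral_add_left' (hu.enorm.pow_const 2)]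
          gcongr
          exact hH c
      _ = _ := by push_cast; rfl
  rw [enorm_eq_nnnorm, ENNReal.coe_le_coe, ← NNReal.coe_le_coe] at h1
  simpa using h1

lemma integral_norm_sq_le {α : Type*} [MeasurableSpace α] {μ : Measure α} {f : α → Oct} {C : ℝ≥0}
    (hf : AEStronglyMeasurable f μ) (h : ∫⁻ x, ‖f x‖ₑ ^ 2 ∂μ ≤ C) : ∫ x, ‖f x‖ ^ 2 ∂μ ≤ C := by
  have hm : AEStronglyMeasurable (fun x => ‖f x‖ ^ 2) μ := hf.norm.pow 2
  rw [integral_eq_lintegral_of_nonneg_ae (Eventually.of_forall fun x => by positivity) hm]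
  refine ENNReal.toReal_le_of_le_ofReal C.coe_nonneg ?_
  rw [ENNReal.ofReal_coe_nnreal]
  refine le_trans (le_of_eq (lintegral_congr fun x => ?_)) h
  rw [ENNReal.ofReal_pow (norm_nonneg _), ofReal_norm]

/-! ### The half-space -/

/-- The real-part coordinate is continuous and open, so preimages commute with closure and frontier.
-/
lemma preimage_apply_zero {s : Set ℝ} : (fun x : Oct => x 0) ⁻¹' closure s =
    closure ((fun x : Oct => x 0) ⁻¹' s) ∧
    (fun x : Oct => x 0) ⁻¹' frontier s = frontier ((fun x : Oct => x 0) ⁻¹' s) := by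
  have hopen : IsOpenMap fun x : Oct => x 0 :=
    (EuclideanSpace.proj (𝕜 := ℝ) (ι := Fin 8) (0 : Fin 8)).isOpenMap fun t =>
      ⟨t • octE 0, by simp [octE]⟩
  exact ⟨hopen.preimage_closure_eq_closure_preimage (by fun_prop) _,
    hopen.preimage_frontier_eq_frontier_preimage (by fun_prop) _⟩

lemma closure_carrier_halfSpace : closure halfSpace.carrier = {x | 0 ≤ x 0} := by
  have := (preimage_apply_zero (s := Ioi 0)).1
  rw [closure_Ioi] at this
  exact this.symm

lemma frontier_carrier_halfSpace : frontier halfSpace.carrier = {x | x 0 = 0} := by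
  have := (preimage_apply_zero (s := Ioi 0)).2
  rw [frontier_Ioi] at this
  exact this.symm

@[simp] lemma octE_zero_apply_zero : octE 0 0 = 1 := by simp [octE]

lemma sub_smul_normal_halfSpace (s : ℝ) (x : Oct) :
    x - s • halfSpace.normal x = x + s • octE 0 := by
  simp [halfSpace]

lemma isRegularDomain_halfSpace : IsRegularDomain halfSpace where
  isOpen := isOpen_lt continuous_const (continuous_oct_apply 0)
  normal_aemeasurable := aemeasurable_const
  normal_norm := Eventually.of_forall fun x => by simp [halfSpace]
  mem_frontier := by
    rw [frontier_carrier_halfSpace]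
    exact ae_hyperplane 0
  parallel := by
    filter_upwards [self_mem_nhdsWithin] with s hs x hx
    rw [frontier_carrier_halfSpace] at hx
    rw [sub_smul_normal_halfSpace]
    have h1 : x 0 = 0 := hx
    simpa [halfSpace, h1] using hs

lemma shift_halfSpace {s : ℝ} (hs : 0 ≤ s) {x : Oct} (hx : 0 ≤ x 0) : 0 ≤ (x + s • octE 0) 0 := by
  simp; linarith

/-- Parallel surfaces are the hyperplanes x₀ = s. The Hardy bound covers s > 0 only; square
integrability on the boundary supplies s = 0. -/
lemma isHardyCore_halfSpace_iff {u : Oct → Oct} : IsHardyCore halfSpace u ↔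
    LeftMonogenicOn u {x | 0 < x 0} ∧ ContinuousOn u {x | 0 ≤ x 0} ∧
      ∃ C : ℝ≥0, ∀ s, 0 ≤ s → ∫⁻ x, ‖u x‖ₑ ^ 2 ∂hyperplaneMeasure s ≤ C := by
  have hshift : ∀ s, ∫⁻ x, ‖u (x + s • octE 0)‖ₑ ^ 2 ∂hyperplaneMeasure 0 =
      ∫⁻ x, ‖u x‖ₑ ^ 2 ∂hyperplaneMeasure s := fun s => by
    have := (measurePreserving_hyperplane_add 0 s).lintegral_comp_emb
      (measurableEmbedding_add_octE s) (fun x => ‖u x‖ₑ ^ 2)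
    rwa [zero_add] at this
  constructor
  · intro hu
    refine ⟨hu.monogenic, closure_carrier_halfSpace ▸ hu.continuousOn, ?_⟩
    obtain ⟨C, hC⟩ := hu.bounded
    have h0 : ∫⁻ x, ‖u x‖ₑ ^ 2 ∂hyperplaneMeasure 0 ≠ ∞ := by
      rw [← eLpNorm_two_sq]
      exact ENNReal.pow_ne_top hu.memLp.2.ne
    refine ⟨C + (∫⁻ x, ‖u x‖ₑ ^ 2 ∂hyperplaneMeasure 0).toNNReal, fun s hs => ?_⟩
    rw [ENNReal.coe_add, ENNReal.coe_toNNReal h0]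
    rcases hs.eq_or_lt with rfl | hs
    · exact le_add_self
    · refine le_trans ?_ le_self_add
      rw [← hshift]
      have := hC s hs fun x hx => by
        rw [frontier_carrier_halfSpace] at hx
        rw [sub_smul_normal_halfSpace]
        have h1 : x 0 = 0 := hx
        simpa [halfSpace, h1] using hs
      simp only [sub_smul_normal_halfSpace] at this
      exact this
  · rintro ⟨h1, h2, C, hC⟩
    refine ⟨h1, closure_carrier_halfSpace ▸ h2, ⟨?_, ?_⟩, C, fun s hs _ => ?_⟩
    · refine aestronglyMeasurable_of_continuousOn
        (isClosed_le continuous_const (continuous_oct_apply 0)).measurableSet h2 ?_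
      filter_upwards [ae_hyperplane 0] with x hx
      exact hx.ge
    · have := (hC 0 le_rfl).trans_lt ENNReal.coe_lt_top
      rw [← eLpNorm_two_sq] at this
      exact (ENNReal.pow_lt_top_iff.1 this).resolve_right two_ne_zero
    · simp only [sub_smul_normal_halfSpace]
      exact (hshift s).trans_le (hC s hs.le)

lemma IsHardyCore.comp_add_halfSpace {u : Oct → Oct} (hu : IsHardyCore halfSpace u) {s : ℝ}
    (hs : 0 ≤ s) : IsHardyCore halfSpace fun x => u (x + s • octE 0) := by
  obtain ⟨h1, h2, C, hC⟩ := isHardyCore_halfSpace_iff.1 hu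
  refine isHardyCore_halfSpace_iff.2 ⟨?_, ?_, C, fun t ht => ?_⟩
  · have := h1.comp_affine (isOpen_lt continuous_const (continuous_oct_apply 0)) (s • octE 0) 1
      (V := {x | 0 < x 0}) fun x hx => by
        have hx : 0 < x 0 := hx
        simp only [mem_ofPred_eq, PiLp.add_apply, PiLp.smul_apply, octE_zero_apply_zero, smul_eq_mul]
        linarith
    simpa only [one_smul, add_comm] using this
  · exact h2.comp (by fun_prop) fun x hx => shift_halfSpace hs hx
  · have := (measurePreserving_hyperplane_add t s).lintegral_comp_emb
      (measurableEmbedding_add_octE s) (fun x => ‖u x‖ₑ ^ 2)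
    exact this.trans_le (hC _ (add_nonneg ht hs))

/-- The functions representing `F ↦ ⟨F(y), v⟩` on the half-space. -/
noncomputable def halfSpaceSystem (y v x : Oct) : Oct := cauchyKernel v (x + oconj y)

@[simp] lemma oconj_apply_zero (x : Oct) : oconj x 0 = x 0 := by simp [oconj]

lemma le_norm_add_oconj (x y : Oct) : x 0 + y 0 ≤ ‖x + oconj y‖ := by
  have := PiLp.norm_apply_le (x + oconj y) 0
  simp only [PiLp.add_apply, oconj_apply_zero] at this
  exact (le_abs_self _).trans this

lemma norm_halfSpaceSystem_le {δ : ℝ} (hδ : 0 < δ) {x y : Oct} (hx : 0 ≤ x 0) (hy : δ ≤ y 0)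
    (v : Oct) : ‖halfSpaceSystem y v x‖ ≤
      (δ ^ 3)⁻¹ * ((1 + ‖y‖) / δ + 1) ^ 4 * ‖v‖ * decay x := by
  have h1 : δ ≤ ‖x - -oconj y‖ := by
    rw [sub_neg_eq_add]
    have := le_norm_add_oconj x y
    linarith
  have h2 := inv_norm_pow_le_decay hδ h1 (one_add_norm_le hδ h1)
  rw [sub_neg_eq_add, norm_neg, norm_oconj] at h2
  rw [halfSpaceSystem, norm_cauchyKernel]
  calc (‖x + oconj y‖ ^ 7)⁻¹ * ‖v‖ ≤ (δ ^ 3)⁻¹ * ((1 + ‖y‖) / δ + 1) ^ 4 * decay x * ‖v‖ := by gcongr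
    _ = _ := by ring

lemma add_oconj_ne_zero {x y : Oct} (hx : 0 ≤ x 0) (hy : 0 < y 0) : x + oconj y ≠ 0 := fun h => by
  have := le_norm_add_oconj x y
  rw [h, norm_zero] at this
  linarith

lemma isHardyCore_halfSpaceSystem {y : Oct} (hy : 0 < y 0) (v : Oct) :
    IsHardyCore halfSpace (halfSpaceSystem y v) := by
  obtain ⟨C, hC⟩ := exists_lintegral_le_of_le_decay
    ((y 0 ^ 3)⁻¹ * ((1 + ‖y‖) / y 0 + 1) ^ 4 * ‖v‖)
  refine isHardyCore_halfSpace_iff.2 ⟨?_, ?_, C, fun s hs => hC s _ ?_⟩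
  · have := (leftMonogenicOn_cauchyKernel v).comp_affine isOpen_compl_singleton (oconj y) 1
      (V := {x | 0 < x 0}) fun x hx => by
        rw [one_smul, add_comm]
        exact add_oconj_ne_zero (le_of_lt hx) hy
    have h2 : halfSpaceSystem y v = fun x => cauchyKernel v (oconj y + (1 : ℝ) • x) := by
      ext1 x; rw [halfSpaceSystem, one_smul, add_comm]
    rw [h2]
    exact this
  · exact ((leftMonogenicOn_cauchyKernel v).1.continuousOn).comp (by fun_prop)
      fun x hx => add_oconj_ne_zero hx hy
  · filter_upwards [ae_hyperplane s] with x hx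
    exact norm_halfSpaceSystem_le hy (hx ▸ hs) le_rfl v

/-- Real shifts are fixed by conjugation, so shifting x is the same as shifting y; this is the
semigroup property of the half-space system. -/
lemma halfSpaceSystem_add (y v x : Oct) (s : ℝ) :
    halfSpaceSystem y v (x + s • octE 0) = halfSpaceSystem (y + s • octE 0) v x := by
  rw [halfSpaceSystem, halfSpaceSystem, oconj_add, oconj_smul, oconj_one]
  congr 1
  abel

lemma oconj_of_apply_zero {x : Oct} (hx : x 0 = 0) : oconj x = -x := by
  ext i; fin_cases i <;> simp [oconj, hx]

/-- On x₀ = 0 conjugation is negation, so the system is minus the dual kernel there, matching the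
outward normal −1. Cauchy's formula on 0 < x₀ < b then applies, and the far face vanishes as b → ∞,
at rate (b − y₀)⁻³. -/
lemma halfSpace_reproducing {u : Oct → Oct} (hu : IsHardyCore halfSpace u) {y : Oct} (hy : 0 < y 0)
    (v : Oct) : ∫ x, inner ℝ (u x) (halfSpaceSystem y v x) ∂hyperplaneMeasure 0 =
      Real.pi ^ 4 / 3 * inner ℝ (u y) v := by
  obtain ⟨h1, h2, C, hC⟩ := isHardyCore_halfSpace_iff.1 hu
  obtain ⟨B, hB⟩ := exists_enorm_integral_inner_le C
  have hbd : ∫ x, inner ℝ (u x) (halfSpaceSystem y v x) ∂hyperplaneMeasure 0 =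
      -∫ x, inner ℝ (u x) (dualKernel 0 v (x - y)) ∂hyperplaneMeasure 0 := by
    rw [← integral_neg]
    refine integral_congr_ae ?_
    filter_upwards [ae_hyperplane 0] with x hx
    have h3 : oconj (x + oconj y) = -(x - y) := by
      rw [oconj_add, oconj_oconj, oconj_of_apply_zero hx]; abel
    rw [halfSpaceSystem, cauchyKernel, h3, neg_omul, ← norm_oconj, h3, norm_neg, dualKernel_zero,
      smul_neg, inner_neg_right]
  have hslab : ∀ b, y 0 < b →
      (∫ x, inner ℝ (u x) (dualKernel 0 v (x - y)) ∂hyperplaneMeasure b) +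
        ∫ x, inner ℝ (u x) (halfSpaceSystem y v x) ∂hyperplaneMeasure 0 =
          Real.pi ^ 4 / 3 * inner ℝ (u y) v := fun b hb => by
    rw [hbd, ← sub_eq_add_neg]
    exact slab_cauchy (h2.mono fun x hx => hx.1) (h1.mono fun x hx => hx.1)
      (C := C) (fun s hs => hC s hs.1) ⟨hy, hb⟩ v
  have hlim : Tendsto (fun b => ∫ x, inner ℝ (u x) (dualKernel 0 v (x - y)) ∂hyperplaneMeasure b)
      atTop (𝓝 0) := by
    have h3 : ∀ᶠ b in atTop, ‖∫ x, inner ℝ (u x) (dualKernel 0 v (x - y)) ∂hyperplaneMeasure b‖ ≤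
        ((b - y 0) ^ 3)⁻¹ * ((1 + ‖y‖) / (b - y 0) + 1) ^ 4 * ‖v‖ * B := by
      filter_upwards [eventually_gt_atTop (y 0)] with b hb
      have hδ : 0 < b - y 0 := sub_pos.2 hb
      refine hB b _ u _ (by positivity) ?_ (hC b (hy.trans hb).le) ?_
      · refine aestronglyMeasurable_of_continuousOn
          (isClosed_le continuous_const (continuous_oct_apply 0)).measurableSet h2 ?_
        filter_upwards [ae_hyperplane b] with x hx
        exact (hy.trans hb).le.trans hx.ge
      · filter_upwards [ae_hyperplane b] with x hx
        refine norm_dualKernel_le_decay hδ ?_ 0 v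
        rw [← hx]
        exact (le_abs_self _).trans (abs_apply_zero_sub_le x y)
    refine squeeze_zero_norm' h3 ?_
    have h4 : Tendsto (fun b : ℝ => b - y 0) atTop atTop := tendsto_atTop_add_const_right _ _ tendsto_id
    have h5 : Tendsto (fun b : ℝ => ((b - y 0) ^ 3)⁻¹) atTop (𝓝 0) :=
      ((tendsto_pow_atTop three_ne_zero).comp h4).inv_tendsto_atTop
    have h6 : Tendsto (fun b : ℝ => (1 + ‖y‖) / (b - y 0)) atTop (𝓝 0) :=
      tendsto_const_nhds.div_atTop h4
    have h7 := ((h5.mul ((h6.add_const 1).pow 4)).mul_const ‖v‖).mul_const (B : ℝ)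
    simpa using h7
  have h3 := hlim.add_const (∫ x, inner ℝ (u x) (halfSpaceSystem y v x) ∂hyperplaneMeasure 0)
  rw [zero_add] at h3
  refine tendsto_nhds_unique h3 (tendsto_const_nhds.congr' ?_)
  filter_upwards [eventually_gt_atTop (y 0)] with b hb using (hslab b hb).symm

lemma isHardyCore_of_mem_kernelSpan_halfSpace {w : Oct → Oct}
    (hw : w ∈ kernelSpan halfSpace halfSpaceSystem) : IsHardyCore halfSpace w := by
  refine Submodule.span_induction (p := fun w _ => IsHardyCore halfSpace w) ?_ ?_ ?_ ?_ hw
  · rintro _ ⟨y, hy, v, rfl⟩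
    exact isHardyCore_halfSpaceSystem hy v
  · exact isHardyCore_zero _
  · exact fun _ _ _ _ h1 h2 => isRegularDomain_halfSpace.core_add h1 h2
  · exact fun c _ _ h1 => isRegularDomain_halfSpace.core_smul h1 c

/-- Normal shifts are symmetric on the span: for a generator both sides reproduce u at y shifted by
s + t. -/
lemma halfSpace_inner_shift {u : Oct → Oct} (hu : IsHardyCore halfSpace u) {w : Oct → Oct}
    (hw : w ∈ kernelSpan halfSpace halfSpaceSystem) {s t : ℝ} (hs : 0 ≤ s) (ht : 0 ≤ t) :
    ∫ x, inner ℝ (u (x + s • octE 0)) (w (x + t • octE 0)) ∂hyperplaneMeasure 0 =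
      ∫ x, inner ℝ (u (x + (s + t) • octE 0)) (w x) ∂hyperplaneMeasure 0 := by
  have hint : ∀ {w : Oct → Oct}, w ∈ kernelSpan halfSpace halfSpaceSystem → ∀ {s t : ℝ}, 0 ≤ s →
      0 ≤ t → Integrable (fun x => inner ℝ (u (x + s • octE 0)) (w (x + t • octE 0)))
        (hyperplaneMeasure 0) :=
    fun {w} hw {s t} hs ht => integrable_inner_of_memLp (hu.comp_add_halfSpace hs).memLp
      ((isHardyCore_of_mem_kernelSpan_halfSpace hw).comp_add_halfSpace ht).memLp
  refine Submodule.span_induction (p := fun w _ =>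
    ∫ x, inner ℝ (u (x + s • octE 0)) (w (x + t • octE 0)) ∂hyperplaneMeasure 0 =
      ∫ x, inner ℝ (u (x + (s + t) • octE 0)) (w x) ∂hyperplaneMeasure 0) ?_ ?_ ?_ ?_ hw
  · rintro _ ⟨y, hy, v, rfl⟩
    have hy : 0 < y 0 := hy
    simp only [halfSpaceSystem_add]
    have hy' : 0 < (y + t • octE 0) 0 := by
      simp only [PiLp.add_apply, PiLp.smul_apply, octE_zero_apply_zero, smul_eq_mul]
      linarith
    rw [halfSpace_reproducing (hu.comp_add_halfSpace hs) hy',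
      halfSpace_reproducing (hu.comp_add_halfSpace (add_nonneg hs ht)) hy, add_assoc, ← add_smul,
      add_comm t s]
  · simp
  · intro f g hf hg h1 h2
    have h3 := hint hf (add_nonneg hs ht) le_rfl
    have h4 := hint hg (add_nonneg hs ht) le_rfl
    simp only [zero_smul, add_zero] at h3 h4
    simp only [Pi.add_apply, inner_add_right]
    rw [integral_add (hint hf hs ht) (hint hg hs ht), h1, h2, integral_add h3 h4]
  · intro c f _ h1
    simp only [Pi.smul_apply, inner_smul_right]
    rw [integral_const_mul, integral_const_mul, h1]

theorem isSzegoSystem_halfSpace : IsSzegoSystem halfSpace halfSpaceKernel halfSpaceSystem where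
  toIsRegularDomain := isRegularDomain_halfSpace
  conj_symm x y := by
    have h : oconj (oconj x + y) = oconj y + x := by
      rw [oconj_add, oconj_oconj, add_comm]
    rw [halfSpaceKernel, oconj_smul, h, ← norm_oconj (oconj x + y), h, halfSpaceKernel]
  core y hy v := isHardyCore_halfSpaceSystem hy v
  kernel_one y _ := by
    ext1 x
    have h : oconj (x + oconj y) = oconj x + y := by rw [oconj_add, oconj_oconj]
    rw [halfSpaceSystem, cauchyKernel, omul_one, h, ← norm_oconj, h, halfSpaceKernel]
  boundary y _ v := Eventually.of_forall fun x => by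
    have h : oconj (x + oconj y) = oconj x + y := by rw [oconj_add, oconj_oconj]
    rw [halfSpaceSystem, cauchyKernel, h, ← norm_oconj (x + oconj y), h]
    simp only [halfSpace, halfSpaceKernel, oconj_neg, neg_omul, omul_neg, oconj_one, one_omul,
      neg_neg, smul_omul]
  reproducing u hu y hy v := halfSpace_reproducing hu hy v
  loc_bound y hy := by
    have hy : 0 < y 0 := hy
    refine ⟨Metric.ball y (y 0 / 2), Metric.ball_mem_nhds y (half_pos hy),
      Real.toNNReal (((y 0 / 2) ^ 3)⁻¹ * ((1 + (‖y‖ + y 0 / 2)) / (y 0 / 2) + 1) ^ 4) *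
        (eLpNorm decay 2 (hyperplaneMeasure 0)).toNNReal, fun z hz v => ?_⟩
    have hzy : ‖z - y‖ < y 0 / 2 := mem_ball_iff_norm.1 hz.1
    have hz0 : y 0 / 2 ≤ z 0 := by
      have := (abs_le.1 ((abs_apply_zero_sub_le z y).trans hzy.le)).1
      linarith
    have hzn : ‖z‖ ≤ ‖y‖ + y 0 / 2 := by
      have : ‖z‖ ≤ ‖z - y‖ + ‖y‖ := by simpa using norm_add_le (z - y) y
      linarith
    have h1 := eLpNorm_le_of_le_decay (c := 0) (f := halfSpaceSystem z v)
      (A := ((y 0 / 2) ^ 3)⁻¹ * ((1 + (‖y‖ + y 0 / 2)) / (y 0 / 2) + 1) ^ 4 * ‖v‖) (by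
        filter_upwards [ae_hyperplane 0] with x hx
        refine (norm_halfSpaceSystem_le (half_pos hy) hx.ge hz0 v).trans ?_
        have := (decay_pos x).le
        gcongr)
    refine h1.trans (le_of_eq ?_)
    rw [ENNReal.coe_mul, ENNReal.coe_toNNReal (memLp_decay 0).2.ne,
      ENNReal.ofReal_mul (by positivity), ofReal_norm, mul_right_comm]
    rfl
  contraction := by
    refine ⟨1, ?_⟩
    filter_upwards [self_mem_nhdsWithin] with s hs w hw
    have hs : 0 < s := hs
    have hwc := isHardyCore_of_mem_kernelSpan_halfSpace hw
    have hL : ∀ {t : ℝ}, 0 ≤ t → MemLp (fun x => w (x + t • octE 0)) 2 (hyperplaneMeasure 0) :=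
      fun {t} ht => (hwc.comp_add_halfSpace ht).memLp
    have hw1 : MemLp w 2 (hyperplaneMeasure 0) := hwc.memLp
    simp only [sub_smul_normal_halfSpace]
    refine eLpNorm_two_le_of_integral_le (hL hs.le) hw1 ?_
    simp only [NNReal.coe_one, one_pow, one_mul]
    obtain ⟨-, -, C, hC⟩ := isHardyCore_halfSpace_iff.1 hwc
    have hpos : ∀ n : ℕ, 0 ≤ 2 ^ n * s := fun n => by positivity
    -- Symmetry of the shifts expresses the squared norm at height h as the pairing of w at height
    -- 2h with w, hence the doubling heights 2ⁿs.
    have key := le_of_le_average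
      (a := fun n : ℕ => ∫ x, ‖w (x + (2 ^ n * s) • octE 0)‖ ^ 2 ∂hyperplaneMeasure 0)
      (b := ∫ x, ‖w x‖ ^ 2 ∂hyperplaneMeasure 0) (M := C) (fun n => ?_) (fun n => ?_)
    · simp only [pow_zero, one_mul] at key
      exact key
    · have h1 := halfSpace_inner_shift hwc hw (hpos n) (hpos n)
      simp only [real_inner_self_eq_norm_sq] at h1
      rw [← two_mul, ← mul_assoc, ← pow_succ'] at h1
      rw [h1]
      exact (integral_inner_le_average (hL (hpos (n + 1))) hw1).trans (le_of_eq (by ring))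
    · refine integral_norm_sq_le (hL (hpos n)).1 ?_
      have := (measurePreserving_hyperplane_add 0 (2 ^ n * s)).lintegral_comp_emb
        (measurableEmbedding_add_octE _) (fun x => ‖w x‖ₑ ^ 2)
      rw [this, zero_add]
      exact hC _ (hpos n)
  approach y hy v := by
    have hy : 0 < y 0 := hy
    simp only [sub_smul_normal_halfSpace]
    have hc := isHardyCore_halfSpaceSystem hy v
    have hcont := (isHardyCore_halfSpace_iff.1 hc).2.1
    obtain ⟨A, hA⟩ : ∃ A, A = (y 0 ^ 3)⁻¹ * ((1 + (‖y‖ + 1)) / y 0 + 1) ^ 4 * ‖v‖ := ⟨_, rfl⟩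
    -- Moving the shift onto y enlarges ‖y‖ by at most 1, so one constant dominates all these shifts
    -- at once.
    have hb : ∀ s ∈ Ico (0 : ℝ) 1, ∀ x : Oct, x 0 = 0 →
        ‖halfSpaceSystem y v (x + s • octE 0)‖ ≤ A * decay x := fun s hs x hx => by
      rw [halfSpaceSystem_add]
      have h1 : y 0 ≤ (y + s • octE 0) 0 := by simpa using hs.1
      have h2 : ‖y + s • octE 0‖ ≤ ‖y‖ + 1 := by
        refine (norm_add_le _ _).trans ?_
        rw [norm_smul, norm_octE, Real.norm_of_nonneg hs.1]
        linarith [hs.2]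
      refine (norm_halfSpaceSystem_le hy hx.ge h1 v).trans ?_
      have := (decay_pos x).le
      rw [hA]
      gcongr
    refine tendsto_eLpNorm_of_tendsto_lintegral (tendsto_lintegral_of_le_decay (A := A + A) ?_ ?_ ?_)
    · filter_upwards [self_mem_nhdsWithin] with s hs
      exact (hc.comp_add_halfSpace (le_of_lt hs)).memLp.1.sub hc.memLp.1
    · filter_upwards [Ioo_mem_nhdsGT (zero_lt_one (α := ℝ))] with s hs
      filter_upwards [ae_hyperplane 0] with x hx
      refine (norm_sub_le _ _).trans ?_
      have h1 := hb s ⟨hs.1.le, hs.2⟩ x hx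
      have h2 := hb 0 ⟨le_rfl, one_pos⟩ x hx
      rw [zero_smul, add_zero] at h2
      linarith
    · filter_upwards [ae_hyperplane 0] with x hx
      have h1 : ContinuousWithinAt (fun s : ℝ => halfSpaceSystem y v (x + s • octE 0)) (Ici 0) 0 :=
        (hcont.comp (f := fun s : ℝ => x + s • octE 0) (s := Ici 0) (by fun_prop) fun s hs =>
          shift_halfSpace hs hx.ge) 0 self_mem_Ici
      have h2 := (h1.mono Ioi_subset_Ici_self).tendsto.sub_const (halfSpaceSystem y v x)
      simpa using h2

/-! ### The strip -/

lemma decay_le_of_norm_le {r : ℝ} (hr : 0 ≤ r) {x z : Oct} (h : ‖x‖ ≤ r + ‖z‖) :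
    decay z ≤ (1 + r) ^ 4 * decay x := by
  have h1 : (1 + ‖x‖) ^ 4 ≤ ((1 + r) * (1 + ‖z‖)) ^ 4 := by
    gcongr
    nlinarith [norm_nonneg z]
  rw [decay, decay, ← div_eq_mul_inv, le_div_iff₀ (by positivity), inv_mul_le_iff₀ (by positivity)]
  rw [mul_pow] at h1
  linarith

lemma closure_carrier_strip {d : ℝ} (hd : 0 < d) : closure (strip d).carrier = closedSlab 0 d := by
  have := (preimage_apply_zero (s := Ioo 0 d)).1
  rw [closure_Ioo hd.ne] at this
  exact this.symm

lemma mem_frontier_strip_iff {d : ℝ} (hd : 0 < d) {x : Oct} :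
    x ∈ frontier (strip d).carrier ↔ x 0 = 0 ∨ x 0 = d := by
  have := (preimage_apply_zero (s := Ioo 0 d)).2
  rw [frontier_Ioo hd] at this
  change x ∈ frontier ((fun x : Oct => x 0) ⁻¹' Ioo 0 d) ↔ _
  rw [← this]
  rfl

lemma sub_smul_normal_strip_zero (d s : ℝ) {x : Oct} (hx : x 0 = 0) :
    x - s • (strip d).normal x = x + s • octE 0 := by
  simp [strip, hx]

lemma sub_smul_normal_strip {d : ℝ} (hd : 0 < d) (s : ℝ) {x : Oct} (hx : x 0 = d) :
    x - s • (strip d).normal x = x + (-s) • octE 0 := by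
  simp [strip, hx, hd.ne', sub_eq_add_neg]

lemma ae_strip_iff {d : ℝ} {p : Oct → Prop} : (∀ᵐ x ∂(strip d).surface, p x) ↔
    (∀ᵐ x ∂hyperplaneMeasure 0, p x) ∧ ∀ᵐ x ∂hyperplaneMeasure d, p x :=
  ae_add_measure_iff

lemma parallel_mem_strip_iff {d : ℝ} (hd : 0 < d) {s : ℝ} :
    (∀ x ∈ frontier (strip d).carrier, x - s • (strip d).normal x ∈ (strip d).carrier) ↔
      0 < s ∧ s < d := by
  constructor
  · intro h
    have h1 := h 0 ((mem_frontier_strip_iff hd).2 (Or.inl rfl))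
    rw [sub_smul_normal_strip_zero d s rfl] at h1
    simpa [strip] using h1
  · rintro ⟨h0, h1⟩ x hx
    rcases (mem_frontier_strip_iff hd).1 hx with hx | hx
    · rw [sub_smul_normal_strip_zero d s hx]
      simpa [strip, hx] using ⟨h0, h1⟩
    · rw [sub_smul_normal_strip hd s hx]
      simp only [strip, mem_ofPred_eq, PiLp.add_apply, PiLp.smul_apply, octE_zero_apply_zero, hx,
        smul_eq_mul]
      constructor <;> linarith

lemma isRegularDomain_strip {d : ℝ} (hd : 0 < d) : IsRegularDomain (strip d) where
  isOpen := isOpen_openSlab 0 d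
  normal_aemeasurable := by
    refine Measurable.aemeasurable (Measurable.ite ?_ measurable_const measurable_const)
    have h : IsClosed {x : Oct | x 0 = 0} := isClosed_eq (continuous_oct_apply 0) continuous_const
    exact h.measurableSet
  normal_norm := Eventually.of_forall fun x => by
    simp only [strip]
    split_ifs <;> simp
  mem_frontier := ae_strip_iff.2
    ⟨(ae_hyperplane 0).mono fun x hx => (mem_frontier_strip_iff hd).2 (Or.inl hx),
      (ae_hyperplane d).mono fun x hx => (mem_frontier_strip_iff hd).2 (Or.inr hx)⟩
  parallel := by
    filter_upwards [Ioo_mem_nhdsGT hd] with s hs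
    exact (parallel_mem_strip_iff hd).2 hs

lemma lintegral_strip (d : ℝ) (f : Oct → ℝ≥0∞) : ∫⁻ x, f x ∂(strip d).surface =
    ∫⁻ x, f x ∂hyperplaneMeasure 0 + ∫⁻ x, f x ∂hyperplaneMeasure d :=
  lintegral_add_measure _ _ _

lemma memLp_strip {E : Type*} [NormedAddCommGroup E] {d : ℝ} {f : Oct → E}
    (h0 : MemLp f 2 (hyperplaneMeasure 0)) (hd : MemLp f 2 (hyperplaneMeasure d)) :
    MemLp f 2 (strip d).surface := by
  refine ⟨h0.1.add_measure hd.1, ?_⟩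
  have h : eLpNorm f 2 (strip d).surface ^ 2 < ∞ := by
    rw [eLpNorm_two_sq, lintegral_strip, ← eLpNorm_two_sq, ← eLpNorm_two_sq]
    exact ENNReal.add_lt_top.2 ⟨ENNReal.pow_lt_top h0.2, ENNReal.pow_lt_top hd.2⟩
  exact (ENNReal.pow_lt_top_iff.1 h).resolve_right two_ne_zero

lemma integral_strip {d : ℝ} {f : Oct → ℝ} (h0 : Integrable f (hyperplaneMeasure 0))
    (hd : Integrable f (hyperplaneMeasure d)) : ∫ x, f x ∂(strip d).surface =
      ∫ x, f x ∂hyperplaneMeasure 0 + ∫ x, f x ∂hyperplaneMeasure d :=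
  integral_add_measure h0 hd

lemma lintegral_parallel_strip {d : ℝ} (hd : 0 < d) (u : Oct → Oct) (s : ℝ) :
    ∫⁻ x, ‖u (x - s • (strip d).normal x)‖ₑ ^ 2 ∂(strip d).surface =
      ∫⁻ x, ‖u x‖ₑ ^ 2 ∂hyperplaneMeasure s + ∫⁻ x, ‖u x‖ₑ ^ 2 ∂hyperplaneMeasure (d - s) := by
  have h1 := (measurePreserving_hyperplane_add 0 s).lintegral_comp_emb
    (measurableEmbedding_add_octE s) (fun x => ‖u x‖ₑ ^ 2)
  have h2 := (measurePreserving_hyperplane_add d (-s)).lintegral_comp_emb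
    (measurableEmbedding_add_octE (-s)) (fun x => ‖u x‖ₑ ^ 2)
  rw [zero_add] at h1
  rw [← sub_eq_add_neg] at h2
  rw [lintegral_strip, ← h1, ← h2]
  congr 1
  · refine lintegral_congr_ae ?_
    filter_upwards [ae_hyperplane 0] with x hx
    rw [sub_smul_normal_strip_zero d s hx]
  · refine lintegral_congr_ae ?_
    filter_upwards [ae_hyperplane d] with x hx
    rw [sub_smul_normal_strip hd s hx]

lemma isHardyCore_strip_iff {d : ℝ} (hd : 0 < d) {u : Oct → Oct} : IsHardyCore (strip d) u ↔
    LeftMonogenicOn u (openSlab 0 d) ∧ ContinuousOn u (closedSlab 0 d) ∧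
      ∃ C : ℝ≥0, ∀ s ∈ Icc 0 d, ∫⁻ x, ‖u x‖ₑ ^ 2 ∂hyperplaneMeasure s ≤ C := by
  constructor
  · intro hu
    refine ⟨hu.monogenic, closure_carrier_strip hd ▸ hu.continuousOn, ?_⟩
    obtain ⟨C, hC⟩ := hu.bounded
    have h0 : ∫⁻ x, ‖u x‖ₑ ^ 2 ∂(strip d).surface ≠ ∞ := by
      rw [← eLpNorm_two_sq]
      exact ENNReal.pow_ne_top hu.memLp.2.ne
    refine ⟨C + (∫⁻ x, ‖u x‖ₑ ^ 2 ∂(strip d).surface).toNNReal, fun s hs => ?_⟩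
    rw [ENNReal.coe_add, ENNReal.coe_toNNReal h0, lintegral_strip]
    rcases hs.1.eq_or_lt with rfl | hs0
    · exact le_self_add.trans le_add_self
    rcases hs.2.eq_or_lt with rfl | hsd
    · exact le_add_self.trans le_add_self
    · have := hC s hs0 ((parallel_mem_strip_iff hd).2 ⟨hs0, hsd⟩)
      rw [lintegral_parallel_strip hd] at this
      exact (le_self_add.trans this).trans le_self_add
  · rintro ⟨h1, h2, C, hC⟩
    refine ⟨h1, closure_carrier_strip hd ▸ h2, memLp_strip (memLp_hyperplane ⟨le_rfl, hd.le⟩ h2 hC)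
      (memLp_hyperplane ⟨hd.le, le_rfl⟩ h2 hC), C + C, fun s _ hpar => ?_⟩
    obtain ⟨hs0, hsd⟩ := (parallel_mem_strip_iff hd).1 hpar
    rw [lintegral_parallel_strip hd, ENNReal.coe_add]
    exact add_le_add (hC s ⟨hs0.le, hsd.le⟩) (hC _ ⟨by linarith, by linarith⟩)

/-! ### The kernel of the strip -/

/-- The summands of `stripSystem`. -/
noncomputable def stripTerm (d : ℝ) (y v : Oct) (n : ℤ) (x : Oct) : Oct :=
  (-1 : ℝ) ^ n • halfSpaceSystem (y + (2 * d * n) • octE 0) v x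

/-- The functions representing `F ↦ ⟨F(y), v⟩` on the strip. -/
noncomputable def stripSystem (d : ℝ) (y v x : Oct) : Oct := ∑' n : ℤ, stripTerm d y v n x

lemma summable_int_inv_cube : Summable fun n : ℤ => ((1 + |(n : ℝ)|) ^ 3)⁻¹ := by
  have h : Summable fun n : ℕ => ((1 + (n : ℝ)) ^ 3)⁻¹ := by
    have h1 := (summable_nat_add_iff 1).2 (Real.summable_one_div_nat_pow.2 (by norm_num : 1 < 3))
    refine h1.congr fun n => ?_
    push_cast
    rw [one_div, add_comm]
  exact Summable.of_nat_of_neg (by simpa using h) (by simpa using h)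

/-- The hypotheses force δ ≤ d, so the distance to the zeros grows linearly in |n|. The constant δ/2
is what the case n = −1 allows. -/
lemma le_abs_add_int {δ d t : ℝ} (hδ : 0 < δ) (h1 : δ ≤ t) (h2 : t ≤ 2 * d - δ) (n : ℤ) :
    δ / 2 * (1 + |(n : ℝ)|) ≤ |t + 2 * d * n| := by
  rcases le_or_gt 0 n with hn | hn
  · have hn' : (0 : ℝ) ≤ n := by exact_mod_cast hn
    rw [abs_of_nonneg hn']
    refine le_trans ?_ (le_abs_self _)
    nlinarith
  · have hn' : (n : ℝ) ≤ -1 := by exact_mod_cast Int.le_sub_one_of_lt hn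
    rw [abs_of_nonpos (by linarith)]
    refine le_trans ?_ (neg_le_abs _)
    nlinarith

lemma norm_sub_smul_octE_le (z : Oct) : ‖z - z 0 • octE 0‖ ≤ 2 * ‖z‖ := by
  have h1 : |z 0| ≤ ‖z‖ := by simpa using PiLp.norm_apply_le z 0
  refine (norm_sub_le _ _).trans ?_
  rw [norm_smul, norm_octE, Real.norm_eq_abs]
  linarith

/-- The comparison of |x| with |z| must not depend on the image shift 2dn. Since the shift is real,
x is recovered from z minus its real part together with x₀ + y₀, which lies between 0 and 2d. Three
powers of |z| then supply the summable factor (1 + |n|)⁻³. -/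
lemma norm_stripTerm_le {δ d Y : ℝ} (hδ : 0 < δ) {x y : Oct} (h1 : δ ≤ x 0 + y 0)
    (h2 : x 0 + y 0 ≤ 2 * d - δ) (hy : ‖y‖ ≤ Y) (v : Oct) (n : ℤ) :
    ‖stripTerm d y v n x‖ ≤ ((δ / 2) ^ 3)⁻¹ * ((1 + 2 * d + Y) / (δ / 2) + 2) ^ 4 * ‖v‖ * decay x *
      ((1 + |(n : ℝ)|) ^ 3)⁻¹ := by
  set z : Oct := x + oconj (y + (2 * d * n) • octE 0) with hz
  have hz0 : z 0 = x 0 + y 0 + 2 * d * n := by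
    simp [hz, add_assoc]
  have hzn : δ / 2 * (1 + |(n : ℝ)|) ≤ ‖z‖ := by
    refine (le_abs_add_int hδ h1 h2 n).trans ?_
    rw [← hz0]
    simpa using PiLp.norm_apply_le z 0
  have hδ2 : δ / 2 ≤ ‖z‖ := by
    refine le_trans ?_ hzn
    nlinarith [abs_nonneg (n : ℝ)]
  have hκ : 1 + ‖x‖ ≤ ((1 + 2 * d + Y) / (δ / 2) + 2) * ‖z‖ := by
    have h3 : x = (z - z 0 • octE 0) + (x 0 + y 0) • octE 0 - oconj y := by
      rw [hz0, hz, oconj_add, oconj_smul, oconj_one]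
      module
    have h4 : ‖x‖ ≤ 2 * ‖z‖ + 2 * d + Y := by
      calc ‖x‖ ≤ ‖z - z 0 • octE 0‖ + ‖(x 0 + y 0) • octE 0‖ + ‖oconj y‖ := by
            nth_rw 1 [h3]
            exact (norm_sub_le _ _).trans (by gcongr; exact norm_add_le _ _)
        _ ≤ 2 * ‖z‖ + 2 * d + Y := by
            rw [norm_smul, norm_octE, norm_oconj, mul_one, Real.norm_of_nonneg (by linarith)]
            linarith [norm_sub_smul_octE_le z]
    have h5 : 1 + 2 * d + Y ≤ (1 + 2 * d + Y) / (δ / 2) * ‖z‖ := by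
      have : 0 ≤ Y := (norm_nonneg y).trans hy
      rw [div_mul_eq_mul_div, le_div_iff₀ (by positivity)]
      exact mul_le_mul_of_nonneg_left hδ2 (by linarith)
    linarith
  have h6 := inv_norm_pow_le_decay (by positivity) hzn hκ
  rw [stripTerm, norm_smul, norm_zpow, norm_neg, norm_one, one_zpow, one_mul, halfSpaceSystem,
    norm_cauchyKernel, ← hz]
  rw [mul_pow, mul_inv] at h6
  refine (mul_le_mul_of_nonneg_right h6 (norm_nonneg v)).trans (le_of_eq (by ring))

lemma exists_stripTerm_le {δ d Y : ℝ} (hδ : 0 < δ) : ∃ A, 0 ≤ A ∧ ∀ {x y : Oct},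
    δ ≤ x 0 + y 0 → x 0 + y 0 ≤ 2 * d - δ → ‖y‖ ≤ Y → ∀ v n,
      ‖stripTerm d y v n x‖ ≤ A * ‖v‖ * decay x * ((1 + |(n : ℝ)|) ^ 3)⁻¹ :=
  ⟨((δ / 2) ^ 3)⁻¹ * ((1 + 2 * d + Y) / (δ / 2) + 2) ^ 4, by positivity,
    fun h1 h2 hy v n => norm_stripTerm_le hδ h1 h2 hy v n⟩

lemma exists_stripSystem_le {δ d Y : ℝ} (hδ : 0 < δ) : ∃ A, 0 ≤ A ∧ ∀ {x y : Oct},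
    δ ≤ x 0 + y 0 → x 0 + y 0 ≤ 2 * d - δ → ‖y‖ ≤ Y → ∀ v,
      ‖stripSystem d y v x‖ ≤ A * ‖v‖ * decay x := by
  obtain ⟨A, hA, h⟩ := exists_stripTerm_le (d := d) (Y := Y) hδ
  refine ⟨A * ∑' n : ℤ, ((1 + |(n : ℝ)|) ^ 3)⁻¹,
    mul_nonneg hA (tsum_nonneg fun n => by positivity), fun {x y} h1 h2 hy v => ?_⟩
  have h3 := tsum_of_norm_bounded ((summable_int_inv_cube.hasSum).mul_left (A * ‖v‖ * decay x))
    fun n => h h1 h2 hy v n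
  refine h3.trans (le_of_eq (by ring))

/-- Half the distance from y to the faces keeps x₀ + z₀ away from 0 and 2d, the values at which the
terms n = 0 and n = −1 could become singular. -/
lemma exists_margin {d : ℝ} {y : Oct} (hy : y ∈ openSlab 0 d) : ∃ δ, 0 < δ ∧
    ∀ x ∈ closedSlab 0 d, ∀ z : Oct, ‖z - y‖ < δ → δ ≤ x 0 + z 0 ∧ x 0 + z 0 ≤ 2 * d - δ := by
  refine ⟨min (y 0) (d - y 0) / 2, half_pos (lt_min hy.1 (sub_pos.2 hy.2)), fun x hx z hz => ?_⟩
  have h1 := min_le_left (y 0) (d - y 0)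
  have h2 := min_le_right (y 0) (d - y 0)
  have h3 := abs_lt.1 ((abs_apply_zero_sub_le z y).trans_lt hz)
  exact ⟨by linarith [hx.1, h3.1], by linarith [hx.2, h3.2]⟩

lemma exists_stripTerm_le_of_mem {d : ℝ} {y : Oct} (hy : y ∈ openSlab 0 d) (v : Oct) : ∃ A, 0 ≤ A ∧
    ∀ x ∈ closedSlab 0 d, ∀ n,
      ‖stripTerm d y v n x‖ ≤ A * decay x * ((1 + |(n : ℝ)|) ^ 3)⁻¹ := by
  obtain ⟨δ, hδ, hδy⟩ := exists_margin hy
  obtain ⟨A, hA, h⟩ := exists_stripTerm_le (d := d) (Y := ‖y‖) hδ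
  refine ⟨A * ‖v‖, by positivity, fun x hx n => ?_⟩
  obtain ⟨h1, h2⟩ := hδy x hx y (by simpa using hδ)
  exact h h1 h2 le_rfl v n

lemma exists_stripSystem_le_of_mem {d : ℝ} {y : Oct} (hy : y ∈ openSlab 0 d) (v : Oct) : ∃ A, 0 ≤ A ∧
    ∀ x ∈ closedSlab 0 d, ‖stripSystem d y v x‖ ≤ A * decay x := by
  obtain ⟨δ, hδ, hδy⟩ := exists_margin hy
  obtain ⟨A, hA, h⟩ := exists_stripSystem_le (d := d) (Y := ‖y‖) hδ
  refine ⟨A * ‖v‖, by positivity, fun x hx => ?_⟩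
  obtain ⟨h1, h2⟩ := hδy x hx y (by simpa using hδ)
  exact h h1 h2 le_rfl v

lemma summable_stripTerm {d : ℝ} {y : Oct} (hy : y ∈ openSlab 0 d) (v : Oct) {x : Oct}
    (hx : x ∈ closedSlab 0 d) : Summable fun n => stripTerm d y v n x := by
  obtain ⟨A, -, h⟩ := exists_stripTerm_le_of_mem hy v
  exact Summable.of_norm_bounded (summable_int_inv_cube.mul_left _) (h x hx)

lemma decay_le_one (x : Oct) : decay x ≤ 1 := by
  rw [decay]
  exact inv_le_one_of_one_le₀ (one_le_pow₀ (by linarith [norm_nonneg x]))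

lemma exists_stripTerm_le_const {d : ℝ} {y : Oct} (hy : y ∈ openSlab 0 d) (v : Oct) : ∃ A,
    ∀ n, ∀ x ∈ closedSlab 0 d, ‖stripTerm d y v n x‖ ≤ A * ((1 + |(n : ℝ)|) ^ 3)⁻¹ := by
  obtain ⟨A, hA, h⟩ := exists_stripTerm_le_of_mem hy v
  refine ⟨A, fun n x hx => (h x hx n).trans ?_⟩
  gcongr
  exact mul_le_of_le_one_right hA (decay_le_one x)

lemma leftMonogenicOn_sum {ι : Type*} {U : Set Oct} (hU : IsOpen U) {F : ι → Oct → Oct}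
    (hF : ∀ i, LeftMonogenicOn (F i) U) (s : Finset ι) :
    LeftMonogenicOn (fun x => ∑ i ∈ s, F i x) U := by
  classical
  induction s using Finset.induction_on with
  | empty =>
    simp only [Finset.sum_empty]
    exact leftMonogenicOn_of_hasFDerivAt fun x _ => ⟨0, hasFDerivAt_const _ _, map_zero _⟩
  | insert i s hi ih =>
    simp only [Finset.sum_insert hi]
    exact (hF i).add hU ih

lemma stripTerm_ne_zero {d : ℝ} {y : Oct} (hy : y ∈ openSlab 0 d) (n : ℤ) {x : Oct}
    (hx : x ∈ closedSlab 0 d) : x + oconj (y + (2 * d * n) • octE 0) ≠ 0 := fun h => by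
  obtain ⟨δ, hδ, hδy⟩ := exists_margin hy
  obtain ⟨h1, h2⟩ := hδy x hx y (by simpa using hδ)
  have h3 := le_abs_add_int hδ h1 h2 n
  have h4 : x 0 + y 0 + 2 * d * n = 0 := by
    have := congrArg (fun z : Oct => z 0) h
    simp only [PiLp.add_apply, oconj_apply_zero, PiLp.smul_apply, octE_zero_apply_zero, smul_eq_mul,
      mul_one, PiLp.zero_apply] at this
    linarith
  rw [h4, abs_zero] at h3
  have : 0 < δ / 2 * (1 + |(n : ℝ)|) := by positivity
  linarith

lemma continuousOn_stripTerm {d : ℝ} {y : Oct} (hy : y ∈ openSlab 0 d) (v : Oct) (n : ℤ) :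
    ContinuousOn (stripTerm d y v n) (closedSlab 0 d) := by
  have h : ContinuousOn (halfSpaceSystem (y + (2 * d * n) • octE 0) v) (closedSlab 0 d) :=
    ((leftMonogenicOn_cauchyKernel v).1.continuousOn).comp (by fun_prop)
      fun _ hx => stripTerm_ne_zero hy n hx
  exact h.const_smul ((-1 : ℝ) ^ n)

lemma leftMonogenicOn_stripTerm {d : ℝ} {y : Oct} (hy : y ∈ openSlab 0 d) (v : Oct) (n : ℤ) :
    LeftMonogenicOn (stripTerm d y v n) (openSlab 0 d) := by
  refine LeftMonogenicOn.const_smul (isOpen_openSlab 0 d) ?_ _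
  have := (leftMonogenicOn_cauchyKernel v).comp_affine isOpen_compl_singleton
    (oconj (y + (2 * d * n) • octE 0)) 1 (V := openSlab 0 d) fun x hx => by
      rw [one_smul, add_comm]
      exact stripTerm_ne_zero hy n (openSlab_subset_closedSlab _ _ hx)
  have h2 : (halfSpaceSystem (y + (2 * d * n) • octE 0) v) =
      fun x => cauchyKernel v (oconj (y + (2 * d * n) • octE 0) + (1 : ℝ) • x) := by
    ext1 x; rw [halfSpaceSystem, one_smul, add_comm]
  rw [h2]
  exact this

lemma isHardyCore_stripSystem {d : ℝ} (hd : 0 < d) {y : Oct} (hy : y ∈ openSlab 0 d) (v : Oct) :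
    IsHardyCore (strip d) (stripSystem d y v) := by
  obtain ⟨A, hA⟩ := exists_stripTerm_le_const hy v
  obtain ⟨B, -, hB⟩ := exists_stripSystem_le_of_mem hy v
  obtain ⟨C, hC⟩ := exists_lintegral_le_of_le_decay B
  refine (isHardyCore_strip_iff hd).2 ⟨?_, ?_, C, fun s hs => hC s _
    ((ae_mem_closedSlab hs).mono hB)⟩
  · have hunif := tendstoUniformlyOn_tsum (summable_int_inv_cube.mul_left A) hA
    -- Closure of monogenic functions under limits is stated for sequences, so a sequence exhausting
    -- the finite sets of indices is chosen.
    obtain ⟨t, ht⟩ := exists_seq_tendsto (atTop : Filter (Finset ℤ))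
    refine LeftMonogenicOn.of_tendstoLocallyUniformlyOn (isOpen_openSlab 0 d)
      (u := fun k x => ∑ n ∈ t k, stripTerm d y v n x)
      (fun k => leftMonogenicOn_sum (isOpen_openSlab 0 d)
        (fun n => leftMonogenicOn_stripTerm hy v n) _) ?_
    refine TendstoUniformlyOn.tendstoLocallyUniformlyOn ?_
    intro U hU
    exact (ht.eventually (hunif U hU)).mono fun k hk x hx =>
      hk x (openSlab_subset_closedSlab _ _ hx)
  · exact continuousOn_tsum (fun n => continuousOn_stripTerm hy v n)
      (summable_int_inv_cube.mul_left A) hA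

/-! ### The reproducing property on the strip -/

/-- The bound on the terms dominates the integrals by a constant times (1 + |n|)⁻³, so the sum and
the face integral may be interchanged. -/
lemma hasSum_integral_stripTerm {d c : ℝ} (hc : c ∈ Icc 0 d) {y : Oct} (hy : y ∈ openSlab 0 d)
    (v : Oct) {u : Oct → Oct} (hu : MemLp u 2 (hyperplaneMeasure c)) :
    HasSum (fun n => ∫ x, inner ℝ (u x) (stripTerm d y v n x) ∂hyperplaneMeasure c)
      (∫ x, inner ℝ (u x) (stripSystem d y v x) ∂hyperplaneMeasure c) := by
  obtain ⟨A, hA0, hA⟩ := exists_stripTerm_le_of_mem hy v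
  have hmem := ae_mem_closedSlab hc
  have hL : ∀ n, MemLp (stripTerm d y v n) 2 (hyperplaneMeasure c) := fun n => by
    refine MemLp.of_le_decay (A := A * ((1 + |(n : ℝ)|) ^ 3)⁻¹)
      (aestronglyMeasurable_of_continuousOn (isClosed_closedSlab 0 d).measurableSet
        (continuousOn_stripTerm hy v n) hmem) (hmem.mono fun x hx => (hA x hx n).trans (le_of_eq ?_))
    ring
  have hi : ∀ n, Integrable (fun x => inner ℝ (u x) (stripTerm d y v n x)) (hyperplaneMeasure c) :=
    fun n => integrable_inner_of_memLp hu (hL n)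
  have hud : Integrable (fun x => ‖u x‖ * decay x) (hyperplaneMeasure c) :=
    MemLp.integrable_mul hu.norm (memLp_decay c)
  have hsum : Summable fun n => ∫ x, ‖(inner ℝ (u x) (stripTerm d y v n x) : ℝ)‖
      ∂hyperplaneMeasure c := by
    refine Summable.of_nonneg_of_le (fun n => integral_nonneg fun x => norm_nonneg _) (fun n => ?_)
      (summable_int_inv_cube.mul_left (A * ∫ x, ‖u x‖ * decay x ∂hyperplaneMeasure c))
    calc ∫ x, ‖(inner ℝ (u x) (stripTerm d y v n x) : ℝ)‖ ∂hyperplaneMeasure c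
        ≤ ∫ x, A * ((1 + |(n : ℝ)|) ^ 3)⁻¹ * (‖u x‖ * decay x) ∂hyperplaneMeasure c := by
          refine integral_mono_ae (hi n).norm (hud.const_mul _) ?_
          filter_upwards [hmem] with x hx
          calc ‖(inner ℝ (u x) (stripTerm d y v n x) : ℝ)‖
              ≤ ‖u x‖ * ‖stripTerm d y v n x‖ := norm_inner_le_norm _ _
            _ ≤ ‖u x‖ * (A * decay x * ((1 + |(n : ℝ)|) ^ 3)⁻¹) := by
                gcongr
                exact hA x hx n
            _ = _ := by ring
      _ = _ := by rw [integral_const_mul]; ring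
  have h := hasSum_integral_of_summable_integral_norm hi hsum
  have h2 : ∫ x, inner ℝ (u x) (stripSystem d y v x) ∂hyperplaneMeasure c =
      ∫ x, ∑' n, inner ℝ (u x) (stripTerm d y v n x) ∂hyperplaneMeasure c := by
    refine integral_congr_ae ?_
    filter_upwards [hmem] with x hx
    exact (innerSL ℝ (u x)).map_tsum (summable_stripTerm hy v hx)
  rw [h2]
  exact h

/-- On this hyperplane x̄ = −x + 2d(m − n), so the n-th term becomes a signed dual kernel with pole
y + 2dm. The face x₀ = 0 is the case n = m, and the face x₀ = d the case n = m − 1. -/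
lemma stripTerm_of_apply_zero_eq {d : ℝ} {x : Oct} (y v : Oct) (n m : ℤ) (hx : x 0 = d * (m - n)) :
    stripTerm d y v n x =
      -((-1 : ℝ) ^ n • dualKernel 0 v (x - (y + (2 * d * m) • octE 0))) := by
  have h1 : oconj x = -x + (2 * d * (m - n)) • octE 0 := by
    have h2 : (2 * d * (m - n) : ℝ) = 2 * x 0 := by rw [hx]; ring
    rw [h2]
    ext i; fin_cases i <;> simp [oconj, octE]
    ring
  have h3 : oconj (x + oconj (y + (2 * d * n) • octE 0)) = -(x - (y + (2 * d * m) • octE 0)) := by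
    rw [oconj_add, oconj_oconj, h1]
    module
  rw [stripTerm, halfSpaceSystem, cauchyKernel, h3, neg_omul, ← norm_oconj, h3, norm_neg,
    dualKernel_zero, smul_neg, smul_neg]

lemma strip_pole_dist {d : ℝ} {y : Oct} (hy : y ∈ openSlab 0 d) {m : ℤ} (hm : m ≠ 0) {x : Oct}
    (hx : x ∈ closedSlab 0 d) : d ≤ ‖x - (y + (2 * d * m) • octE 0)‖ := by
  refine le_trans ?_ (abs_apply_zero_sub_le _ _)
  simp only [PiLp.add_apply, PiLp.smul_apply, octE_zero_apply_zero, smul_eq_mul, mul_one]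
  have hd : 0 < d := hy.1.trans hy.2
  obtain ⟨hx0, hx1⟩ := hx
  obtain ⟨hy0, hy1⟩ := hy
  rcases lt_or_gt_of_ne hm with hm | hm
  · have hm' : (m : ℝ) ≤ -1 := by exact_mod_cast Int.le_sub_one_of_lt hm
    refine le_trans ?_ (le_abs_self _)
    nlinarith
  · have hm' : (1 : ℝ) ≤ m := by exact_mod_cast hm
    refine le_trans ?_ (neg_le_abs _)
    nlinarith

/-- Terms are grouped by pole. The m-th term on the lower face and the (m − 1)-st on the upper face
share the pole y + 2dm and combine to (−1)ᵐ times a difference of face integrals. For m = 0 this is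
Cauchy's formula; for m ≠ 0 the pole is outside the closed strip and Cauchy's theorem gives zero. -/
lemma strip_reproducing {d : ℝ} (hd : 0 < d) {u : Oct → Oct} (hu : IsHardyCore (strip d) u) {y : Oct}
    (hy : y ∈ openSlab 0 d) (v : Oct) :
    ∫ x, inner ℝ (u x) (stripSystem d y v x) ∂(strip d).surface =
      Real.pi ^ 4 / 3 * inner ℝ (u y) v := by
  obtain ⟨h1, h2, C, hC⟩ := (isHardyCore_strip_iff hd).1 hu
  obtain ⟨-, k2, B, hB⟩ := (isHardyCore_strip_iff hd).1 (isHardyCore_stripSystem hd hy v)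
  have h0I : (0 : ℝ) ∈ Icc 0 d := ⟨le_rfl, hd.le⟩
  have hdI : d ∈ Icc 0 d := ⟨hd.le, le_rfl⟩
  have hi : ∀ c ∈ Icc 0 d, Integrable (fun x => inner ℝ (u x) (stripSystem d y v x))
      (hyperplaneMeasure c) := fun c hc =>
    integrable_inner_of_memLp (memLp_hyperplane hc h2 hC) (memLp_hyperplane hc k2 hB)
  rw [integral_strip (hi 0 h0I) (hi d hdI)]
  let J : ℝ → ℤ → ℝ := fun c m =>
    ∫ x, inner ℝ (u x) (dualKernel 0 v (x - (y + (2 * d * m) • octE 0))) ∂hyperplaneMeasure c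
  have hJ0 : ∀ m : ℤ, ∫ x, inner ℝ (u x) (stripTerm d y v m x) ∂hyperplaneMeasure 0 =
      -((-1) ^ m * J 0 m) := fun m => by
    rw [← integral_const_mul, ← integral_neg]
    refine integral_congr_ae ?_
    filter_upwards [ae_hyperplane 0] with x hx
    rw [stripTerm_of_apply_zero_eq y v m m (by rw [hx]; ring), inner_neg_right, inner_smul_right]
  have hJd : ∀ m : ℤ, ∫ x, inner ℝ (u x) (stripTerm d y v (m - 1) x) ∂hyperplaneMeasure d =
      (-1) ^ m * J d m := fun m => by
    rw [← integral_const_mul]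
    refine integral_congr_ae ?_
    filter_upwards [ae_hyperplane d] with x hx
    rw [stripTerm_of_apply_zero_eq y v (m - 1) m (by rw [hx]; push_cast; ring), inner_neg_right,
      inner_smul_right, zpow_sub_one₀ (by norm_num)]
    ring
  have hs0 := hasSum_integral_stripTerm h0I hy v (memLp_hyperplane h0I h2 hC)
  have hsd := hasSum_integral_stripTerm hdI hy v (memLp_hyperplane hdI h2 hC)
  -- Reindexing the upper face by m ↦ m − 1 aligns the poles of the two series.
  rw [← (Equiv.subRight (1 : ℤ)).hasSum_iff] at hsd
  have hs := hs0.add hsd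
  refine hs.unique ?_
  have hval : (fun m : ℤ => ∫ x, inner ℝ (u x) (stripTerm d y v m x) ∂hyperplaneMeasure 0 +
      ((fun n => ∫ x, inner ℝ (u x) (stripTerm d y v n x) ∂hyperplaneMeasure d) ∘
        (Equiv.subRight (1 : ℤ))) m) =
      fun m => if m = 0 then Real.pi ^ 4 / 3 * inner ℝ (u y) v else 0 := by
    ext1 m
    simp only [Function.comp_apply, Equiv.subRight_apply]
    rw [hJ0, hJd]
    split_ifs with hm
    · have := slab_cauchy h2 h1 hC hy v
      rw [← this, hm]
      simp only [J, Int.cast_zero, mul_zero, zero_smul, add_zero, zpow_zero, one_mul]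
      ring
    · have hpole : ∀ x ∈ closedSlab 0 d, d ≤ ‖x - (y + (2 * d * m) • octE 0)‖ := fun x hx =>
        strip_pole_dist hy hm hx
      have hne : ∀ x ∈ closedSlab 0 d,
          (0 : ℝ) ^ 2 + ‖x - (y + (2 * d * m) • octE 0)‖ ^ 2 ≠ 0 := fun x hx => by
        have := hd.trans_le (hpole x hx)
        positivity
      have := slab_orthogonal hd.le (by positivity) h2 h1 hC
        (W := fun x => dualKernel 0 v (x - (y + (2 * d * m) • octE 0)))
        (fun x hx => (hasFDerivAt_dualKernel_sub (hne x hx) v).continuousAt.continuousWithinAt)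
        (fun x hx => by
          have hx' := openSlab_subset_closedSlab _ _ hx
          refine ⟨_, hasFDerivAt_dualKernel_sub (hne x hx') v, ?_⟩
          rw [crBarSymbol_fderiv_dualKernel (hne x hx')]
          simp)
        (fun x hx => norm_dualKernel_le_decay hd (hpole x hx) 0 v)
      have h3 : J d m = J 0 m := this
      rw [h3]
      ring
  rw [hval]
  exact hasSum_ite_eq 0 _

/-! ### Convexity of the norms on slices -/

/-- The map x ↦ −x̄ reverses only the real axis, and ēᵢ A(−ēᵢ) = −eᵢ A(eᵢ) for every i. Composition
with this reflection therefore exchanges the equation of left monogenic functions with its dual. -/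
lemma crBarSymbol_comp_neg_oconjL (A : Oct →L[ℝ] Oct) :
    crBarSymbol (A.comp (-oconjL)) = -crSymbol A := by
  rw [crBarSymbol_apply, crSymbol_apply, ← Finset.sum_neg_distrib]
  refine Finset.sum_congr rfl fun i _ => ?_
  have h : oconj (octE i) = octE i ∨ oconj (octE i) = -octE i := by
    rcases eq_or_ne i 0 with rfl | hi
    · exact Or.inl oconj_one
    · exact Or.inr (oconj_of_apply_zero (by rw [octE_apply]; simp [hi.symm]))
  rcases h with h | h <;>
    simp [ContinuousLinearMap.comp_apply, h, omul_neg, neg_omul]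

lemma norm_sq_slice_midpoint_le {d A : ℝ} (hd : 0 < d) (hA : 0 ≤ A) {w : Oct → Oct}
    (hw : IsHardyCore (strip d) w) (hwd : ∀ x ∈ closedSlab 0 d, ‖w x‖ ≤ A * decay x) {s t : ℝ}
    (hs : 0 ≤ s) (hst : s ≤ t) (ht : t ≤ d) :
    ∫ x, ‖w x‖ ^ 2 ∂hyperplaneMeasure ((s + t) / 2) ≤
      (∫ x, ‖w x‖ ^ 2 ∂hyperplaneMeasure s + ∫ x, ‖w x‖ ^ 2 ∂hyperplaneMeasure t) / 2 := by
  obtain ⟨h1, h2, C, hC⟩ := (isHardyCore_strip_iff hd).1 hw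
  have hL : ∀ c ∈ Icc 0 d, MemLp w 2 (hyperplaneMeasure c) := fun c hc => memLp_hyperplane hc h2 hC
  let ρ : Oct → Oct := fun x => (s + t) • octE 0 - oconj x
  have hρ0 : ∀ x : Oct, ρ x 0 = s + t - x 0 := fun x => by simp [ρ]
  have hρslice : ∀ (c : ℝ) (ξ : Fin 7 → ℝ), ρ (slicePt c ξ) = slicePt (s + t - c) ξ := fun c ξ => by
    ext i
    fin_cases i <;> simp [ρ, slicePt, oconj, octE, Fin.cons] <;> rfl
  have hρc : Continuous ρ := continuous_const.sub continuous_oconj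
  have hρd : ∀ x, HasFDerivAt ρ (-oconjL) x := fun x => oconjL.hasFDerivAt.const_sub _
  have hm : s ≤ (s + t) / 2 ∧ (s + t) / 2 ≤ t := ⟨by linarith, by linarith⟩
  have hmaps : ∀ x ∈ closedSlab s ((s + t) / 2), ρ x ∈ closedSlab 0 d := fun x hx =>
    ⟨by rw [hρ0]; linarith [hx.2], by rw [hρ0]; linarith [hx.1]⟩
  have hmaps' : ∀ x ∈ openSlab s ((s + t) / 2), ρ x ∈ openSlab 0 d := fun x hx =>
    ⟨by rw [hρ0]; linarith [hx.2], by rw [hρ0]; linarith [hx.1]⟩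
  -- Pairing w with its reflection over the slab from s to the midpoint: the right face pairs the
  -- middle slice with itself, the left face pairs slice s with slice t.
  have key := slab_orthogonal (W := fun x => w (ρ x)) (A := A * (1 + (s + t)) ^ 4) hm.1
    (by positivity) (h2.mono fun x hx => ⟨hs.trans hx.1, by linarith [hx.2]⟩)
    (h1.mono fun x hx => ⟨hs.trans_lt hx.1, by linarith [hx.2]⟩)
    (C := C) (fun c hc => hC c ⟨hs.trans hc.1, by linarith [hc.2]⟩)
    (h2.comp hρc.continuousOn hmaps)
    (fun x hx => by
      have h3 := (h1.hasFDerivAt (isOpen_openSlab 0 d) (hmaps' x hx)).comp x (hρd x)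
      refine ⟨_, h3, ?_⟩
      rw [crBarSymbol_comp_neg_oconjL, h1.crSymbol_eq_zero (hmaps' x hx), neg_zero])
    (fun x hx => by
      refine (hwd _ (hmaps x hx)).trans ?_
      rw [mul_assoc]
      gcongr
      refine decay_le_of_norm_le (by linarith) ?_
      have h3 : oconj x = (s + t) • octE 0 - ρ x := by simp [ρ]
      rw [← norm_oconj, h3]
      refine (norm_sub_le _ _).trans (le_of_eq ?_)
      rw [norm_smul, norm_octE, Real.norm_of_nonneg (by linarith), mul_one])
  simp only [integral_hyperplane, hρslice] at key ⊢
  rw [show s + t - (s + t) / 2 = (s + t) / 2 by ring, show s + t - s = t by ring] at key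
  simp only [real_inner_self_eq_norm_sq] at key
  rw [key]
  have hV : ∀ c ∈ Icc 0 d, MemLp (fun ξ => w (slicePt c ξ)) 2 volume := fun c hc =>
    (measurableEmbedding_slicePt c).memLp_map_measure_iff.1 (hL c hc)
  exact integral_inner_le_average (hV s ⟨hs, hst.trans ht⟩) (hV t ⟨hs.trans hst, ht⟩)

/-- The auxiliary point may depend on x; iterating a choice of it reduces the claim to
`le_of_le_average`. -/
lemma le_of_exists_le_average {α : Type*} {f : α → ℝ} {b M : ℝ} (hM : ∀ x, f x ≤ M)
    (h : ∀ x, ∃ z, f x ≤ (b + f z) / 2) (x : α) : f x ≤ b := by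
  choose φ hφ using h
  refine le_of_le_average (a := fun n => f (φ^[n] x)) (fun n => ?_) (fun n => hM _)
  rw [Function.iterate_succ_apply']
  exact hφ _

/-- Every c in the strip is the midpoint of an endpoint and another slice: of 0 and 2c when c ≤ d/2,
of 2c − d and d otherwise. Midpoint convexity and a uniform bound on the slices then suffice. -/
lemma norm_sq_slice_le {d A : ℝ} (hd : 0 < d) (hA : 0 ≤ A) {w : Oct → Oct}
    (hw : IsHardyCore (strip d) w) (hwd : ∀ x ∈ closedSlab 0 d, ‖w x‖ ≤ A * decay x) {s : ℝ}
    (hs : s ∈ Icc 0 d) : ∫ x, ‖w x‖ ^ 2 ∂hyperplaneMeasure s ≤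
      ∫ x, ‖w x‖ ^ 2 ∂hyperplaneMeasure 0 + ∫ x, ‖w x‖ ^ 2 ∂hyperplaneMeasure d := by
  obtain ⟨h1, h2, C, hC⟩ := (isHardyCore_strip_iff hd).1 hw
  have hnn : ∀ c, 0 ≤ ∫ x, ‖w x‖ ^ 2 ∂hyperplaneMeasure c := fun c =>
    integral_nonneg fun x => by positivity
  refine le_of_exists_le_average (α := Icc 0 d)
    (f := fun c => ∫ x, ‖w x‖ ^ 2 ∂hyperplaneMeasure c) (M := C)
    (fun c => integral_norm_sq_le (memLp_hyperplane c.2 h2 hC).1 (hC c c.2)) ?_ ⟨s, hs⟩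
  rintro ⟨c, hc0, hcd⟩
  rcases le_total c (d / 2) with hc | hc
  · refine ⟨⟨2 * c, by linarith, by linarith⟩, ?_⟩
    have := norm_sq_slice_midpoint_le hd hA hw hwd (s := 0) (t := 2 * c) le_rfl (by linarith)
      (by linarith)
    rw [show (0 + 2 * c) / 2 = c by ring] at this
    refine this.trans ?_
    have := hnn d
    dsimp only
    linarith
  · refine ⟨⟨2 * c - d, by linarith, by linarith⟩, ?_⟩
    have := norm_sq_slice_midpoint_le hd hA hw hwd (s := 2 * c - d) (t := d) (by linarith)
      (by linarith) le_rfl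
    rw [show (2 * c - d + d) / 2 = c by ring] at this
    refine this.trans ?_
    have := hnn 0
    dsimp only
    linarith

/-! ### The Szegő system of the strip -/

/-- The pointwise decay is carried through the span because the reflected function must decay for
Cauchy's theorem on the unbounded slab. -/
lemma exists_bound_of_mem_kernelSpan_strip {d : ℝ} {w : Oct → Oct} (hd : 0 < d)
    (hw : w ∈ kernelSpan (strip d) (stripSystem d)) : IsHardyCore (strip d) w ∧
      ∃ A, 0 ≤ A ∧ ∀ x ∈ closedSlab 0 d, ‖w x‖ ≤ A * decay x := by
  refine Submodule.span_induction (p := fun w _ => IsHardyCore (strip d) w ∧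
      ∃ A, 0 ≤ A ∧ ∀ x ∈ closedSlab 0 d, ‖w x‖ ≤ A * decay x) ?_ ?_ ?_ ?_ hw
  · rintro _ ⟨y, hy, v, rfl⟩
    exact ⟨isHardyCore_stripSystem hd hy v, exists_stripSystem_le_of_mem hy v⟩
  · exact ⟨isHardyCore_zero _, 0, le_rfl, fun x _ => by simp⟩
  · rintro f g _ _ ⟨h1, A, hA, h2⟩ ⟨h3, B, hB, h4⟩
    refine ⟨(isRegularDomain_strip hd).core_add h1 h3, A + B, by positivity, fun x hx => ?_⟩
    rw [add_mul]
    exact (norm_add_le _ _).trans (add_le_add (h2 x hx) (h4 x hx))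
  · rintro c f _ ⟨h1, A, hA, h2⟩
    refine ⟨(isRegularDomain_strip hd).core_smul h1 c, ‖c‖ * A, by positivity, fun x hx => ?_⟩
    rw [Pi.smul_apply, norm_smul, mul_assoc]
    gcongr
    exact h2 x hx

/-- No summability is needed, as conjugation is a continuous linear equivalence; conjugate symmetry
of the strip kernel is claimed for all x and y. -/
lemma tsum_oconj (f : ℤ → Oct) : ∑' n, oconj (f n) = oconj (∑' n, f n) :=
  ((ContinuousLinearEquiv.equivOfInverse oconjL oconjL oconj_oconj oconj_oconj).map_tsum).symm

lemma stripTerm_eq (d : ℝ) (x y v : Oct) (n : ℤ) : stripTerm d y v n x =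
    (((-1 : ℝ) ^ n * (‖oconj x + y + (2 * d * n) • octE 0‖ ^ 8)⁻¹) •
      (oconj x + y + (2 * d * n) • octE 0)) ⬝ₒ v := by
  have h : oconj (x + oconj (y + (2 * d * n) • octE 0)) = oconj x + y + (2 * d * n) • octE 0 := by
    rw [oconj_add, oconj_oconj, add_assoc]
  rw [stripTerm, halfSpaceSystem, cauchyKernel, h, ← norm_oconj (x + _), h, smul_smul, smul_omul]

/-- Right multiplication by v is continuous and linear, so it passes through the convergent series.
The normals ±1 cancel without any regrouping of products, which makes this the boundary identity of
the strip. -/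
lemma stripKernel_omul {d : ℝ} {x y : Oct} (hx : x ∈ closedSlab 0 d) (hy : y ∈ openSlab 0 d)
    (v : Oct) : stripKernel d x y ⬝ₒ v = stripSystem d y v x := by
  have hs := summable_stripTerm hy (octE 0) hx
  have h1 : stripKernel d x y = ∑' n, stripTerm d y (octE 0) n x :=
    tsum_congr fun n => by rw [stripTerm_eq, omul_one]
  rw [h1]
  refine ((omulL.flip v).map_tsum hs).trans (tsum_congr fun n => ?_)
  simp only [ContinuousLinearMap.flip_apply, omulL_apply]
  rw [stripTerm_eq, stripTerm_eq, omul_one]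

/-- Treats both faces at once: σ is the sign of the inward direction, and dominated convergence uses
that the weight changes by a bounded factor under shifts shorter than d. -/
lemma tendsto_lintegral_strip_face {d c σ : ℝ} (hd : 0 < d) (hσ : |σ| = 1)
    (hc : ∀ s ∈ Ico 0 d, c + s * σ ∈ Icc 0 d) {w : Oct → Oct} (hw : ContinuousOn w (closedSlab 0 d))
    {A : ℝ} (hA : 0 ≤ A) (hwd : ∀ x ∈ closedSlab 0 d, ‖w x‖ ≤ A * decay x) :
    Tendsto (fun s : ℝ => ∫⁻ x, ‖w (x + (s * σ) • octE 0) - w x‖ₑ ^ 2 ∂hyperplaneMeasure c)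
      (𝓝[>] 0) (𝓝 0) := by
  have hmem : ∀ s ∈ Ico 0 d, ∀ x : Oct, x 0 = c → x + (s * σ) • octE 0 ∈ closedSlab 0 d :=
    fun s hs x hx => by
      have := hc s hs
      simp only [closedSlab, mem_ofPred_eq, PiLp.add_apply, PiLp.smul_apply, octE_zero_apply_zero,
        smul_eq_mul, mul_one, hx]
      exact this
  have h0 : ∀ x : Oct, x 0 = c → x ∈ closedSlab 0 d := fun x hx => by
    simpa using hmem 0 ⟨le_rfl, hd⟩ x hx
  refine tendsto_lintegral_of_le_decay (A := A * (1 + d) ^ 4 + A) ?_ ?_ ?_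
  · filter_upwards [Ioo_mem_nhdsGT hd] with s hs
    have h1 : AEStronglyMeasurable w (hyperplaneMeasure (c + s * σ)) :=
      aestronglyMeasurable_of_continuousOn (isClosed_closedSlab 0 d).measurableSet hw
        (ae_mem_closedSlab (hc s ⟨hs.1.le, hs.2⟩))
    refine (h1.comp_measurePreserving (measurePreserving_hyperplane_add c (s * σ))).sub ?_
    exact aestronglyMeasurable_of_continuousOn (isClosed_closedSlab 0 d).measurableSet hw
      ((ae_hyperplane c).mono h0)
  · filter_upwards [Ioo_mem_nhdsGT hd] with s hs
    filter_upwards [ae_hyperplane c] with x hx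
    have h1 : decay (x + (s * σ) • octE 0) ≤ (1 + d) ^ 4 * decay x := by
      refine decay_le_of_norm_le hd.le ?_
      have h2 : ‖(s * σ) • octE 0‖ ≤ d := by
        rw [norm_smul, norm_octE, Real.norm_eq_abs, abs_mul, hσ, abs_of_pos hs.1]
        linarith [hs.2]
      have h3 := norm_sub_le (x + (s * σ) • octE 0) ((s * σ) • octE 0)
      rw [add_sub_cancel_right] at h3
      linarith
    calc ‖w (x + (s * σ) • octE 0) - w x‖
        ≤ ‖w (x + (s * σ) • octE 0)‖ + ‖w x‖ := norm_sub_le _ _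
      _ ≤ A * ((1 + d) ^ 4 * decay x) + A * decay x := by
          refine add_le_add ((hwd _ (hmem s ⟨hs.1.le, hs.2⟩ x hx)).trans ?_) (hwd x (h0 x hx))
          gcongr
      _ = _ := by ring
  · filter_upwards [ae_hyperplane c] with x hx
    have h1 : ContinuousWithinAt (fun s : ℝ => w (x + (s * σ) • octE 0)) (Ico 0 d) 0 :=
      (hw.comp (f := fun s : ℝ => x + (s * σ) • octE 0) (s := Ico 0 d) (by fun_prop)
        fun s hs => hmem s hs x hx) 0 ⟨le_rfl, hd⟩
    have h2 := ((h1.mono Ioo_subset_Ico_self).tendsto.sub_const (w x))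
    rw [nhdsWithin_Ioo_eq_nhdsGT hd] at h2
    simpa using h2

theorem isSzegoSystem_strip {d : ℝ} (hd : 0 < d) :
    IsSzegoSystem (strip d) (stripKernel d) (stripSystem d) where
  toIsRegularDomain := isRegularDomain_strip hd
  conj_symm x y := by
    rw [stripKernel, ← tsum_oconj]
    refine tsum_congr fun n => ?_
    have h : oconj (oconj x + y + (2 * d * n) • octE 0) = oconj y + x + (2 * d * n) • octE 0 := by
      rw [oconj_add, oconj_add, oconj_oconj, oconj_smul, oconj_one, add_comm x]
    rw [oconj_smul, h, ← norm_oconj (oconj x + y + _), h]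
  core y hy v := isHardyCore_stripSystem hd hy v
  kernel_one y _ := by
    ext1 x
    exact tsum_congr fun n => by rw [stripTerm_eq, omul_one]
  boundary y hy v := by
    have h : ∀ n : Oct, n = octE 0 ∨ n = -octE 0 → ∀ s : Oct, oconj n ⬝ₒ ((n ⬝ₒ s) ⬝ₒ v) = s ⬝ₒ v := by
      rintro n (rfl | rfl) s <;> simp [oconj_neg, neg_omul, omul_neg]
    have h2 : ∀ x, (strip d).normal x = octE 0 ∨ (strip d).normal x = -octE 0 := fun x => by
      simp only [strip]
      split_ifs <;> simp
    have h3 : ∀ x ∈ closedSlab 0 d, oconj ((strip d).normal x) ⬝ₒ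
        (((strip d).normal x ⬝ₒ stripKernel d x y) ⬝ₒ v) = stripSystem d y v x := fun x hx => by
      rw [h _ (h2 x), stripKernel_omul hx hy]
    exact ae_strip_iff.2 ⟨(ae_mem_closedSlab ⟨le_rfl, hd.le⟩).mono h3,
      (ae_mem_closedSlab ⟨hd.le, le_rfl⟩).mono h3⟩
  reproducing u hu y hy v := strip_reproducing hd hu hy v
  loc_bound y hy := by
    obtain ⟨δ, hδ, hδy⟩ := exists_margin hy
    obtain ⟨A, hA, h⟩ := exists_stripSystem_le (d := d) (Y := ‖y‖ + δ) hδ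
    refine ⟨Metric.ball y δ, Metric.ball_mem_nhds y hδ,
      Real.toNNReal A * (eLpNorm decay 2 (strip d).surface).toNNReal, fun z hz v => ?_⟩
    have hzy : ‖z - y‖ < δ := mem_ball_iff_norm.1 hz.1
    have hzn : ‖z‖ ≤ ‖y‖ + δ := by
      have : ‖z‖ ≤ ‖z - y‖ + ‖y‖ := by simpa using norm_add_le (z - y) y
      linarith
    have hb : ∀ x ∈ closedSlab 0 d, ‖stripSystem d z v x‖ ≤ A * ‖v‖ * ‖decay x‖ := fun x hx => by
      obtain ⟨h1, h2⟩ := hδy x hx z hzy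
      rw [Real.norm_of_nonneg (decay_pos x).le]
      exact h h1 h2 hzn v
    refine (eLpNorm_le_mul_eLpNorm_of_ae_le_mul (ae_strip_iff.2
      ⟨(ae_mem_closedSlab ⟨le_rfl, hd.le⟩).mono hb,
        (ae_mem_closedSlab ⟨hd.le, le_rfl⟩).mono hb⟩) 2).trans (le_of_eq ?_)
    rw [ENNReal.coe_mul, ENNReal.coe_toNNReal (memLp_strip (memLp_decay 0) (memLp_decay d)).2.ne,
      ENNReal.ofReal_mul hA, ofReal_norm, mul_right_comm]
    rfl
  contraction := by
    -- Each of the two slices is bounded by the sum over both faces, giving a factor 2 for squared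
    -- norms; the constant 2 supplies the larger factor 4.
    refine ⟨2, ?_⟩
    filter_upwards [Ioo_mem_nhdsGT hd] with s hs w hw
    obtain ⟨hwc, A, hA, hwd⟩ := exists_bound_of_mem_kernelSpan_strip hd hw
    obtain ⟨h1, h2, C, hC⟩ := (isHardyCore_strip_iff hd).1 hwc
    have hI : ∀ c ∈ Icc 0 d, MemLp w 2 (hyperplaneMeasure c) := fun c hc =>
      memLp_hyperplane hc h2 hC
    have hsI : s ∈ Icc 0 d := ⟨hs.1.le, hs.2.le⟩
    have hsI' : d - s ∈ Icc 0 d := ⟨by linarith [hs.2], by linarith [hs.1]⟩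
    have hnn : ∀ c, 0 ≤ ∫ x, ‖w x‖ ^ 2 ∂hyperplaneMeasure c := fun c =>
      integral_nonneg fun x => by positivity
    have hsq : ∀ c ∈ Icc 0 d, eLpNorm w 2 (hyperplaneMeasure c) ^ 2 =
        ENNReal.ofReal (∫ x, ‖w x‖ ^ 2 ∂hyperplaneMeasure c) := fun c hc => by
      rw [eLpNorm_two_sq, ofReal_integral_eq_lintegral_ofReal (integrable_norm_sq_of_memLp (hI c hc))
        (Eventually.of_forall fun x => by positivity)]
      refine lintegral_congr fun x => ?_
      rw [ENNReal.ofReal_pow (norm_nonneg _), ofReal_norm]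
    have h0I : (0 : ℝ) ∈ Icc 0 d := ⟨le_rfl, hd.le⟩
    have hdI : d ∈ Icc 0 d := ⟨hd.le, le_rfl⟩
    refine (ENNReal.pow_le_pow_left_iff two_ne_zero).1 ?_
    rw [mul_pow, eLpNorm_two_sq, lintegral_parallel_strip hd, eLpNorm_two_sq, lintegral_strip,
      ← eLpNorm_two_sq, ← eLpNorm_two_sq, ← eLpNorm_two_sq, ← eLpNorm_two_sq, hsq s hsI,
      hsq _ hsI', hsq 0 h0I, hsq d hdI, ← ENNReal.ofReal_add (hnn _) (hnn _),
      ← ENNReal.ofReal_add (hnn _) (hnn _)]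
    have hc4 : ((2 : ℝ≥0) : ℝ≥0∞) ^ 2 = ENNReal.ofReal 4 := by norm_num
    rw [hc4, ← ENNReal.ofReal_mul (by norm_num)]
    refine ENNReal.ofReal_le_ofReal ?_
    have h3 := norm_sq_slice_le hd hA hwc hwd hsI
    have h4 := norm_sq_slice_le hd hA hwc hwd hsI'
    have := hnn 0
    have := hnn d
    linarith
  approach y hy v := by
    obtain ⟨A, hA, hwd⟩ := exists_stripSystem_le_of_mem hy v
    have hw := ((isHardyCore_strip_iff hd).1 (isHardyCore_stripSystem hd hy v)).2.1
    refine tendsto_eLpNorm_of_tendsto_lintegral ?_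
    have h1 := tendsto_lintegral_strip_face hd (c := 0) (σ := 1) (by norm_num)
      (fun s hs => ⟨by linarith [hs.1], by linarith [hs.2]⟩) hw hA hwd
    have h2 := tendsto_lintegral_strip_face hd (c := d) (σ := -1) (by norm_num)
      (fun s hs => ⟨by linarith [hs.2], by linarith [hs.1]⟩) hw hA hwd
    have h3 := h1.add h2
    rw [add_zero] at h3
    refine h3.congr fun s => ?_
    rw [lintegral_strip]
    congr 1
    · refine lintegral_congr_ae ?_
      filter_upwards [ae_hyperplane 0] with x hx
      rw [sub_smul_normal_strip_zero d s hx, mul_one]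
    · refine lintegral_congr_ae ?_
      filter_upwards [ae_hyperplane d] with x hx
      rw [sub_smul_normal_strip hd s hx, mul_neg_one]

/-! ### The three domains together -/

theorem mainTheorem4 (D : HardyDomain) (S : Oct → Oct → Oct)
    (hDS : (D = unitBall ∧ S = ballKernel) ∨ (D = halfSpace ∧ S = halfSpaceKernel) ∨
      ∃ d : ℝ, 0 < d ∧ D = strip d ∧ S = stripKernel d) :
    (∀ x y : Oct, oconj (S x y) = S y x) ∧
    (∀ i : Fin 8, IsComponentKernel D i S) ∧
    ∃ P : BoundaryL2 D →L[ℝ] BoundaryL2 D,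
      (∀ f : BoundaryL2 D,
        HasBoundaryValue D (totalSzego D (fun _ => S) f) (P f) ∧
        IsHardyExtension D (P f) (totalSzego D (fun _ => S) f)) ∧
      (∀ f g : BoundaryL2 D, compInner D 0 (P f) g = compInner D 0 f (P g)) ∧
      (∀ f : BoundaryL2 D, P (P f) = P f) ∧
      Set.range P = hardySpace D ∧
      (∀ f h : BoundaryL2 D, h ∈ hardySpace D → compInner D 0 (fun x => f x - P f x) h = 0) := by
  rcases hDS with ⟨rfl, rfl⟩ | ⟨rfl, rfl⟩ | ⟨d, hd, rfl, rfl⟩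
  · exact isSzegoSystem_unitBall.main
  · exact isSzegoSystem_halfSpace.main
  · exact (isSzegoSystem_strip hd).main
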